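/- **Setting.** A Markov decision process (MDP) $M$ has a finite set $V$ of vertices, each of which is either a control vertex, with a nonempty set of successors in $V$, or a random vertex $v$, with a probability distribution $\delta(v)$ on $V$ whose support is its set of successors. Let $T\subseteq V$ be a set of target vertices, all of them sinks (the only successor of $t\in T$ is $t$). In the bidding game on $M$ the reachability player has budget $B\in[0,1]$ and the safety player has budget $1-B$. At a control vertex both players simultaneously bid at most their budgets; the higher bidder (the reachability player in case of a tie) pays the bid to the other player and moves the token to a successor; at a random vertex the token moves according to $\delta$. A policy maps the player's available budget and the finite path so far to a bid and a successor. $\Pi_{\mathsf R}(B,p,v)$ (resp. $\Pi_{\mathsf S}(B,p,v)$) is the set of policies of the reachability (resp. safety) player that guarantee, against all policies of the opponent, that $T$ is eventually reached from $v$ with probability $\ge p$ (resp. $\le p$). The threshold $\mathit{Th}_v$ is the set of all $(B,p)\in[0,1]^2$ such that, for $(B',p')\in[0,1]^2$, $\Pi_{\mathsf R}(B',p',v)\ne\emptyset$ whenever $B'>B$, $p'<p$, and $\Pi_{\mathsf S}(B',p',v)\neq\emptyset$ whenever $B'<B$, $p'>p$. The quantitative reachability problem asks, for $j\in\{\mathsf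 R,\mathsf S\}$, $v\in V$ and $(B,p)\in[0,1]^2$, whether $\Pi_j(B,p,v)\neq\emptyset$. Let $\mathsf{r}^0_v=[0,1]^2$ and $\mathsf{s}^0_v=[0,1]\times\{1\}\cup\{0\}\times[0,1]$ if $v\in T$, and $\mathsf{r}^0_v=[0,1]\times\{0\}\cup\{1\}\times[0,1]$ and $\mathsf{s}^0_v=[0,1]^2$ otherwise. For $\mathsf{x}\in\{\mathsf r,\mathsf s\}$, let $\mathsf{x}^{i+1}_v$ be, for random $v$, the set of all $(B,\sum_w\delta(v)(w)\,p_w)$ with $B\in[0,1]$ and $(B,p_w)\in\mathsf{x}^i_w$ for all successors $w$ of $v$, and, for control $v$, the set of all $(\frac{B_++B_-}{2},p)$ with $p\in[0,1]$, $(B_+,p)\in\mathsf{x}^i_w$ for all successors $w$ of $v$, and $(B_-,p)\in \mathsf{x}^i_w$ for some successor $w$ of $v$. Let $\mathsf{r}^*_v=\overline{\bigcup_i\mathsf{r}^i_v}$ and $\mathsf{s}^*_v=\bigcap_i\mathsf{s}^i_v$. Let $d_\infty$ be the maximum-metric distance. The distance of $(B,p)$ from $v$'s threshold is $d_\infty((B,p),\mathsf{s}^*_v)$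 if $(B,p)\in\mathsf{r}^*_v$, and $d_\infty((B,p),\mathsf{r}^*_v)$ otherwise. Let $\delta_{\min}$ be the minimum positive transition probability of the random vertices, or $\frac12$ if no transition is properly probabilistic. Interiors are relative to $[0,1]^2$. The algorithm $\mathsf{AlgExact}$, on input $(M,v,T,B,p)$, repeats for $i=0,1,2,\dots$: (1) if $(B,p)\in\mathsf{r}^i_v$, it stops and returns $\mathsf R$; (2) otherwise, if $d_\infty((B,p),\mathsf{r}^i_v)>2e^{-i\,\delta_{\min}^{2|V|}/(4|V|)}$, it stops and returns $\mathsf S$. The sets $\mathsf{r}^i_v$ are stored as finite lists of corner points: a list represents the set of all $(B,p)\in[0,1]^2$ with $b\le B$ and $p\le q$ for some $(b,q)$ in it. Time is the number of elementary steps and space the number of memory cells on a random access machine with unit cost real arithmetic (including comparison and $\exp$). **Theorem.** $\mathsf{AlgExact}$ is a semi-decision procedure for the quantitative reachability problem, in the sense that on every input on which it stops its answer is correct: if it returns $\mathsf R$ then $(B,p)\in\mathsf{r}^*_v$ and, provided $B<1$, $\Pi_{\mathsf R}(B,p,v)\ne\emptyset$; if it returns $\mathsf S$ then $(B,p)$ is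 in the interior of $\mathsf{s}^*_v$, $\Pi_{\mathsf S}(B,p,v)\neq\emptyset$ and $\Pi_{\mathsf R}(B,p,v)=\emptyset$. If $(B,p)\notin\mathit{Th}_v$, then it is a sound and complete algorithm: it stops and returns some $j\in\{\mathsf R,\mathsf S\}$, $(B,p)$ is in the interior of $\mathsf{r}^*_v$ if $j=\mathsf R$ and of $\mathsf{s}^*_v$ if $j=\mathsf S$, and $\Pi_j(B,p,v)$ is nonempty while the other player's set of winning policies is empty. Moreover, there is a constant $C$ such that, whenever the distance of $(B,p)$ from $v$'s threshold is $\epsilon>0$, with $$N=\log(2/\epsilon)\,|V|\,\delta_{\min}^{-2|V|},$$ $\mathsf{AlgExact}$ stops after at most $C\,N$ iterations, and its implementation on lists of corner points, which returns the same answers in the same iterations, needs time and space at most $\max(|V|,2)^{C N}$. -/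

import Mathlib

open MeasureTheory ProbabilityTheory Topology

noncomputable section

namespace BiddingGame

/-! ## Markov decision processes -/

/-- The kind of a vertex. A control vertex carries its (nonempty) set of successors, a random
vertex carries a probability distribution on the vertices. -/
inductive Node (V : Type*) [Fintype V]
  | control (E : Finset V) (hE : E.Nonempty)
  | random (δ : stdSimplex ℝ V)

/-- A Markov decision process with vertex set `V`: every vertex is either a control vertex or a
random vertex. -/
structure MDP (V : Type*) [Fintype V] where
  node : V → Node V

section MDPBasics

variable {V : Type*} [Fintype V]

def MDP.IsControl (M : MDP V) (v : V) : Prop :=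
  match M.node v with
  | .control _ _ => True
  | .random _ => False

/-- The transition probability from `v` to `w`; it is `0` if `v` is a control vertex. -/
def MDP.prob (M : MDP V) (v w : V) : ℝ :=
  match M.node v with
  | .control _ _ => 0
  | .random δ => δ.1 w

/-- The successors of a vertex. -/
def MDP.succ (M : MDP V) (v : V) : Finset V :=
  match M.node v with
  | .control E _ => E
  | .random δ => Finset.univ.filter fun w => 0 < δ.1 w

def MDP.IsSink (M : MDP V) (v : V) : Prop := M.succ v = {v}

/-- The minimum transition probability. Putting `1/2` into the set has an effect only if no
transition is properly probabilistic, in which case the value is `1/2`: otherwise some positive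
transition probability is at most `1/2` anyway. -/
def MDP.deltaMin (M : MDP V) : ℝ :=
  sInf (insert (1 / 2) {x : ℝ | 0 < x ∧ ∃ v w, M.prob v w = x})

end MDPBasics

/-! ## Policies and the probability measure on infinite paths -/

/-- Finite sequences `v⁰ … vⁿ` of vertices. -/
abbrev FinPath (V : Type*) (n : ℕ) : Type _ := (i : Finset.Iic n) → V

def FinPath.last {V : Type*} {n : ℕ} (ρ : FinPath V n) : V :=
  ρ ⟨n, Finset.mem_Iic.2 le_rfl⟩

def FinPath.init {V : Type*} {n : ℕ} (ρ : FinPath V (n + 1)) : FinPath V n :=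
  fun i => ρ ⟨i.1, Finset.mem_Iic.2 ((Finset.mem_Iic.1 i.2).trans n.le_succ)⟩

section Policies

variable {V : Type*} [Fintype V]

/-- A policy maps the available budget of its player and the finite path so far, if that ends in a
control vertex, to a legal bid and a successor of the last vertex. Values at other arguments are
never used. -/
structure Policy (M : MDP V) where
  act : ℝ → (n : ℕ) → FinPath V n → ℝ × V
  bid_nonneg : ∀ b ∈ Set.Icc (0 : ℝ) 1, ∀ n (ρ : FinPath V n),
    M.IsControl ρ.last → 0 ≤ (act b n ρ).1
  bid_le : ∀ b ∈ Set.Icc (0 : ℝ) 1, ∀ n (ρ : FinPath V n),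
    M.IsControl ρ.last → (act b n ρ).1 ≤ b
  move_mem : ∀ b ∈ Set.Icc (0 : ℝ) 1, ∀ n (ρ : FinPath V n),
    M.IsControl ρ.last → (act b n ρ).2 ∈ M.succ ρ.last

variable {M : MDP V}

/-- One bidding after the path `ρ`, where the reachability player has budget `b` and the safety
player has budget `1 - b`: the vertex the token moves to, and the new budget of the reachability
player. The higher bidder pays the bid to the other player and moves the token; ties go to the
reachability player. -/
def bidding (σ τ : Policy M) (b : ℝ) (n : ℕ) (ρ : FinPath V n) : V × ℝ :=
  if (τ.act (1 - b) n ρ).1 ≤ (σ.act b n ρ).1 then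
    ((σ.act b n ρ).2, b - (σ.act b n ρ).1)
  else
    ((τ.act (1 - b) n ρ).2, b + (τ.act (1 - b) n ρ).1)

/-- The budget of the reachability player after the path `ρ`, with initial budget `B`. -/
def budget (σ τ : Policy M) (B : ℝ) : (n : ℕ) → FinPath V n → ℝ
  | 0, _ => B
  | n + 1, ρ =>
    match M.node ρ.init.last with
    | .control _ _ => (bidding σ τ (budget σ τ B n ρ.init) n ρ.init).2
    | .random _ => budget σ τ B n ρ.init

/-- The scheduler induced by two policies and the initial budget. -/
def scheduler (σ τ : Policy M) (B : ℝ) (n : ℕ) (ρ : FinPath V n) : V :=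
  (bidding σ τ (budget σ τ B n ρ) n ρ).1

variable [MeasurableSpace V] [DiscreteMeasurableSpace V]

/-- The law of the next vertex after the path `ρ`, under the scheduler `θ`. -/
def nextLaw (M : MDP V) (θ : (n : ℕ) → FinPath V n → V) (n : ℕ) (ρ : FinPath V n) : Measure V :=
  match M.node ρ.last with
  | .control _ _ => Measure.dirac (θ n ρ)
  | .random δ => ∑ w, ENNReal.ofReal (δ.1 w) • Measure.dirac w

def stepKernel (M : MDP V) (θ : (n : ℕ) → FinPath V n → V) (n : ℕ) : Kernel (FinPath V n) V :=
  Kernel.ofFunOfCountable (nextLaw M θ n)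

instance (M : MDP V) (θ : (n : ℕ) → FinPath V n → V) (n : ℕ) :
    IsMarkovKernel (stepKernel M θ n) := by
  refine ⟨fun ρ => ⟨?_⟩⟩
  change nextLaw M θ n ρ Set.univ = 1
  unfold nextLaw
  split
  · simp
  · rename_i δ _
    simp only [Measure.coe_finsetSum, Finset.sum_apply, Measure.smul_apply, measure_univ,
      smul_eq_mul, mul_one]
    rw [← ENNReal.ofReal_sum_of_nonneg (fun w _ => δ.2.1 w), δ.2.2, ENNReal.ofReal_one]

/-- The probability measure on infinite sequences of vertices that start in `v`, when the players
use the policies `σ` (reachability) and `τ` (safety) and the reachability player has initial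
budget `B`. -/
def pathMeasure (σ τ : Policy M) (v : V) (B : ℝ) : Measure (ℕ → V) :=
  Kernel.traj (X := fun _ => V) (stepKernel M (scheduler σ τ B)) 0 (fun _ => v)

/-- The event that the set `T` is eventually visited. -/
def Reach (T : Finset V) : Set (ℕ → V) := {ω | ∃ i, ω i ∈ T}

inductive Player
  | reach
  | safe

/-- The winning policies of a player for the initial configuration `(v, B)`, the target `T` and
the required probability `p`. -/
def winning (M : MDP V) (T : Finset V) (v : V) (B p : ℝ) : Player → Set (Policy M)
  | .reach => {σ | ∀ τ : Policy M, p ≤ (pathMeasure σ τ v B).real (Reach T)}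
  | .safe => {τ | ∀ σ : Policy M, (pathMeasure σ τ v B).real (Reach T) ≤ p}

/-- The unit square of pairs (budget, probability). The metric of `ℝ × ℝ` is the maximum metric. -/
def square : Set (ℝ × ℝ) := Set.Icc 0 1 ×ˢ Set.Icc 0 1

/-- The threshold of the vertex `v`. -/
def threshold (M : MDP V) (T : Finset V) (v : V) : Set (ℝ × ℝ) :=
  {x | x ∈ square ∧ ∀ y ∈ square,
    (x.1 < y.1 → y.2 < x.2 → (winning M T v y.1 y.2 .reach).Nonempty) ∧
    (y.1 < x.1 → x.2 < y.2 → (winning M T v y.1 y.2 .safe).Nonempty)}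

end Policies

/-! ## Value iteration -/

section ValueIteration

variable {V : Type*} [Fintype V]

/-- The operator of value iteration at the vertex `v`. -/
def bellman (M : MDP V) (val : V → Set (ℝ × ℝ)) (v : V) : Set (ℝ × ℝ) :=
  match M.node v with
  | .random δ => {x | x.1 ∈ Set.Icc (0 : ℝ) 1 ∧ ∃ q : V → ℝ,
      (∀ w ∈ M.succ v, (x.1, q w) ∈ val w) ∧ x.2 = ∑ w ∈ M.succ v, δ.1 w * q w}
  | .control E _ => {x | x.2 ∈ Set.Icc (0 : ℝ) 1 ∧ ∃ bplus bminus : ℝ,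
      (∃ w ∈ E, (bminus, x.2) ∈ val w) ∧ (∀ w ∈ E, (bplus, x.2) ∈ val w) ∧
      x.1 = (bplus + bminus) / 2}

variable [DecidableEq V]

/-- The reachability values. -/
def rval (M : MDP V) (T : Finset V) : ℕ → V → Set (ℝ × ℝ)
  | 0, v => if v ∈ T then square else Set.Icc 0 1 ×ˢ {0} ∪ {1} ×ˢ Set.Icc 0 1
  | i + 1, v => bellman M (rval M T i) v

/-- The safety values. -/
def sval (M : MDP V) (T : Finset V) : ℕ → V → Set (ℝ × ℝ)
  | 0, v => if v ∈ T then Set.Icc 0 1 ×ˢ {1} ∪ {0} ×ˢ Set.Icc 0 1 else square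
  | i + 1, v => bellman M (sval M T i) v

/-- The limit values of the two players. -/
def valStar (M : MDP V) (T : Finset V) (v : V) : Player → Set (ℝ × ℝ)
  | .reach => closure (⋃ i, rval M T i v)
  | .safe => ⋂ i, sval M T i v

/-- The interior relative to the unit square. -/
def squareInterior (S : Set (ℝ × ℝ)) : Set (ℝ × ℝ) := {x | x ∈ square ∧ S ∈ 𝓝[square] x}

open Classical in
/-- The distance of a point of the unit square from the threshold of `v`: its distance from the
limit value of the player to whose limit value it does not belong. -/
def thresholdDist (M : MDP V) (T : Finset V) (v : V) (x : ℝ × ℝ) : ℝ :=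
  if x ∈ valStar M T v .reach then Metric.infDist x (valStar M T v .safe)
  else Metric.infDist x (valStar M T v .reach)

end ValueIteration

/-! ## Problem instances and the algorithm -/

/-- A problem instance `(M, v, T, B, p)`, where the targets are sinks. -/
structure ProblemInstance (V : Type*) [Fintype V] where
  M : MDP V
  v : V
  T : Finset V
  sink : ∀ t ∈ T, M.IsSink t
  B : ℝ
  B_mem : B ∈ Set.Icc (0 : ℝ) 1
  p : ℝ
  p_mem : p ∈ Set.Icc (0 : ℝ) 1

namespace ProblemInstance

variable {V : Type*} [Fintype V] [DecidableEq V]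

def point (I : ProblemInstance V) : ℝ × ℝ := (I.B, I.p)

open Classical in
/-- What the `i`-th iteration of the algorithm returns; `none` means that the algorithm goes on to
the next iteration. -/
def verdict (I : ProblemInstance V) (i : ℕ) : Option Player :=
  if I.point ∈ rval I.M I.T i I.v then some .reach
  else if 2 * Real.exp (-((i * I.M.deltaMin ^ (2 * Fintype.card V)) / (4 * Fintype.card V)))
      < Metric.infDist I.point (rval I.M I.T i I.v) then some .safe
  else none

/-- The algorithm terminates in the `i`-th iteration (counted from `0`) and returns that the point
belongs to the player `j`. -/
def ReturnsAt (I : ProblemInstance V) (j : Player) (i : ℕ) : Prop :=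
  (∀ k < i, I.verdict k = none) ∧ I.verdict i = some j

end ProblemInstance

/-! ## An implementation with explicit time and space

The model is the random access machine with unit cost real arithmetic: an elementary step is one
arithmetic operation, one comparison, one maximum or minimum, one exponential, one access to the
input or to a table, the construction of one list cell, or one pass of loop control. A memory cell
holds a bounded number of values. Memory is never released, so that the number of written cells
bounds the memory in use. -/

/-- A result together with the number of elementary steps that led to it and the number of memory
cells written on the way. -/
structure Cost (α : Type*) where
  val : α
  time : ℕ
  space : ℕ

namespace Cost

/-- A value that is available already. -/
def ret {α : Type*} (x : α) : Cost α := ⟨x, 0, 0⟩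

/-- Sequential composition. -/
def andThen {α β : Type*} (x : Cost α) (f : α → Cost β) : Cost β :=
  ⟨(f x.val).val, x.time + (f x.val).time, x.space + (f x.val).space⟩

instance : Monad Cost where
  pure := ret
  bind := andThen

/-- One elementary step, whose result is written to a new memory cell. -/
def op {α : Type*} (x : α) : Cost α := ⟨x, 1, 1⟩

/-- One elementary comparison, used only for branching. -/
def test (P : Prop) [Decidable P] : Cost Bool := ⟨decide P, 1, 0⟩

/-- A loop over a list, with one step of loop control in each pass. -/
def fold {α β : Type*} (f : β → α → Cost β) : β → List α → Cost β
  | b, [] => ret b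
  | b, a :: l => andThen ⟨(), 1, 0⟩ fun _ => andThen (f b a) fun c => fold f c l

/-- Fills a table indexed by `V`; each entry costs one step and one cell on top of its own
computation. -/
def table {V α : Type*} [Fintype V] (f : V → Cost α) : Cost (V → α) :=
  ⟨fun v => (f v).val, ∑ v, ((f v).time + 1), ∑ v, ((f v).space + 1)⟩

end Cost

open Cost

/-- The list of corner points `(b, q)` of a staircase, which represents the set of all `(B, p)` in
the unit square with `b ≤ B` and `p ≤ q` for some corner. -/
abbrev Corners := List (ℝ × ℝ)

/-- The largest `q` with `(B, q)` in the represented set. -/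
def Corners.bestProb (G : Corners) (B : ℝ) : Cost ℝ :=
  fold (fun r c => do
    if ← test (c.1 ≤ B) then op (max r c.2) else return r) 0 G

/-- The least `b` with `(b, p)` in the represented set. -/
def Corners.leastBudget (G : Corners) (p : ℝ) : Cost ℝ :=
  fold (fun r c => do
    if ← test (p ≤ c.2) then op (min r c.1) else return r) 1 G

/-- Whether `(B, p)` belongs to the represented set. -/
def Corners.contains (G : Corners) (B p : ℝ) : Cost Bool :=
  fold (fun r c => do
    if ← test (c.1 ≤ B) then
      if ← test (p ≤ c.2) then op true else return r
    else return r) false G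

/-- The maximum metric distance of `(B, p)` from the represented set. -/
def Corners.dist (G : Corners) (B p : ℝ) : Cost ℝ :=
  fold (fun r c => do
    let x ← op (c.1 - B)
    let y ← op (p - c.2)
    let m ← op (max x y)
    let m ← op (max m 0)
    op (min r m)) 1 G

section Implementation

variable {V : Type*} [Fintype V] [DecidableEq V]

/-- The vertices in some order. -/
def vertices (V : Type*) [Fintype V] : List V := Finset.univ.toList

def initTable (T : Finset V) : Cost (V → Corners) :=
  table fun v => do
    if ← test (v ∈ T) then op [(0, 1)]
    else
      let l ← op [(1, 1)]
      op ((0, 0) :: l)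

/-- Averaging along the probability axis, at each corner budget of each vertex. -/
def stepRandom (δ : V → ℝ) (G : V → Corners) : Cost Corners :=
  fold (fun acc w => do
    let Gw ← op (G w)
    fold (fun acc c => do
      let q ← fold (fun s u => do
        let Gu ← op (G u)
        let r ← Gu.bestProb c.1
        let d ← op (δ u)
        let x ← op (d * r)
        op (s + x)) 0 (vertices V)
      op ((c.1, q) :: acc)) acc Gw) [] (vertices V)

/-- Averaging along the budget axis, at each corner probability of each successor. -/
def stepControl (E : Finset V) (G : V → Corners) : Cost Corners :=
  fold (fun acc w => do
    if ← test (w ∈ E) then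
      let Gw ← op (G w)
      fold (fun acc c => do
        let bminus ← fold (fun s u => do
          if ← test (u ∈ E) then
            let Gu ← op (G u)
            let b ← Gu.leastBudget c.2
            op (min s b)
          else return s) 1 (vertices V)
        let bplus ← fold (fun s u => do
          if ← test (u ∈ E) then
            let Gu ← op (G u)
            let b ← Gu.leastBudget c.2
            op (max s b)
          else return s) 0 (vertices V)
        let s ← op (bplus + bminus)
        let b ← op (s / 2)
        op ((b, c.2) :: acc)) acc Gw
    else return acc) [] (vertices V)

/-- One step of value iteration. -/
def stepTable (M : MDP V) (G : V → Corners) : Cost (V → Corners) :=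
  table fun v =>
    match M.node v with
    | .control E _ => stepControl E G
    | .random δ => stepRandom δ.1 G

def computeDeltaMin (M : MDP V) : Cost ℝ :=
  fold (fun r v =>
    match M.node v with
    | .control _ _ => ret r
    | .random δ => fold (fun r w => do
        let d ← op (δ.1 w)
        if ← test (0 < d) then op (min r d) else return r) r (vertices V)) (1 / 2) (vertices V)

/-- The radius `2 exp (- i δ ^ (2 n) / (4 n))`, where `δ` is the minimum probability and `n` the
number of vertices. -/
def computeRadius (M : MDP V) (i : ℕ) : Cost ℝ := do
  let d ← computeDeltaMin M
  let n ← fold (fun s _ => op (s + 1)) (0 : ℝ) (vertices V)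
  let pw ← fold (fun s _ => do
    let x ← op (s * d)
    op (x * d)) (1 : ℝ) (vertices V)
  let k ← op (i : ℝ)
  let x ← op (k * pw)
  let y ← op (4 * n)
  let z ← op (x / y)
  let z ← op (-z)
  let e ← op (Real.exp z)
  op (2 * e)

/-- The two tests of the `i`-th iteration, given the table of the `i`-th values. -/
def runTests (I : ProblemInstance V) (i : ℕ) (G : V → Corners) : Cost (Option Player) := do
  let Gv ← op (G I.v)
  if ← Gv.contains I.B I.p then op (some .reach)
  else
    let d ← Gv.dist I.B I.p
    let r ← computeRadius I.M i
    if ← test (r < d) then op (some .safe) else return none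

/-- The algorithm up to and including iteration `n`, stopped as soon as it returns an answer. The
result consists of the answer, if there is one, and the current table. -/
def ProblemInstance.run (I : ProblemInstance V) : ℕ → Cost (Option Player × (V → Corners))
  | 0 => andThen (initTable I.T) fun G => andThen (runTests I 0 G) fun a => ret (a, G)
  | n + 1 => andThen (I.run n) fun s =>
      match s.1 with
      | some _ => ret s
      | none => andThen (stepTable I.M s.2) fun G =>
          andThen (runTests I (n + 1) G) fun a => ret (a, G)

end Implementation

end BiddingGame

end

/-! A point `(b, p)` of a value is a promise: budget `b` suffices for probability `p`. One `bellman`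
step passes it on to the successors. At a control vertex a bid of half the excess of `bplus` over
`bminus` makes winning and losing equally acceptable; at a random vertex the promised probability is
preserved on average. Following the promises (`exists_tracking_policy`) therefore gives a policy
along which the promised probability is controlled in expectation. For reachability a promise in
`rval i` is redeemed after `i` steps (`reach_winning_of_mem_rval`). For safety the limit value lies
in its own image under `bellman`, by compactness, so its promises can be kept for ever
(`safe_winning_of_mem_valStar`). At each stage the two values cover the square
(`mem_rval_or_mem_sval`), so a point outside the safety limit already belongs to some `rval k`.

The speed of convergence is measured by hyperbolas. `HyperbolaBound` with constant `s` at `x` says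
that `rval i` contains every point whose budget advantage and probability advantage over `x` have
product at least `s`. With one advantage fixed, the other one required is linear in `s`, so both
kinds of averaging in `bellman` average the constants (`hyperbolaBound_of_derived`). A successor
with a better constant thus lowers the constant in proportion to its weight, which is at least
`deltaMin`. Every point of the reachability limit is linked to the initial values by at most `n =
Fintype.card V` favourable steps (`subset_reachWithin_card`), where the constant is zero. Hence `n`
iterations multiply the constant by at most `1 - deltaMin ^ n`, and the radius of the algorithm is
chosen so that its square dominates the resulting constant (`hyperbolaBound_radius`).

It follows that a point farther than the radius from `rval i` lies in the safety limit, together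
with its neighbours. Conversely, a point whose distance from the threshold exceeds the radius is
decided by one of the two tests (`verdict_ne_none_of_radius_lt`). For the cost, one step gives each
vertex at most as many corners as all vertices had together, so the total number grows at most by
the factor `n` per iteration. -/

noncomputable section

namespace BiddingGame

/-! ### Finite paths and a supermartingale bound for the path measure. -/

section PathMeasure

variable {V : Type*}

/-- The path `ρ`, prolonged by the vertex `w`. -/
def FinPath.snoc {k : ℕ} (ρ : FinPath V k) (w : V) : FinPath V (k + 1) :=
  fun i => if h : i.1 ≤ k then ρ ⟨i.1, Finset.mem_Iic.2 h⟩ else w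

@[simp] lemma FinPath.last_snoc {k : ℕ} (ρ : FinPath V k) (w : V) : (ρ.snoc w).last = w := by
  simp [FinPath.last, FinPath.snoc]

@[simp] lemma FinPath.init_snoc {k : ℕ} (ρ : FinPath V k) (w : V) : (ρ.snoc w).init = ρ := by
  funext i
  have : i.1 ≤ k := Finset.mem_Iic.1 i.2
  simp [FinPath.init, FinPath.snoc, this]

variable [Fintype V] [MeasurableSpace V] [DiscreteMeasurableSpace V] {M : MDP V}

lemma lintegral_partialTraj_succ_self (θ : (n : ℕ) → FinPath V n → V) (k : ℕ)
    (ρ : FinPath V k) (f : FinPath V (k + 1) → ENNReal) :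
    ∫⁻ η, f η ∂(Kernel.partialTraj (X := fun _ => V) (stepKernel M θ) k (k + 1) ρ) =
      ∫⁻ w, f (ρ.snoc w) ∂(nextLaw M θ k ρ) := by
  have hf : Measurable f := measurable_of_finite f
  rw [Kernel.partialTraj_succ_self, Kernel.lintegral_map _ (measurable_IicProdIoc (X := fun _ : ℕ => V)) _ hf,
    Kernel.lintegral_id_prod (by fun_prop),
    Kernel.lintegral_map _ (MeasurableEquiv.measurable _) _ (by fun_prop)]
  change ∫⁻ w, _ ∂(nextLaw M θ k ρ) = _
  refine lintegral_congr fun w => congrArg f ?_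
  funext i
  simp only [IicProdIoc, FinPath.snoc]
  split
  · rfl
  · have hi : i.1 = k + 1 := by have := Finset.mem_Iic.1 i.2; omega
    obtain ⟨i, hi'⟩ := i
    subst hi
    simp [MeasurableEquiv.piSingleton]

lemma lintegral_nextLaw_control {θ : (n : ℕ) → FinPath V n → V} {k : ℕ} {ρ : FinPath V k}
    {E : Finset V} {hE : E.Nonempty} (h : M.node ρ.last = .control E hE) (f : V → ENNReal) :
    ∫⁻ w, f w ∂(nextLaw M θ k ρ) = f (θ k ρ) := by
  simp [nextLaw, h]

lemma lintegral_nextLaw_random {θ : (n : ℕ) → FinPath V n → V} {k : ℕ} {ρ : FinPath V k}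
    {δ : stdSimplex ℝ V} (h : M.node ρ.last = .random δ) (f : V → ENNReal) :
    ∫⁻ w, f w ∂(nextLaw M θ k ρ) = ∑ w, ENNReal.ofReal (δ.1 w) * f w := by
  simp [nextLaw, h]

/-- A function of finite paths that does not increase in expectation bounds the probability of the
event that its value is at least one. -/
lemma traj_le_of_supermartingale (θ : (n : ℕ) → FinPath V n → V) (x₀ : FinPath V 0)
    (f : (k : ℕ) → FinPath V k → ENNReal)
    (hf : ∀ k ρ, ∫⁻ w, f (k + 1) (ρ.snoc w) ∂(nextLaw M θ k ρ) ≤ f k ρ)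
    (k : ℕ) (S : Set (FinPath V k)) (hS : ∀ ρ ∈ S, 1 ≤ f k ρ) :
    Kernel.traj (X := fun _ => V) (stepKernel M θ) 0 x₀
      {ω | Preorder.frestrictLe (π := fun _ => V) k ω ∈ S} ≤ f 0 x₀ := by
  have key : ∀ k, ∫⁻ ρ, f k ρ ∂(Kernel.partialTraj (X := fun _ => V) (stepKernel M θ) 0 k x₀)
      ≤ f 0 x₀ := by
    intro k
    induction k with
    | zero =>
      rw [Kernel.partialTraj_self, Kernel.id_apply, lintegral_dirac]
    | succ k ih =>
      rw [Kernel.partialTraj_succ_eq_comp (Nat.zero_le k),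
        Kernel.lintegral_comp _ _ _ (measurable_of_finite _)]
      refine le_trans (lintegral_mono fun ρ => ?_) ih
      rw [lintegral_partialTraj_succ_self]
      exact hf k ρ
  have hSm : MeasurableSet S := S.toFinite.measurableSet
  have h1 : Kernel.traj (X := fun _ => V) (stepKernel M θ) 0 x₀
      {ω | Preorder.frestrictLe (π := fun _ => V) k ω ∈ S} =
      Kernel.partialTraj (X := fun _ => V) (stepKernel M θ) 0 k x₀ S := by
    rw [← Kernel.traj_map_frestrictLe, Kernel.map_apply' _ (by fun_prop) _ hSm]
    rfl
  rw [h1]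
  calc _ = ∫⁻ ρ in S, 1 ∂(Kernel.partialTraj (X := fun _ => V) (stepKernel M θ) 0 k x₀) := by simp
    _ ≤ ∫⁻ ρ in S, f k ρ ∂(Kernel.partialTraj (X := fun _ => V) (stepKernel M θ) 0 k x₀) :=
        setLIntegral_mono' hSm hS
    _ ≤ _ := (setLIntegral_le_lintegral _ _).trans (key k)

/-- An invariant `Inv` together with a bounded quantity `val` that does not increase in expectation
as long as the invariant holds. -/
lemma pathMeasure_le_of_invariant (σ τ : Policy M) (v : V) (B : ℝ)
    (Inv : (k : ℕ) → FinPath V k → Prop) (val : (k : ℕ) → FinPath V k → ℝ)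
    (h0 : Inv 0 fun _ => v)
    (hval : ∀ k ρ, Inv k ρ → 0 ≤ val k ρ)
    (hcontrol : ∀ k ρ, Inv k ρ → M.IsControl ρ.last →
      Inv (k + 1) (ρ.snoc (scheduler σ τ B k ρ)) ∧
      val (k + 1) (ρ.snoc (scheduler σ τ B k ρ)) ≤ val k ρ)
    (hrandom : ∀ k ρ, Inv k ρ → ∀ δ, M.node ρ.last = .random δ →
      (∀ w, 0 < δ.1 w → Inv (k + 1) (ρ.snoc w)) ∧
      ∑ w, δ.1 w * val (k + 1) (ρ.snoc w) ≤ val k ρ)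
    (k : ℕ) (S : Set (FinPath V k)) (hS : ∀ ρ ∈ S, Inv k ρ → 1 ≤ val k ρ) :
    (pathMeasure σ τ v B).real {ω | Preorder.frestrictLe (π := fun _ => V) k ω ∈ S} ≤
      val 0 fun _ => v := by
  classical
  -- The value is `⊤` where `Inv` fails, so nothing has to be checked there; successors of
  -- probability zero do no harm because `0 * ⊤ = 0`.
  have := traj_le_of_supermartingale (M := M) (scheduler σ τ B) (fun _ => v)
    (fun k ρ => if Inv k ρ then ENNReal.ofReal (val k ρ) else ⊤) ?_ k S ?_
  · rw [if_pos h0] at this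
    exact ENNReal.toReal_le_of_le_ofReal (hval 0 _ h0) this
  · intro k ρ
    by_cases hI : Inv k ρ
    swap
    · simp [hI]
    rw [if_pos hI]
    cases hn : M.node ρ.last with
    | control E hE =>
      rw [lintegral_nextLaw_control hn]
      have := hcontrol k ρ hI (by simp [MDP.IsControl, hn])
      rw [if_pos this.1]
      exact ENNReal.ofReal_le_ofReal this.2
    | random δ =>
      rw [lintegral_nextLaw_random hn]
      obtain ⟨h1, h2⟩ := hrandom k ρ hI δ hn
      have hδ : ∀ w, 0 ≤ δ.1 w := δ.2.1
      calc _ = ∑ w, ENNReal.ofReal (δ.1 w * val (k + 1) (ρ.snoc w)) := by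
            refine Finset.sum_congr rfl fun w _ => ?_
            rcases (hδ w).eq_or_lt with h | h
            · simp [← h]
            · rw [if_pos (h1 w h), ENNReal.ofReal_mul (hδ w)]
        _ = ENNReal.ofReal (∑ w, δ.1 w * val (k + 1) (ρ.snoc w)) := by
            refine (ENNReal.ofReal_sum_of_nonneg fun w _ => ?_).symm
            rcases (hδ w).eq_or_lt with h | h
            · simp [← h]
            · exact mul_nonneg (hδ w) (hval _ _ (h1 w h))
        _ ≤ _ := ENNReal.ofReal_le_ofReal h2
  · intro ρ hρ
    split
    · rename_i hI
      exact ENNReal.one_le_ofReal.2 (hS ρ hρ hI)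
    · exact le_top

end PathMeasure

/-! ### The operator `bellman` on subsets of the square. -/

section Values

variable {V : Type*}

lemma mem_square {x : ℝ × ℝ} :
    x ∈ square ↔ (0 ≤ x.1 ∧ x.1 ≤ 1) ∧ (0 ≤ x.2 ∧ x.2 ≤ 1) := Iff.rfl

lemma isCompact_square : IsCompact square := isCompact_Icc.prod isCompact_Icc

lemma isClosed_exists_mem {X : Type*} [TopologicalSpace X] {val : V → Set (ℝ × ℝ)}
    (h : ∀ v, IsClosed (val v)) (E : Finset V) {f : X → ℝ × ℝ} (hf : Continuous f) :
    IsClosed {z | ∃ w ∈ E, f z ∈ val w} := by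
  have : {z | ∃ w ∈ E, f z ∈ val w} = ⋃ w ∈ E, f ⁻¹' val w := by ext; simp
  rw [this]
  exact isClosed_biUnion_finset fun w _ => (h w).preimage hf

lemma isClosed_forall_mem {X : Type*} [TopologicalSpace X] {val : V → Set (ℝ × ℝ)}
    (h : ∀ v, IsClosed (val v)) (P : V → Prop) {f : V → X → ℝ × ℝ} (hf : ∀ w, Continuous (f w)) :
    IsClosed {z | ∀ w, P w → f w z ∈ val w} := by
  have : {z | ∀ w, P w → f w z ∈ val w} = ⋂ w, ⋂ _ : P w, f w ⁻¹' val w := by ext; simp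
  rw [this]
  exact isClosed_iInter fun w => isClosed_iInter fun _ => (h w).preimage (hf w)

variable [Fintype V] {M : MDP V}

lemma sum_succ_eq {v : V} {δ : stdSimplex ℝ V} (h : M.node v = .random δ) (q : V → ℝ) :
    ∑ w ∈ M.succ v, δ.1 w * q w = ∑ w, δ.1 w * q w := by
  refine Finset.sum_subset (Finset.subset_univ _) fun w _ hw => ?_
  have : ¬ 0 < δ.1 w := by simpa [MDP.succ, h] using hw
  have h0 : δ.1 w = 0 := le_antisymm (not_lt.1 this) (δ.2.1 w)
  rw [h0, zero_mul]

lemma mem_bellman_random {v : V} {δ : stdSimplex ℝ V} (h : M.node v = .random δ)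
    {val : V → Set (ℝ × ℝ)} {x : ℝ × ℝ} :
    x ∈ bellman M val v ↔ x.1 ∈ Set.Icc (0 : ℝ) 1 ∧ ∃ q : V → ℝ,
      (∀ w, 0 < δ.1 w → (x.1, q w) ∈ val w) ∧ x.2 = ∑ w, δ.1 w * q w := by
  have h1 : x ∈ bellman M val v ↔ x.1 ∈ Set.Icc (0 : ℝ) 1 ∧ ∃ q : V → ℝ,
      (∀ w ∈ M.succ v, (x.1, q w) ∈ val w) ∧ x.2 = ∑ w ∈ M.succ v, δ.1 w * q w := by
    simp [bellman, h]
  simp only [h1, sum_succ_eq h]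
  simp [MDP.succ, h]

lemma mem_bellman_control {v : V} {E : Finset V} {hE : E.Nonempty}
    (h : M.node v = .control E hE) {val : V → Set (ℝ × ℝ)} {x : ℝ × ℝ} :
    x ∈ bellman M val v ↔ x.2 ∈ Set.Icc (0 : ℝ) 1 ∧ ∃ bplus bminus : ℝ,
      (∃ w ∈ E, (bminus, x.2) ∈ val w) ∧ (∀ w ∈ E, (bplus, x.2) ∈ val w) ∧
      x.1 = (bplus + bminus) / 2 := by
  simp [bellman, h]

lemma succ_control {v : V} {E : Finset V} {hE : E.Nonempty} (h : M.node v = .control E hE) :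
    M.succ v = E := by
  simp [MDP.succ, h]

lemma mem_succ_random {v : V} {δ : stdSimplex ℝ V} (h : M.node v = .random δ) {w : V} :
    w ∈ M.succ v ↔ 0 < δ.1 w := by
  simp [MDP.succ, h]

lemma bellman_mono {val val' : V → Set (ℝ × ℝ)} (h : ∀ v, val v ⊆ val' v) (v : V) :
    bellman M val v ⊆ bellman M val' v := by
  intro x hx
  cases hn : M.node v with
  | control E hE =>
    rw [mem_bellman_control hn] at hx ⊢
    obtain ⟨h2, bp, bm, ⟨w, hw, hm⟩, hp, hs⟩ := hx
    exact ⟨h2, bp, bm, ⟨w, hw, h _ hm⟩, fun w hw => h _ (hp w hw), hs⟩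
  | random δ =>
    rw [mem_bellman_random hn] at hx ⊢
    obtain ⟨h2, q, hq, hs⟩ := hx
    exact ⟨h2, q, fun w hw => h _ (hq w hw), hs⟩

lemma bellman_subset_square {val : V → Set (ℝ × ℝ)} (h : ∀ v, val v ⊆ square) (v : V) :
    bellman M val v ⊆ square := by
  intro x hx
  rw [mem_square]
  cases hn : M.node v with
  | control E hE =>
    rw [mem_bellman_control hn] at hx
    obtain ⟨h2, bp, bm, ⟨w, hw, hm⟩, hp, hs⟩ := hx
    have h3 := mem_square.1 (h _ hm)
    have h4 := mem_square.1 (h _ (hp w hw))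
    simp only at h3 h4
    exact ⟨by constructor <;> linarith, h2⟩
  | random δ =>
    rw [mem_bellman_random hn] at hx
    obtain ⟨h2, q, hq, hs⟩ := hx
    refine ⟨h2, ?_⟩
    rw [hs]
    have h3 : ∀ w, 0 ≤ δ.1 w * q w ∧ δ.1 w * q w ≤ δ.1 w := by
      intro w
      rcases (δ.2.1 w).eq_or_lt with h0 | h0
      · simp [← h0]
      · have := (mem_square.1 (h _ (hq w h0))).2
        simp only at this
        exact ⟨mul_nonneg h0.le this.1, mul_le_of_le_one_right h0.le this.2⟩
    exact ⟨Finset.sum_nonneg fun w _ => (h3 w).1,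
      (Finset.sum_le_sum fun w _ => (h3 w).2).trans δ.2.2.le⟩

lemma mem_bellman_of_forall_succ {val : V → Set (ℝ × ℝ)} {v : V} {x : ℝ × ℝ} (hx : x ∈ square)
    (h : ∀ w ∈ M.succ v, x ∈ val w) : x ∈ bellman M val v := by
  cases hn : M.node v with
  | control E hE =>
    rw [mem_bellman_control hn]
    rw [succ_control hn] at h
    obtain ⟨w, hw⟩ := hE
    exact ⟨hx.2, x.1, x.1, ⟨w, hw, h w hw⟩, h, by ring⟩
  | random δ =>
    rw [mem_bellman_random hn]
    refine ⟨hx.1, fun _ => x.2, fun w hw => h w ((mem_succ_random hn).2 hw), ?_⟩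
    rw [← Finset.sum_mul, δ.2.2, one_mul]

/-- Closed under increasing the budget and decreasing the probability, within the unit square. -/
def UpClosed (S : Set (ℝ × ℝ)) : Prop :=
  ∀ x ∈ S, ∀ y ∈ square, x.1 ≤ y.1 → y.2 ≤ x.2 → y ∈ S

lemma exists_smaller_average (δ : stdSimplex ℝ V) (q : V → ℝ) {p : ℝ} (hp0 : 0 ≤ p)
    (hp : p ≤ ∑ w, δ.1 w * q w) (hq : ∀ w, 0 < δ.1 w → 0 ≤ q w) :
    ∃ q' : V → ℝ, (∀ w, 0 < δ.1 w → 0 ≤ q' w ∧ q' w ≤ q w) ∧ p = ∑ w, δ.1 w * q' w := by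
  rcases hp0.eq_or_lt with h0 | h0
  · exact ⟨fun _ => 0, fun w hw => ⟨le_rfl, hq w hw⟩, by simp [← h0]⟩
  have hs : 0 < ∑ w, δ.1 w * q w := h0.trans_le hp
  refine ⟨fun w => q w * (p / ∑ w, δ.1 w * q w), fun w hw => ⟨?_, ?_⟩, ?_⟩
  · exact mul_nonneg (hq w hw) (div_nonneg hp0 hs.le)
  · exact mul_le_of_le_one_right (hq w hw) ((div_le_one hs).2 hp)
  · simp_rw [← mul_assoc, ← Finset.sum_mul]
    field_simp

/-- All witnesses are moved by one common contraction, budgets towards `1` or probabilities towards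
`0`. This commutes with averaging and moves each witness in a direction in which its set is closed.
-/
lemma upClosed_bellman {val : V → Set (ℝ × ℝ)} (hs : ∀ v, val v ⊆ square)
    (h : ∀ v, UpClosed (val v)) (v : V) : UpClosed (bellman M val v) := by
  intro x hx y hy h1 h2
  cases hn : M.node v with
  | control E hE =>
    rw [mem_bellman_control hn] at hx ⊢
    obtain ⟨h3, bp, bm, ⟨w, hw, hm⟩, hp, hx1⟩ := hx
    refine ⟨hy.2, ?_⟩
    obtain ⟨a1, a2⟩ := mem_square.1 hy
    have hm1 := (mem_square.1 (hs _ hm)).1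
    have hp1 := (mem_square.1 (hs _ (hp w hw))).1
    simp only at hm1 hp1
    set t := (1 - y.1) / (1 - x.1) with ht
    have ht0 : 0 ≤ t := div_nonneg (by linarith) (by linarith)
    have ht1 : t ≤ 1 := div_le_one_of_le₀ (by linarith) (by linarith)
    have hb : ∀ b : ℝ, 0 ≤ b → b ≤ 1 → b ≤ 1 - (1 - b) * t ∧ 1 - (1 - b) * t ≤ 1 := by
      intro b hb0 hb1
      constructor <;> nlinarith
    have hb1 := hb bm hm1.1 hm1.2
    have hb2 := hb bp hp1.1 hp1.2
    refine ⟨1 - (1 - bp) * t, 1 - (1 - bm) * t, ⟨w, hw, h _ _ hm _ ?_ hb1.1 h2⟩,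
      fun w hw => h _ _ (hp w hw) _ ?_ hb2.1 h2, ?_⟩
    · exact mem_square.2 ⟨⟨by simp only; linarith, hb1.2⟩, a2⟩
    · exact mem_square.2 ⟨⟨by simp only; linarith, hb2.2⟩, a2⟩
    -- If `x.1 = 1`, then `t = 0` by the convention for division by zero, and `y.1 = 1` as well.
    · have : (1 - x.1) * t = 1 - y.1 := by
        rcases eq_or_ne (1 - x.1) 0 with h0 | h0
        · rw [h0, zero_mul]; linarith
        · rw [ht]; field_simp
      rw [hx1] at this
      linarith
  | random δ =>
    rw [mem_bellman_random hn] at hx ⊢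
    obtain ⟨h3, q, hq, hx2⟩ := hx
    refine ⟨hy.1, ?_⟩
    rw [hx2] at h2
    obtain ⟨q', hq', he⟩ := exists_smaller_average δ q hy.2.1 h2
      fun w hw => (mem_square.1 (hs _ (hq w hw))).2.1
    refine ⟨q', fun w hw => h _ _ (hq w hw) _ ?_ h1 (hq' w hw).2, he⟩
    exact mem_square.2 ⟨hy.1, (hq' w hw).1,
      (hq' w hw).2.trans (mem_square.1 (hs _ (hq w hw))).2.2⟩

/-- The set is the continuous image of a compact set of witnesses. -/
lemma isClosed_bellman {val : V → Set (ℝ × ℝ)} (hs : ∀ v, val v ⊆ square)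
    (h : ∀ v, IsClosed (val v)) (v : V) : IsClosed (bellman M val v) := by
  cases hn : M.node v with
  | control E hE =>
    have hK : IsCompact {z : ℝ × ℝ × ℝ | z ∈ Set.Icc 0 1 ∧
        (∃ w ∈ E, (z.2.2, z.1) ∈ val w) ∧ (∀ w ∈ E, (z.2.1, z.1) ∈ val w)} := by
      refine isCompact_Icc.inter_right (IsClosed.inter ?_ ?_)
      · exact isClosed_exists_mem h E (by fun_prop)
      · exact isClosed_forall_mem h _ (by fun_prop)
    have hc := hK.image (f := fun z : ℝ × ℝ × ℝ => ((z.2.1 + z.2.2) / 2, z.1)) (by fun_prop)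
    convert hc.isClosed using 1
    ext x
    rw [mem_bellman_control hn]
    constructor
    · rintro ⟨h2, bp, bm, ⟨w, hw, hm⟩, hp, hx⟩
      have h3 := (hs _ hm).1
      have h4 := (hs _ (hp w hw)).1
      exact ⟨(x.2, bp, bm), ⟨⟨⟨h2.1, h4.1, h3.1⟩, ⟨h2.2, h4.2, h3.2⟩⟩, ⟨w, hw, hm⟩, hp⟩,
        Prod.ext hx.symm rfl⟩
    · rintro ⟨⟨p, bp, bm⟩, ⟨⟨h1, h2⟩, hm, hp⟩, rfl⟩
      exact ⟨⟨h1.1, h2.1⟩, bp, bm, hm, hp, rfl⟩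
  | random δ =>
    have hK : IsCompact {z : ℝ × (V → ℝ) | z ∈ Set.Icc 0 1 ∧
        ∀ w, 0 < δ.1 w → (z.1, z.2 w) ∈ val w} := by
      refine isCompact_Icc.inter_right ?_
      exact isClosed_forall_mem h _ (by fun_prop)
    have hc := hK.image (f := fun z : ℝ × (V → ℝ) => (z.1, ∑ w, δ.1 w * z.2 w)) (by fun_prop)
    convert hc.isClosed using 1
    ext x
    rw [mem_bellman_random hn]
    constructor
    · rintro ⟨h1, q, hq, hx⟩
      classical
      -- The witness is unconstrained at vertices of probability zero; resetting it there puts it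
      -- into the cube.
      refine ⟨(x.1, fun w => if 0 < δ.1 w then q w else 0), ⟨⟨⟨h1.1, ?_⟩, ⟨h1.2, ?_⟩⟩, ?_⟩, ?_⟩
      · intro w
        dsimp only
        split
        · exact (hs _ (hq w ‹_›)).2.1
        · exact le_rfl
      · intro w
        dsimp only
        split
        · exact (hs _ (hq w ‹_›)).2.2
        · exact zero_le_one
      · intro w hw
        simpa [hw] using hq w hw
      · refine Prod.ext rfl ?_
        rw [hx]
        refine Finset.sum_congr rfl fun w _ => ?_
        rcases (δ.2.1 w).eq_or_lt with h0 | h0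
        · simp [← h0]
        · simp [h0]
    · rintro ⟨⟨b, q⟩, ⟨⟨h1, h2⟩, hq⟩, rfl⟩
      exact ⟨⟨h1.1, h2.1⟩, q, hq, rfl⟩

/-- A family of closed subsets of the unit square that decreases with the first index: the operator
of value iteration commutes with its intersection, up to inclusion. -/
lemma iInter_bellman_subset {val : ℕ → V → Set (ℝ × ℝ)} (hs : ∀ i v, val i v ⊆ square)
    (h : ∀ i v, IsClosed (val i v)) (ha : ∀ i v, val (i + 1) v ⊆ val i v) (v : V) :
    ⋂ i, bellman M (val i) v ⊆ bellman M (fun w => ⋂ i, val i w) v := by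
  have ha' : ∀ v, Antitone fun i => val i v := fun v => antitone_nat_of_succ_le fun i => ha i v
  intro x hx
  rw [Set.mem_iInter] at hx
  cases hn : M.node v with
  | control E hE =>
    simp only [mem_bellman_control hn] at hx ⊢
    refine ⟨(hx 0).1, ?_⟩
    -- The witnesses of the stages form a decreasing sequence of nonempty compact sets, so one
    -- witness serves all stages.
    let K : ℕ → Set (ℝ × ℝ) := fun i => {z | z ∈ square ∧
      (∃ w ∈ E, (z.2, x.2) ∈ val i w) ∧ (∀ w ∈ E, (z.1, x.2) ∈ val i w) ∧ x.1 = (z.1 + z.2) / 2}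
    have hK : ∀ i, IsCompact (K i) := by
      intro i
      refine isCompact_square.inter_right (IsClosed.inter ?_ (IsClosed.inter ?_ ?_))
      · exact isClosed_exists_mem (h i) E (by fun_prop)
      · exact isClosed_forall_mem (h i) _ (by fun_prop)
      · exact isClosed_eq (by fun_prop) (by fun_prop)
    obtain ⟨z, hz⟩ := IsCompact.nonempty_iInter_of_sequence_nonempty_isCompact_isClosed K
      (fun i z hz => ⟨hz.1, ⟨hz.2.1.choose, hz.2.1.choose_spec.1, ha i _ hz.2.1.choose_spec.2⟩,
        fun w hw => ha i _ (hz.2.2.1 w hw), hz.2.2.2⟩)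
      (fun i => by
        obtain ⟨-, bp, bm, ⟨w, hw, hm⟩, hp, hx1⟩ := hx i
        exact ⟨(bp, bm), ⟨(hs i _ (hp w hw)).1, (hs i _ hm).1⟩, ⟨w, hw, hm⟩, hp, hx1⟩)
      (hK 0) (fun i => (hK i).isClosed)
    rw [Set.mem_iInter] at hz
    refine ⟨z.1, z.2, ?_, fun w hw => Set.mem_iInter.2 fun i => (hz i).2.2.1 w hw, (hz 0).2.2.2⟩
    -- The successor that carries `z.2` may vary with the stage. If each successor failed at some
    -- stage, all of them would fail at the latest of these finitely many stages.
    by_contra! hcon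
    simp only [Set.mem_iInter, not_forall] at hcon
    choose! j hj using hcon
    obtain ⟨w, hw, hm⟩ := (hz (E.sup j)).2.1
    exact hj w hw (ha' w (Finset.le_sup hw) hm)
  | random δ =>
    simp only [mem_bellman_random hn] at hx ⊢
    refine ⟨(hx 0).1, ?_⟩
    let K : ℕ → Set (V → ℝ) := fun i => {q | q ∈ Set.Icc 0 1 ∧
      (∀ w, 0 < δ.1 w → (x.1, q w) ∈ val i w) ∧ x.2 = ∑ w, δ.1 w * q w}
    have hK : ∀ i, IsCompact (K i) := by
      intro i
      refine isCompact_Icc.inter_right (IsClosed.inter ?_ ?_)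
      · exact isClosed_forall_mem (h i) _ (by fun_prop)
      · exact isClosed_eq (by fun_prop) (by fun_prop)
    obtain ⟨q, hq⟩ := IsCompact.nonempty_iInter_of_sequence_nonempty_isCompact_isClosed K
      (fun i q hq => ⟨hq.1, fun w hw => ha i _ (hq.2.1 w hw), hq.2.2⟩)
      (fun i => by
        classical
        obtain ⟨-, q, hq, hx1⟩ := hx i
        refine ⟨fun w => if 0 < δ.1 w then q w else 0, ⟨fun w => ?_, fun w => ?_⟩,
          fun w hw => by simpa [hw] using hq w hw, ?_⟩
        · dsimp only
          split
          · exact (hs _ _ (hq w ‹_›)).2.1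
          · exact le_rfl
        · dsimp only
          split
          · exact (hs _ _ (hq w ‹_›)).2.2
          · exact zero_le_one
        · rw [hx1]
          refine Finset.sum_congr rfl fun w _ => ?_
          rcases (δ.2.1 w).eq_or_lt with h0 | h0
          · simp [← h0]
          · simp [h0])
      (hK 0) (fun i => (hK i).isClosed)
    rw [Set.mem_iInter] at hq
    exact ⟨q, fun w hw => Set.mem_iInter.2 fun i => (hq i).2.1 w hw, (hq 0).2.2⟩

/-- The point reflection of the square exchanges the roles of the players. -/
def reflect (x : ℝ × ℝ) : ℝ × ℝ := (1 - x.1, 1 - x.2)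

@[simp] lemma reflect_reflect (x : ℝ × ℝ) : reflect (reflect x) = x := by simp [reflect]

lemma reflect_mem_square {x : ℝ × ℝ} : reflect x ∈ square ↔ x ∈ square := by
  simp only [mem_square, reflect]
  constructor <;> rintro ⟨⟨h1, h2⟩, h3, h4⟩ <;>
    exact ⟨⟨by linarith, by linarith⟩, by linarith, by linarith⟩

lemma continuous_reflect : Continuous reflect := by unfold reflect; fun_prop

/-- Both averages are affine and the quantifiers over successors are untouched, so one rule serves
both players. -/
lemma reflect_mem_bellman {val val' : V → Set (ℝ × ℝ)}
    (h : ∀ v x, x ∈ val v → reflect x ∈ val' v) {v : V} {x : ℝ × ℝ} (hx : x ∈ bellman M val v) :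
    reflect x ∈ bellman M val' v := by
  cases hn : M.node v with
  | control E hE =>
    rw [mem_bellman_control hn] at hx ⊢
    obtain ⟨h3, bp, bm, ⟨w, hw, hm⟩, hp, hx1⟩ := hx
    refine ⟨⟨by simp [reflect, h3.2], by simp [reflect, h3.1]⟩, 1 - bp, 1 - bm,
      ⟨w, hw, h _ _ hm⟩, fun w hw => h _ _ (hp w hw), ?_⟩
    simp only [reflect, hx1]
    ring
  | random δ =>
    rw [mem_bellman_random hn] at hx ⊢
    obtain ⟨h3, q, hq, hx1⟩ := hx
    refine ⟨⟨by simp [reflect, h3.2], by simp [reflect, h3.1]⟩, fun w => 1 - q w,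
      fun w hw => h _ _ (hq w hw), ?_⟩
    simp only [reflect, hx1, mul_sub, mul_one, Finset.sum_sub_distrib]
    rw [δ.2.2]

end Values

/-! ### Monotonicity of the values, duality, and the covering of the square. -/

section Iteration

variable {V : Type*} [Fintype V] [DecidableEq V] {M : MDP V} {T : Finset V}

lemma rval_subset_square (i : ℕ) (v : V) : rval M T i v ⊆ square := by
  induction i generalizing v with
  | zero =>
    rw [rval]
    split
    · exact subset_rfl
    · rintro ⟨b, p⟩ (⟨h1, h2⟩ | ⟨h1, h2⟩) <;>
        simp only [Set.mem_singleton_iff] at h1 h2 <;> subst_vars <;> simp_all [mem_square]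
  | succ i ih => exact bellman_subset_square ih v

lemma isClosed_rval (i : ℕ) (v : V) : IsClosed (rval M T i v) := by
  induction i generalizing v with
  | zero =>
    rw [rval]
    split
    · exact isCompact_square.isClosed
    · exact (isClosed_Icc.prod isClosed_singleton).union (isClosed_singleton.prod isClosed_Icc)
  | succ i ih => exact isClosed_bellman (rval_subset_square i) ih v

/-- These two sides are the default wherever a point is truncated to the square or no corner
qualifies. -/
lemma side_mem_rval (i : ℕ) (v : V) {x : ℝ × ℝ} (hx : x ∈ square) (h : x.1 = 1 ∨ x.2 = 0) :
    x ∈ rval M T i v := by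
  induction i generalizing v with
  | zero =>
    rw [rval]
    split
    · exact hx
    · rcases h with h | h
      · exact Or.inr ⟨h, hx.2⟩
      · exact Or.inl ⟨hx.1, h⟩
  | succ i ih => exact mem_bellman_of_forall_succ hx fun w _ => ih w

lemma upClosed_rval (i : ℕ) (v : V) : UpClosed (rval M T i v) := by
  induction i generalizing v with
  | zero =>
    intro x hx y hy h1 h2
    by_cases hv : v ∈ T
    · simpa [rval, hv] using hy
    · apply side_mem_rval 0 v hy
      obtain ⟨⟨a1, a2⟩, a3, a4⟩ := mem_square.1 hy
      simp only [rval, hv, if_false] at hx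
      rcases hx with hx | hx
      · have : x.2 = 0 := hx.2
        right; linarith
      · have : x.1 = 1 := hx.1
        left; linarith
  | succ i ih => exact upClosed_bellman (rval_subset_square i) ih v

lemma rval_le_succ (hT : ∀ t ∈ T, M.IsSink t) (i : ℕ) (v : V) :
    rval M T i v ⊆ rval M T (i + 1) v := by
  induction i generalizing v with
  | zero =>
    intro x hx
    have hxs := rval_subset_square 0 v hx
    refine mem_bellman_of_forall_succ hxs fun w hw => ?_
    by_cases hv : v ∈ T
    · rw [hT v hv, Finset.mem_singleton] at hw
      rwa [hw]
    · simp only [rval, hv, if_false] at hx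
      refine side_mem_rval 0 w hxs ?_
      rcases hx with hx | hx
      · exact Or.inr hx.2
      · exact Or.inl hx.1
  | succ i ih => exact bellman_mono ih v

lemma rval_mono (hT : ∀ t ∈ T, M.IsSink t) (v : V) : Monotone fun i => rval M T i v :=
  monotone_nat_of_le_succ fun i => rval_le_succ hT i v

/-- Transfers closedness and the sides from `rval` to `sval`. Monotonicity is not transferred, since
the vertices of `Tᶜ` need not be sinks. -/
lemma mem_sval_iff (i : ℕ) (v : V) (x : ℝ × ℝ) :
    x ∈ sval M T i v ↔ reflect x ∈ rval M Tᶜ i v := by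
  have h0 : ∀ v x, x ∈ sval M T 0 v ↔ reflect x ∈ rval M Tᶜ 0 v := by
    intro v x
    by_cases hv : v ∈ T
    · simp only [sval, rval, hv, if_true, Finset.mem_compl, not_true, if_false]
      simp only [Set.mem_union, Set.mem_prod, Set.mem_singleton_iff, Set.mem_Icc, reflect]
      refine or_congr (and_congr ⟨?_, ?_⟩ ⟨?_, ?_⟩) (and_congr ⟨?_, ?_⟩ ⟨?_, ?_⟩)
      all_goals first | (intro h; linarith) | (rintro ⟨h1, h2⟩; constructor <;> linarith)
    · simp [sval, rval, hv, reflect_mem_square]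
  induction i generalizing v x with
  | zero => exact h0 v x
  | succ i ih =>
    constructor
    · exact fun h => reflect_mem_bellman (fun v x => (ih v x).1) h
    · intro h
      rw [← reflect_reflect x]
      refine reflect_mem_bellman (fun v x hx => (ih v _).2 ?_) h
      rwa [reflect_reflect]

lemma sval_eq_preimage (i : ℕ) (v : V) : sval M T i v = reflect ⁻¹' rval M Tᶜ i v :=
  Set.ext fun x => mem_sval_iff i v x

lemma sval_subset_square (i : ℕ) (v : V) : sval M T i v ⊆ square := fun x hx =>
  reflect_mem_square.1 (rval_subset_square i v ((mem_sval_iff i v x).1 hx))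

lemma isClosed_sval (i : ℕ) (v : V) : IsClosed (sval M T i v) := by
  rw [sval_eq_preimage]
  exact (isClosed_rval i v).preimage continuous_reflect

lemma side_mem_sval (i : ℕ) (v : V) {x : ℝ × ℝ} (hx : x ∈ square) (h : x.1 = 0 ∨ x.2 = 1) :
    x ∈ sval M T i v := by
  rw [mem_sval_iff]
  refine side_mem_rval i v (reflect_mem_square.2 hx) ?_
  rcases h with h | h <;> simp [reflect, h]

/-- The only real case is a target at stage zero. Its only successor is itself, and the sides `p =
1` and `b = 0` reproduce themselves: if `p ≠ 1`, both averaged budgets are `0`. -/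
lemma sval_succ_le (hT : ∀ t ∈ T, M.IsSink t) (i : ℕ) (v : V) :
    sval M T (i + 1) v ⊆ sval M T i v := by
  induction i generalizing v with
  | zero =>
    intro x hx
    have hxs := sval_subset_square 1 v hx
    by_cases hv : v ∈ T
    swap
    · simpa [sval, hv] using hxs
    apply side_mem_sval 0 v hxs
    have key : ∀ y ∈ sval M T 0 v, y.1 = 0 ∨ y.2 = 1 := by
      intro y hy
      simp only [sval, hv, if_true] at hy
      rcases hy with hy | hy
      · exact Or.inr hy.2
      · exact Or.inl hy.1
    have hsink := hT v hv
    rw [MDP.IsSink] at hsink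
    rw [sval] at hx
    cases hn : M.node v with
    | control E hE =>
      rw [mem_bellman_control hn] at hx
      rw [succ_control hn] at hsink
      subst hsink
      obtain ⟨h3, bp, bm, ⟨w, hw, hm⟩, hp, hx1⟩ := hx
      rw [Finset.mem_singleton] at hw
      subst hw
      rcases key _ hm with h | h
      · rcases key _ (hp w (by simp)) with h' | h'
        · left; simp only at h h'; rw [hx1, h, h']; norm_num
        · exact Or.inr h'
      · exact Or.inr h
    | random δ =>
      have hv1 : v ∈ M.succ v := by simp [hsink]
      have hsum := sum_succ_eq hn fun _ => 1
      simp only [hsink, mul_one, Finset.sum_singleton] at hsum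
      rw [δ.2.2] at hsum
      have hx' : x.1 ∈ Set.Icc (0 : ℝ) 1 ∧ ∃ q : V → ℝ, (∀ w ∈ M.succ v, (x.1, q w) ∈
          sval M T 0 w) ∧ x.2 = ∑ w ∈ M.succ v, δ.1 w * q w := by
        simpa [bellman, hn] using hx
      obtain ⟨-, q, hq, hx2⟩ := hx'
      rw [hsink, Finset.sum_singleton, hsum, one_mul] at hx2
      rw [hx2]
      exact key _ (hq v hv1)
  | succ i ih => exact bellman_mono ih v

lemma valStar_reach_closed (v : V) : IsClosed (valStar M T v .reach) := isClosed_closure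

lemma rval_subset_valStar (i : ℕ) (v : V) : rval M T i v ⊆ valStar M T v .reach :=
  (Set.subset_iUnion (fun i => rval M T i v) i).trans subset_closure

lemma valStar_reach_subset_square (v : V) : valStar M T v .reach ⊆ square :=
  closure_minimal (Set.iUnion_subset fun i => rval_subset_square i v) isCompact_square.isClosed

lemma valStar_reach_subset_bellman (hT : ∀ t ∈ T, M.IsSink t) (v : V) :
    valStar M T v .reach ⊆ bellman M (fun w => valStar M T w .reach) v := by
  refine closure_minimal (Set.iUnion_subset fun i => ?_)
    (isClosed_bellman valStar_reach_subset_square valStar_reach_closed v)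
  exact (rval_le_succ hT i v).trans (bellman_mono (fun w => rval_subset_valStar i w) v)

/-- This is what lets the safety player renew a promise from the limit value at every step without a
horizon. -/
lemma valStar_safe_subset_bellman (hT : ∀ t ∈ T, M.IsSink t) (v : V) :
    valStar M T v .safe ⊆ bellman M (fun w => valStar M T w .safe) v := by
  refine subset_trans ?_ (iInter_bellman_subset sval_subset_square isClosed_sval
    (sval_succ_le hT) v)
  exact fun x hx => Set.mem_iInter.2 fun i => Set.mem_iInter.1 hx (i + 1)

/-- If `z` in some `rval` approximates `x`, then `(max y.1 z.1, min y.2 z.2)` lies in the same value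
and is no farther from `y` than `z` is from `x`. -/
lemma upClosed_valStar_reach (v : V) : UpClosed (valStar M T v .reach) := by
  intro x hx y hy h1 h2
  change x ∈ closure _ at hx
  change y ∈ closure _
  rw [Metric.mem_closure_iff] at hx ⊢
  intro ε hε
  obtain ⟨z, hz, hd⟩ := hx ε hε
  obtain ⟨i, hz⟩ := Set.mem_iUnion.1 hz
  rw [Prod.dist_eq, max_lt_iff, Real.dist_eq, Real.dist_eq, abs_lt, abs_lt] at hd
  obtain ⟨⟨d1, d2⟩, d3, d4⟩ := hd
  have hzs := mem_square.1 (rval_subset_square i v hz)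
  obtain ⟨⟨a1, a2⟩, a3, a4⟩ := mem_square.1 hy
  refine ⟨(max y.1 z.1, min y.2 z.2), Set.mem_iUnion.2 ⟨i, upClosed_rval i v z hz _ ?_
    (le_max_right _ _) (min_le_right _ _)⟩, ?_⟩
  · exact mem_square.2 ⟨⟨a1.trans (le_max_left _ _), max_le a2 hzs.1.2⟩,
      le_min a3 hzs.2.1, (min_le_left _ _).trans a4⟩
  · rw [Prod.dist_eq, max_lt_iff, Real.dist_eq, Real.dist_eq, abs_lt, abs_lt]
    simp only
    rcases max_cases y.1 z.1 with ⟨e1, _⟩ | ⟨e1, _⟩ <;>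
      rcases min_cases y.2 z.2 with ⟨e2, _⟩ | ⟨e2, _⟩ <;> rw [e1, e2] <;>
      exact ⟨⟨by linarith, by linarith⟩, by linarith, by linarith⟩

/-- The values of the two players cover the unit square. -/
lemma mem_rval_or_mem_sval (i : ℕ) (v : V) {x : ℝ × ℝ} (hx : x ∈ square) :
    x ∈ rval M T i v ∨ x ∈ sval M T i v := by
  induction i generalizing v x with
  | zero =>
    by_cases hv : v ∈ T
    · left; simpa [rval, hv] using hx
    · right; simpa [sval, hv] using hx
  | succ i ih =>
    rw [or_iff_not_imp_left]
    intro hr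
    have hcontra : ∀ y ∈ rval M T (i + 1) v, y.1 ≤ x.1 → x.2 ≤ y.2 → False :=
      fun y hy h1 h2 => hr (upClosed_rval _ _ y hy x hx h1 h2)
    obtain ⟨⟨a1, a2⟩, a3, a4⟩ := mem_square.1 hx
    have hcomp : ∀ w, IsCompact (rval M T i w) := fun w =>
      isCompact_square.of_isClosed_subset (isClosed_rval i w) (rval_subset_square i w)
    cases hn : M.node v with
    | control E hE =>
      have hmin : ∀ w, ∃ b, (b, x.2) ∈ rval M T i w ∧ ∀ b', (b', x.2) ∈ rval M T i w → b ≤ b' := by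
        intro w
        have hc : IsCompact (rval M T i w ∩ {y | y.2 = x.2}) :=
          (hcomp w).inter_right (isClosed_eq continuous_snd continuous_const)
        obtain ⟨y, ⟨hy, hy2⟩, hmin⟩ := hc.exists_isMinOn
          ⟨(1, x.2), side_mem_rval i w (mem_square.2 ⟨by norm_num, a3, a4⟩) (Or.inl rfl), rfl⟩
          continuous_fst.continuousOn
        have hy2' : y.2 = x.2 := hy2
        refine ⟨y.1, hy2' ▸ hy, fun b' hb' => hmin (a := (b', x.2)) ⟨hb', rfl⟩⟩
      choose b hb hbmin using hmin
      obtain ⟨w1, hw1, h1⟩ := E.exists_min_image b hE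
      obtain ⟨w2, hw2, h2⟩ := E.exists_max_image b hE
      have hb0 : ∀ w, 0 ≤ b w ∧ b w ≤ 1 := fun w => (mem_square.1 (rval_subset_square i w (hb w))).1
      have hlt : x.1 < (b w2 + b w1) / 2 := by
        by_contra! hge
        refine hcontra ((b w2 + b w1) / 2, x.2) ?_ hge le_rfl
        rw [rval, mem_bellman_control hn]
        refine ⟨⟨a3, a4⟩, b w2, b w1, ⟨w1, hw1, hb w1⟩, fun w hw => ?_, rfl⟩
        exact upClosed_rval i w _ (hb w) _ (mem_square.2 ⟨hb0 w2, a3, a4⟩) (h2 w hw) le_rfl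
      have hA : 0 < (b w2 + b w1) / 2 := a1.trans_lt hlt
      -- Since `x.1` lies below the average of the extreme least budgets, scaling by `t < 1` pushes
      -- each positive one out of `rval`, hence into `sval` by induction; budget zero lies on a side
      -- of `sval`.
      set t := x.1 / ((b w2 + b w1) / 2) with ht
      have ht0 : 0 ≤ t := div_nonneg a1 hA.le
      have ht1 : t < 1 := (div_lt_one hA).2 hlt
      have hs : ∀ w c, 0 ≤ c → c ≤ b w → (c * t, x.2) ∈ sval M T i w := by
        intro w c hc0 hc
        have hsq : (c * t, x.2) ∈ square := by
          have := (hb0 w).2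
          exact mem_square.2 ⟨⟨mul_nonneg hc0 ht0, by simp only; nlinarith⟩, a3, a4⟩
        rcases hc0.eq_or_lt with h0 | h0
        · exact side_mem_sval i w hsq (Or.inl (by simp [← h0]))
        · refine (ih w hsq).resolve_left fun hmem => ?_
          have := hbmin w _ hmem
          nlinarith
      rw [sval, mem_bellman_control hn]
      -- The extremes change roles: the smallest budget is now good at all successors, the largest
      -- one at `w2`.
      refine ⟨⟨a3, a4⟩, b w1 * t, b w2 * t, ⟨w2, hw2, hs _ _ (hb0 w2).1 le_rfl⟩,
        fun w hw => hs _ _ (hb0 w1).1 (h1 w hw), ?_⟩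
      have : t * ((b w2 + b w1) / 2) = x.1 := div_mul_cancel₀ _ hA.ne'
      linarith
    | random δ =>
      have hmax : ∀ w, ∃ q, (x.1, q) ∈ rval M T i w ∧ ∀ q', (x.1, q') ∈ rval M T i w → q' ≤ q := by
        intro w
        have hc : IsCompact (rval M T i w ∩ {y | y.1 = x.1}) :=
          (hcomp w).inter_right (isClosed_eq continuous_fst continuous_const)
        obtain ⟨y, ⟨hy, hy2⟩, hmax⟩ := hc.exists_isMaxOn
          ⟨(x.1, 0), side_mem_rval i w (mem_square.2 ⟨⟨a1, a2⟩, by norm_num⟩) (Or.inr rfl), rfl⟩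
          continuous_snd.continuousOn
        have hy2' : y.1 = x.1 := hy2
        refine ⟨y.2, hy2' ▸ hy, fun b' hb' => hmax (a := (x.1, b')) ⟨hb', rfl⟩⟩
      choose q hq hqmax using hmax
      have hq0 : ∀ w, 0 ≤ q w ∧ q w ≤ 1 := fun w => (mem_square.1 (rval_subset_square i w (hq w))).2
      have hlt : ∑ w, δ.1 w * q w < x.2 := by
        by_contra! hge
        refine hcontra (x.1, ∑ w, δ.1 w * q w) ?_ le_rfl hge
        rw [rval, mem_bellman_random hn]
        exact ⟨⟨a1, a2⟩, q, fun w _ => hq w, rfl⟩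
      set P := ∑ w, δ.1 w * q w with hP
      -- Moving each greatest probability by the ratio `t` towards `1` lifts the average from `P` to
      -- `x.2` and leaves `rval`, except where the probability is `1` already.
      set t := (x.2 - P) / (1 - P) with ht
      have ht0 : 0 < t := div_pos (by linarith) (by linarith)
      have ht1 : t ≤ 1 := (div_le_one (by linarith)).2 (by linarith)
      rw [sval, mem_bellman_random hn]
      refine ⟨⟨a1, a2⟩, fun w => q w + t * (1 - q w), fun w _ => ?_, ?_⟩
      · obtain ⟨q0, q1⟩ := hq0 w
        have hsq : (x.1, q w + t * (1 - q w)) ∈ square :=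
          mem_square.2 ⟨⟨a1, a2⟩, by simp only; nlinarith, by simp only; nlinarith⟩
        rcases q1.eq_or_lt with h1 | h1
        · exact side_mem_sval i w hsq (Or.inr (by simp [h1]))
        · refine (ih w hsq).resolve_left fun hmem => ?_
          have := hqmax w _ hmem
          nlinarith
      · have : ∑ w, δ.1 w * (q w + t * (1 - q w)) = P + t * (1 - P) := by
          simp only [mul_add, Finset.sum_add_distrib, mul_sub, mul_left_comm _ t]
          rw [Finset.sum_sub_distrib, ← Finset.mul_sum, ← Finset.mul_sum]
          simp only [mul_one]
          rw [δ.2.2, ← hP]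
          ring
        rw [this, ht, div_mul_cancel₀ _ (by linarith)]
        ring

lemma mem_valStar_reach_or_mem_valStar_safe (v : V) {x : ℝ × ℝ} (hx : x ∈ square) :
    (∃ i, x ∈ rval M T i v) ∨ x ∈ valStar M T v .safe := by
  rw [or_iff_not_imp_left]
  intro h
  refine Set.mem_iInter.2 fun i => (mem_rval_or_mem_sval i v hx).resolve_left fun hi => h ⟨i, hi⟩

end Iteration

/-! ### Favourable steps towards the initial values. -/

section Convergence

variable {V : Type*} [Fintype V] {M : MDP V}

lemma finite_deltaMin_set (M : MDP V) :
    (insert (1 / 2) {x : ℝ | 0 < x ∧ ∃ v w, M.prob v w = x}).Finite := by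
  refine Set.Finite.insert _ ((Set.finite_range fun z : V × V => M.prob z.1 z.2).subset ?_)
  rintro x ⟨-, v, w, rfl⟩
  exact ⟨(v, w), rfl⟩

lemma deltaMin_pos (M : MDP V) : 0 < M.deltaMin := by
  rcases (Set.insert_nonempty _ _).csInf_mem (finite_deltaMin_set M) with h | h
  · rw [MDP.deltaMin, h]; norm_num
  · exact h.1

lemma deltaMin_le_half (M : MDP V) : M.deltaMin ≤ 1 / 2 :=
  csInf_le (finite_deltaMin_set M).bddBelow (Set.mem_insert _ _)

lemma deltaMin_le {v w : V} {δ : stdSimplex ℝ V} (h : M.node v = .random δ) (hw : 0 < δ.1 w) :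
    M.deltaMin ≤ δ.1 w :=
  csInf_le (finite_deltaMin_set M).bddBelow
    (Set.mem_insert_of_mem _ ⟨hw, v, w, by simp [MDP.prob, h]⟩)

/-- The point `x` is derived by value iteration at `v` from points of `R`, and one of the
successors that are good for the reachability player contributes a point of `G`. -/
def Derived (M : MDP V) (R G : V → Set (ℝ × ℝ)) (v : V) (x : ℝ × ℝ) : Prop :=
  match M.node v with
  | .control E _ => ∃ bplus bminus : ℝ, (∃ w ∈ E, (bminus, x.2) ∈ G w) ∧
      (∀ w ∈ E, (bplus, x.2) ∈ R w) ∧ x.1 = (bplus + bminus) / 2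
  | .random δ => ∃ q : V → ℝ, (∃ w, 0 < δ.1 w ∧ (x.1, q w) ∈ G w) ∧
      (∀ w, 0 < δ.1 w → (x.1, q w) ∈ R w) ∧ x.2 = ∑ w, δ.1 w * q w

lemma derived_control {v : V} {E : Finset V} {hE : E.Nonempty} (h : M.node v = .control E hE)
    {R G : V → Set (ℝ × ℝ)} {x : ℝ × ℝ} :
    Derived M R G v x ↔ ∃ bplus bminus : ℝ, (∃ w ∈ E, (bminus, x.2) ∈ G w) ∧
      (∀ w ∈ E, (bplus, x.2) ∈ R w) ∧ x.1 = (bplus + bminus) / 2 := by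
  simp [Derived, h]

lemma derived_random {v : V} {δ : stdSimplex ℝ V} (h : M.node v = .random δ)
    {R G : V → Set (ℝ × ℝ)} {x : ℝ × ℝ} :
    Derived M R G v x ↔ ∃ q : V → ℝ, (∃ w, 0 < δ.1 w ∧ (x.1, q w) ∈ G w) ∧
      (∀ w, 0 < δ.1 w → (x.1, q w) ∈ R w) ∧ x.2 = ∑ w, δ.1 w * q w := by
  simp [Derived, h]

lemma derived_of_forall_succ {R G : V → Set (ℝ × ℝ)} {v u : V} {x : ℝ × ℝ}
    (h : ∀ w ∈ M.succ v, x ∈ R w) (hu : u ∈ M.succ v) (hx : x ∈ G u) : Derived M R G v x := by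
  cases hn : M.node v with
  | control E hE =>
    rw [derived_control hn]
    rw [succ_control hn] at h hu
    exact ⟨x.1, x.1, ⟨u, hu, hx⟩, h, by ring⟩
  | random δ =>
    rw [derived_random hn]
    rw [mem_succ_random hn] at hu
    refine ⟨fun _ => x.2, ⟨u, hu, hx⟩, fun w hw => h w ((mem_succ_random hn).2 hw), ?_⟩
    rw [← Finset.sum_mul, δ.2.2, one_mul]

/-- A point that is derived with one successor to which it does not belong is derived from a
strictly better point of another one. -/
lemma derived_of_not_forall_succ {R G : V → Set (ℝ × ℝ)} {v : V} {x : ℝ × ℝ}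
    (hs : ∀ v, R v ⊆ square) (hR : ∀ v, UpClosed (R v))
    (hx : x ∈ bellman M R v) (h : ¬ ∀ w ∈ M.succ v, x ∈ R w)
    (hG : ∀ w, ∀ y ∈ R w, y.1 ≤ x.1 → x.2 ≤ y.2 → y ≠ x → y ∈ G w) : Derived M R G v x := by
  have hxs := bellman_subset_square hs v hx
  push Not at h
  obtain ⟨u, hu, hxu⟩ := h
  cases hn : M.node v with
  | control E hE =>
    rw [derived_control hn]
    rw [succ_control hn] at hu
    rw [mem_bellman_control hn] at hx
    obtain ⟨h2, bp, bm, ⟨w, hw, hm⟩, hp, hx1⟩ := hx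
    have hlt : x.1 < bp := by
      by_contra! hle
      exact hxu (hR u _ (hp u hu) x hxs hle le_rfl)
    refine ⟨bp, bm, ⟨w, hw, hG w _ hm (by simp only; linarith) le_rfl fun he => ?_⟩, hp, hx1⟩
    have : bm = x.1 := congrArg Prod.fst he
    linarith
  | random δ =>
    rw [derived_random hn]
    rw [mem_succ_random hn] at hu
    rw [mem_bellman_random hn] at hx
    obtain ⟨h2, q, hq, hx2⟩ := hx
    have hqu : q u < x.2 := by
      by_contra! hle
      exact hxu (hR u _ (hq u hu) x hxs le_rfl hle)
    have : ∃ w, 0 < δ.1 w ∧ x.2 < q w := by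
      by_contra! hcon
      have : ∑ w, δ.1 w * q w < ∑ w, δ.1 w * x.2 := by
        refine Finset.sum_lt_sum (fun w _ => ?_) ⟨u, Finset.mem_univ u, by nlinarith⟩
        rcases (δ.2.1 w).eq_or_lt with h0 | h0
        · simp [← h0]
        · exact mul_le_mul_of_nonneg_left (hcon w h0) h0.le
      rw [← Finset.sum_mul, δ.2.2, one_mul] at this
      linarith
    obtain ⟨w, hw, hlt⟩ := this
    refine ⟨q, ⟨w, hw, hG w _ (hq w hw) le_rfl hlt.le fun he => ?_⟩, hq, hx2⟩
    have : q w = x.2 := congrArg Prod.snd he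
    linarith

open Classical in
/-- The vertices whose set contains `x`. -/
def owners (R : V → Set (ℝ × ℝ)) (x : ℝ × ℝ) : Finset V := Finset.univ.filter fun w => x ∈ R w

open Classical in
/-- The vertices whose set contains a point that is better than `x`. -/
def strictOwners (R : V → Set (ℝ × ℝ)) (x : ℝ × ℝ) : Finset V :=
  Finset.univ.filter fun w => ∃ y ∈ R w, y.1 ≤ x.1 ∧ x.2 ≤ y.2 ∧ y ≠ x

lemma mem_owners {R : V → Set (ℝ × ℝ)} {x : ℝ × ℝ} {w : V} : w ∈ owners R x ↔ x ∈ R w := by simp [owners]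

lemma mem_strictOwners {R : V → Set (ℝ × ℝ)} {x : ℝ × ℝ} {w : V} :
    w ∈ strictOwners R x ↔ ∃ y ∈ R w, y.1 ≤ x.1 ∧ x.2 ≤ y.2 ∧ y ≠ x := by simp [strictOwners]

/-- The radius that the algorithm uses in iteration `i`. -/
def radius (M : MDP V) (i : ℕ) : ℝ :=
  2 * Real.exp (-((i * M.deltaMin ^ (2 * Fintype.card V)) / (4 * Fintype.card V)))

lemma radius_pos (M : MDP V) (i : ℕ) : 0 < radius M i := by unfold radius; positivity

/-- With `a = deltaMin ^ n`, the left side is at most `exp (-a * ⌊i / n⌋)`. Rounding down costs at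
most a factor `e`, which the `4` from squaring the leading `2` absorbs; the exponent of the radius
is smaller because `a ^ 2 / 2 ≤ a`. -/
lemma pow_div_le_radius_sq (M : MDP V) (hn : Fintype.card V ≠ 0) (i : ℕ) :
    (1 - M.deltaMin ^ Fintype.card V) ^ (i / Fintype.card V) ≤ radius M i ^ 2 := by
  have hd0 := deltaMin_pos M
  have hd1 := deltaMin_le_half M
  have hr : radius M i ^ 2 = 4 * Real.exp (-((M.deltaMin ^ Fintype.card V) ^ 2 / 2 *
      (i / Fintype.card V))) := by
    rw [radius, mul_pow, ← Real.exp_nat_mul, mul_comm 2 (Fintype.card V), pow_mul]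
    congr 1
    · norm_num
    · congr 1
      field_simp
      push_cast
      ring
  set n := Fintype.card V
  have hn' : (0 : ℝ) < n := by exact_mod_cast Nat.pos_of_ne_zero hn
  set a := M.deltaMin ^ n with ha
  have ha0 : 0 < a := pow_pos hd0 n
  have ha1 : a ≤ 1 / 2 := (pow_le_of_le_one hd0.le (by linarith) hn).trans hd1
  have hk : (i : ℝ) / n - 1 ≤ ((i / n : ℕ) : ℝ) := by
    have h1 : i < n * (i / n + 1) := Nat.lt_mul_div_succ i (Nat.pos_of_ne_zero hn)
    have h2 : (i : ℝ) < n * (((i / n : ℕ) : ℝ) + 1) := by exact_mod_cast h1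
    rw [sub_le_iff_le_add, div_le_iff₀ hn']
    linarith
  have hin : (0 : ℝ) ≤ i / n := by positivity
  calc (1 - a) ^ (i / n) ≤ Real.exp (-a) ^ (i / n) := by
        gcongr
        · linarith
        · linarith [Real.add_one_le_exp (-a)]
    _ = Real.exp (-(a * (i / n : ℕ))) := by
        rw [← Real.exp_nat_mul]
        ring_nf
    _ ≤ Real.exp (1 + -(a ^ 2 / 2 * (i / n))) := by
        apply Real.exp_le_exp.2
        nlinarith [mul_nonneg ha0.le hin]
    _ = Real.exp 1 * Real.exp (-(a ^ 2 / 2 * (i / n))) := Real.exp_add _ _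
    _ ≤ 4 * Real.exp (-(a ^ 2 / 2 * (i / n))) := by
        gcongr
        linarith [Real.exp_one_lt_d9]
    _ = _ := hr.symm

variable [DecidableEq V] {T : Finset V}

/-- The points of `R` at `v` from which the reachability player gets to the initial values within
`m` favourable steps. -/
def reachWithin (M : MDP V) (T : Finset V) (R : V → Set (ℝ × ℝ)) : ℕ → V → Set (ℝ × ℝ)
  | 0, v => rval M T 0 v
  | m + 1, v => reachWithin M T R m v ∪
      {x | x ∈ square ∧ ∃ y, y.1 ≤ x.1 ∧ x.2 ≤ y.2 ∧ Derived M R (reachWithin M T R m) v y}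

lemma reachWithin_subset_square (R : V → Set (ℝ × ℝ)) (m : ℕ) (v : V) :
    reachWithin M T R m v ⊆ square := by
  induction m with
  | zero => exact rval_subset_square 0 v
  | succ m ih => exact Set.union_subset ih fun x hx => hx.1

lemma reachWithin_mono (R : V → Set (ℝ × ℝ)) (v : V) :
    Monotone fun m => reachWithin M T R m v :=
  monotone_nat_of_le_succ fun _ => Set.subset_union_left

lemma upClosed_reachWithin (R : V → Set (ℝ × ℝ)) (m : ℕ) (v : V) :
    UpClosed (reachWithin M T R m v) := by
  induction m with
  | zero => exact upClosed_rval 0 v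
  | succ m ih =>
    rintro x (hx | ⟨-, z, h1, h2, h3⟩) y hy hxy1 hxy2
    · exact Or.inl (ih x hx y hy hxy1 hxy2)
    · exact Or.inr ⟨hy, z, h1.trans hxy1, hxy2.trans h2, h3⟩

lemma mem_reachWithin_of_derived {R : V → Set (ℝ × ℝ)} {m : ℕ} {v : V} {x : ℝ × ℝ}
    (hx : x ∈ square) (h : Derived M R (reachWithin M T R m) v x) :
    x ∈ reachWithin M T R (m + 1) v :=
  Or.inr ⟨hx, x, le_rfl, le_rfl, h⟩

/-- Families with the properties of the reachability limit values. -/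
structure ReachLike (M : MDP V) (T : Finset V) (R : V → Set (ℝ × ℝ)) : Prop where
  subset_square : ∀ v, R v ⊆ square
  upClosed : ∀ v, UpClosed (R v)
  closed : ∀ v, IsClosed (R v)
  subset_bellman : ∀ v, R v ⊆ bellman M R v
  trap : ∀ Y : Set V, (∀ v ∈ Y, v ∉ T ∧ ∀ w ∈ M.succ v, w ∈ Y) → ∀ v ∈ Y, R v ⊆ rval M T 0 v

/-- Only `trap` needs an argument: without targets the two sides reproduce themselves. At a control
vertex with `p ≠ 0` all averaged budgets are `1`; at a random vertex with budget other than `1` all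
averaged probabilities are `0`. -/
lemma reachLike_valStar (hT : ∀ t ∈ T, M.IsSink t) :
    ReachLike M T fun v => valStar M T v .reach where
  subset_square := valStar_reach_subset_square
  upClosed := upClosed_valStar_reach
  closed := valStar_reach_closed
  subset_bellman := valStar_reach_subset_bellman hT
  trap := by
    intro Y hY v hv
    refine closure_minimal (Set.iUnion_subset fun i => ?_) (isClosed_rval 0 v)
    have key : ∀ v ∈ Y, ∀ x, x ∈ rval M T 0 v → x.1 = 1 ∨ x.2 = 0 := by
      intro v hv x hx
      simp only [rval, (hY v hv).1, if_false] at hx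
      rcases hx with hx | hx
      · exact Or.inr hx.2
      · exact Or.inl hx.1
    induction i generalizing v with
    | zero => exact subset_rfl
    | succ i ih =>
      intro x hx
      refine side_mem_rval 0 v (rval_subset_square _ _ hx) ?_
      have hsucc := (hY v hv).2
      rw [rval] at hx
      cases hn : M.node v with
      | control E hE =>
        rw [mem_bellman_control hn] at hx
        rw [succ_control hn] at hsucc
        obtain ⟨h3, bp, bm, ⟨w, hw, hm⟩, hp, hx1⟩ := hx
        rcases key w (hsucc w hw) _ (ih w (hsucc w hw) hm) with h | h
        · rcases key w (hsucc w hw) _ (ih w (hsucc w hw) (hp w hw)) with h' | h'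
          · left; simp only at h h'; rw [hx1, h, h']; norm_num
          · exact Or.inr h'
        · exact Or.inr h
      | random δ =>
        rw [mem_bellman_random hn] at hx
        obtain ⟨h3, q, hq, hx2⟩ := hx
        rw [or_iff_not_imp_left]
        intro h1
        rw [hx2]
        refine Finset.sum_eq_zero fun w _ => ?_
        rcases (δ.2.1 w).eq_or_lt with h0 | h0
        · simp [← h0]
        · have hwY := hsucc w ((mem_succ_random hn).2 h0)
          have := (key w hwY _ (ih w hwY (hq w h0))).resolve_left h1
          simp only at this
          rw [this, mul_zero]

/-! ### Counting favourable steps by owners. -/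

section Path

variable {R : V → Set (ℝ × ℝ)}

/-- A point strictly better than `x` is owned only by strict owners of `x`, which are fewer than the
owners because `v` is not among them; so by `ih` it needs at most `S.card` steps. Starting from the
strict owners, each further step reaches at least one new owner of `x`, so `(owners R x).card` steps
suffice. -/
lemma mem_reachWithin_of_not_mem_strictOwners (hR : ReachLike M T R) {x : ℝ × ℝ} (hx : x ∈ square)
    (ih : ∀ y ∈ square, (owners R y).card < (owners R x).card →
      ∀ v, y ∈ R v → y ∈ reachWithin M T R (owners R y).card v)
    {v : V} (hv : x ∈ R v) (hv' : v ∉ strictOwners R x) :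
    x ∈ reachWithin M T R (owners R x).card v := by
  classical
  set S := strictOwners R x with hS
  have hSD : S ⊆ owners R x := by
    intro w hw
    obtain ⟨y, hy, h1, h2, -⟩ := mem_strictOwners.1 hw
    exact mem_owners.2 (hR.upClosed w y hy x hx h1 h2)
  have hlt : S.card < (owners R x).card :=
    Finset.card_lt_card (Finset.ssubset_iff_subset_ne.2
      ⟨hSD, fun he => hv' (he ▸ mem_owners.2 hv)⟩)
  have hbetter : ∀ w, ∀ y ∈ R w, y.1 ≤ x.1 → x.2 ≤ y.2 → y ≠ x →
      y ∈ reachWithin M T R S.card w := by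
    intro w y hy h1 h2 hne
    have hys := hR.subset_square w hy
    have hsub : owners R y ⊆ S := fun w' hw' =>
      mem_strictOwners.2 ⟨y, mem_owners.1 hw', h1, h2, hne⟩
    have hc := Finset.card_le_card hsub
    exact reachWithin_mono R w hc (ih y hys (hc.trans_lt hlt) w hy)
  let A : ℕ → Finset V := fun j =>
    (owners R x).filter fun w => x ∈ reachWithin M T R (S.card + j) w
  have hA : ∀ {j w}, w ∈ A j ↔ x ∈ R w ∧ x ∈ reachWithin M T R (S.card + j) w := by
    intro j w
    simp [A, mem_owners]
  have hAD : ∀ j, A j ⊆ owners R x := fun j => Finset.filter_subset _ _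
  have hAm : ∀ j, A j ⊆ A (j + 1) := fun j w hw =>
    hA.2 ⟨(hA.1 hw).1, reachWithin_mono R w (by omega) (hA.1 hw).2⟩
  have hcard : ∀ j, S.card + j ≤ (A j).card ∨ A j = owners R x := by
    intro j
    induction j with
    | zero =>
      left
      refine Finset.card_le_card fun w hw => hA.2 ⟨mem_owners.1 (hSD hw), ?_⟩
      obtain ⟨y, hy, h1, h2, h3⟩ := mem_strictOwners.1 hw
      exact upClosed_reachWithin R _ w y (hbetter w y hy h1 h2 h3) x hx h1 h2
    | succ j ihj =>
      by_cases hj : A j = owners R x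
      · right
        exact (hAD _).antisymm (hj ▸ hAm j)
      left
      have hjc := ihj.resolve_right hj
      have hex : ∃ w ∈ A (j + 1), w ∉ A j := by
        -- If `A` stopped growing, the owners outside `A j` would form a trap without targets. There
        -- `R` lies in the initial value, so `x` would be reached in zero steps.
        by_contra! hcon
        have hYne : ∃ w, x ∈ R w ∧ w ∉ A j := by
          by_contra! hall
          exact hj ((hAD j).antisymm fun w hw => hall w (mem_owners.1 hw))
        obtain ⟨u, hu, huA⟩ := hYne
        have hnot : ∀ w, x ∈ R w → w ∉ A j → x ∉ reachWithin M T R (S.card + j + 1) w :=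
          fun w hw hwA hmem => hwA (hcon w (hA.2 ⟨hw, hmem⟩))
        refine huA (hA.2 ⟨hu, reachWithin_mono R u (Nat.zero_le _)
          (hR.trap {w | x ∈ R w ∧ w ∉ A j} ?_ u ⟨hu, huA⟩ hu)⟩)
        rintro w ⟨hw, hwA⟩
        refine ⟨fun hwT => hwA (hA.2 ⟨hw, reachWithin_mono R w (Nat.zero_le _) ?_⟩), ?_⟩
        · simpa [reachWithin, rval, hwT] using hx
        -- If a successor does not own `x`, another one contributes a strictly better point, which
        -- is already known to need at most `S.card` steps.
        have hall : ∀ w' ∈ M.succ w, x ∈ R w' := by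
          by_contra hcon'
          refine hnot w hw hwA (reachWithin_mono R w (by omega : S.card + 1 ≤ S.card + j + 1)
            (mem_reachWithin_of_derived hx (derived_of_not_forall_succ hR.subset_square
              hR.upClosed (hR.subset_bellman w hw) hcon' hbetter)))
        refine fun w' hw' => ⟨hall w' hw', fun hA' => hnot w hw hwA ?_⟩
        exact mem_reachWithin_of_derived hx (derived_of_forall_succ hall hw' (hA.1 hA').2)
      obtain ⟨w, hw, hw'⟩ := hex
      have := Finset.card_lt_card (Finset.ssubset_iff_of_subset (hAm j) |>.2 ⟨w, hw, hw'⟩)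
      omega
  have hfin : A ((owners R x).card - S.card) = owners R x := by
    rcases hcard ((owners R x).card - S.card) with h | h
    · exact Finset.eq_of_subset_of_card_le (hAD _) (by omega)
    · exact h
  have hvA : v ∈ A ((owners R x).card - S.card) := by
    rw [hfin]
    exact mem_owners.2 hv
  have := (hA.1 hvA).2
  rwa [Nat.add_sub_cancel' hlt.le] at this

/-- By compactness `R v` has a point `y`, at least as good as `x`, that maximises `y.2 - y.1`.
Nothing in `R v` is strictly better than `y`, and `y` has no more owners than `x`, so the extremal
case applies to `y`. -/
lemma mem_reachWithin_card_owners (hR : ReachLike M T R) {x : ℝ × ℝ} (hx : x ∈ square)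
    {v : V} (hv : x ∈ R v) : x ∈ reachWithin M T R (owners R x).card v := by
  induction hk : (owners R x).card using Nat.strong_induction_on generalizing x v with
  | _ k ih =>
    subst hk
    have hc : IsCompact (R v ∩ {y | y.1 ≤ x.1 ∧ x.2 ≤ y.2}) :=
      (isCompact_square.of_isClosed_subset (hR.closed v) (hR.subset_square v)).inter_right
        ((isClosed_le continuous_fst continuous_const).inter
          (isClosed_le continuous_const continuous_snd))
    obtain ⟨y, ⟨hy, hy1, hy2⟩, hmax⟩ := hc.exists_isMaxOn ⟨x, hv, le_rfl, le_rfl⟩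
      (f := fun y => y.2 - y.1) (by fun_prop)
    have hys := hR.subset_square v hy
    have hcard : (owners R y).card ≤ (owners R x).card :=
      Finset.card_le_card fun w hw =>
        mem_owners.2 (hR.upClosed w y (mem_owners.1 hw) x hx hy1 hy2)
    refine upClosed_reachWithin R _ v y (reachWithin_mono R v hcard ?_) x hx hy1 hy2
    refine mem_reachWithin_of_not_mem_strictOwners hR hys
      (fun z hz hzc w hw => ih _ (hzc.trans_le hcard) hz hw rfl) hy fun hS => ?_
    obtain ⟨z, hz, h1, h2, hne⟩ := mem_strictOwners.1 hS
    have := hmax (a := z) ⟨hz, h1.trans hy1, hy2.trans h2⟩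
    simp only [Set.mem_ofPred_eq] at this
    exact hne (Prod.ext (by linarith) (by linarith))

lemma subset_reachWithin_card (hR : ReachLike M T R) (v : V) :
    R v ⊆ reachWithin M T R (Fintype.card V) v := fun _ hx =>
  reachWithin_mono R v (Finset.card_le_univ _)
    (mem_reachWithin_card_owners hR (hR.subset_square v hx) hx)

end Path

/-! ### Contraction of the hyperbola constants. -/

/-- Every point of the unit square that is better for the reachability player than `x`, with an
advantage in budget and an advantage in probability whose product is at least `s`, belongs to the
`i`-th reachability value. -/
def HyperbolaBound (M : MDP V) (T : Finset V) (s : ℝ) (i : ℕ) (v : V) (x : ℝ × ℝ) : Prop :=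
  ∀ y ∈ square, x.1 ≤ y.1 → y.2 ≤ x.2 → s ≤ (y.1 - x.1) * (x.2 - y.2) → y ∈ rval M T i v

lemma HyperbolaBound.mono (hT : ∀ t ∈ T, M.IsSink t) {s s' : ℝ} {i i' : ℕ} {v : V} {x : ℝ × ℝ}
    (h : HyperbolaBound M T s i v x) (hs : s ≤ s') (hi : i ≤ i') :
    HyperbolaBound M T s' i' v x :=
  fun y hy h1 h2 h3 => rval_mono hT v hi (h y hy h1 h2 (hs.trans h3))

lemma HyperbolaBound.of_better {s : ℝ} {i : ℕ} {v : V} {x x' : ℝ × ℝ}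
    (h : HyperbolaBound M T s i v x) (h1 : x.1 ≤ x'.1) (h2 : x'.2 ≤ x.2) :
    HyperbolaBound M T s i v x' := fun y hy h3 h4 h5 =>
  h y hy (h1.trans h3) (h4.trans h2) (h5.trans
    (mul_le_mul (by linarith) (by linarith) (by linarith) (by linarith)))

/-- The point with budget advantage `s / c`, truncated to the unit square. -/
lemma HyperbolaBound.budget {s : ℝ} {i : ℕ} {v : V} {b p : ℝ} (h : HyperbolaBound M T s i v (b, p))
    {c p' : ℝ} (hs : 0 ≤ s) (hc : 0 < c) (hb : 0 ≤ b) (hp' : p' ∈ Set.Icc (0 : ℝ) 1)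
    (hpc : c = p - p') : (min 1 (b + s / c), p') ∈ rval M T i v := by
  have hd : 0 ≤ s / c := div_nonneg hs hc.le
  have hsq : (min 1 (b + s / c), p') ∈ square :=
    mem_square.2 ⟨⟨le_min zero_le_one (by linarith), min_le_left _ _⟩, hp'⟩
  rcases le_total 1 (b + s / c) with h1 | h1
  · exact side_mem_rval i v hsq (Or.inl (min_eq_left h1))
  · refine h _ hsq ?_ (by simp only; linarith) ?_
    · simp only [min_eq_right h1]; linarith
    · simp only [min_eq_right h1, ← hpc]
      rw [add_sub_cancel_left, div_mul_cancel₀ _ hc.ne']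

/-- The point with probability advantage `s / c`, truncated to the unit square. -/
lemma HyperbolaBound.prob {s : ℝ} {i : ℕ} {v : V} {b q : ℝ} (h : HyperbolaBound M T s i v (b, q))
    {c b' : ℝ} (hs : 0 ≤ s) (hc : 0 < c) (hq : q ≤ 1) (hb' : b' ∈ Set.Icc (0 : ℝ) 1)
    (hbc : c = b' - b) : (b', max 0 (q - s / c)) ∈ rval M T i v := by
  have hd : 0 ≤ s / c := div_nonneg hs hc.le
  have hsq : (b', max 0 (q - s / c)) ∈ square :=
    mem_square.2 ⟨hb', le_max_left _ _, max_le zero_le_one (by linarith)⟩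
  rcases le_total (q - s / c) 0 with h1 | h1
  · exact side_mem_rval i v hsq (Or.inr (max_eq_left h1))
  · refine h _ hsq (by simp only; linarith) ?_ ?_
    · simp only [max_eq_right h1]; linarith
    · simp only [max_eq_right h1, ← hbc]
      rw [sub_sub_cancel, mul_div_cancel₀ _ hc.ne']

/-- For a fixed advantage `c` in one coordinate the other one must be `s / c`, linear in `s`. A
control step averages the constants at fixed probability advantage, a random step at fixed budget
advantage. The successor in `G` saves `a * s` with weight at least `deltaMin`; at a control vertex
its weight is `1 / 2`. -/
lemma hyperbolaBound_of_derived {R G : V → Set (ℝ × ℝ)} {s a : ℝ} {i : ℕ}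
    (hRs : ∀ v, R v ⊆ square) (hGs : ∀ v, G v ⊆ square)
    (hs : 0 < s) (ha0 : 0 ≤ a) (ha1 : a ≤ 1)
    (hR : ∀ v, ∀ x ∈ R v, HyperbolaBound M T s i v x)
    (hG : ∀ v, ∀ x ∈ G v, HyperbolaBound M T ((1 - a) * s) i v x)
    {v : V} {x : ℝ × ℝ} (hx : Derived M R G v x) :
    HyperbolaBound M T ((1 - a * M.deltaMin) * s) (i + 1) v x := by
  intro y hy h1 h2 h3
  have hd0 := deltaMin_pos M
  have hd1 := deltaMin_le_half M
  have had : a * M.deltaMin ≤ a * (1 / 2) := mul_le_mul_of_nonneg_left hd1 ha0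
  have hpos : 0 < (1 - a * M.deltaMin) * s := mul_pos (by linarith) hs
  have hs' : 0 ≤ (1 - a) * s := mul_nonneg (by linarith) hs.le
  have hβ : 0 < y.1 - x.1 := (sub_nonneg.2 h1).lt_of_ne fun h => by
    rw [← h, zero_mul] at h3; linarith
  have hπ : 0 < x.2 - y.2 := (sub_nonneg.2 h2).lt_of_ne fun h => by
    rw [← h, mul_zero] at h3; linarith
  have hyU := upClosed_rval (M := M) (T := T) (i + 1) v
  cases hn : M.node v with
  | control E hE =>
    rw [derived_control hn] at hx
    obtain ⟨bp, bm, ⟨w, hw, hm⟩, hp, hx1⟩ := hx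
    have hmem : ((min 1 (bp + s / (x.2 - y.2)) + min 1 (bm + (1 - a) * s / (x.2 - y.2))) / 2, y.2)
        ∈ rval M T (i + 1) v := by
      rw [rval, mem_bellman_control hn]
      refine ⟨hy.2, _, _, ⟨w, hw, ?_⟩, fun w hw => ?_, rfl⟩
      · exact (hG w _ hm).budget hs' hπ (hGs w hm).1.1 hy.2 rfl
      · exact (hR w _ (hp w hw)).budget hs.le hπ (hRs w (hp w hw)).1.1 hy.2 rfl
    refine hyU _ hmem y hy ?_ le_rfl
    have e1 := min_le_right 1 (bp + s / (x.2 - y.2))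
    have e2 := min_le_right 1 (bm + (1 - a) * s / (x.2 - y.2))
    have e3 : s / (x.2 - y.2) + (1 - a) * s / (x.2 - y.2) ≤ 2 * (y.1 - x.1) := by
      rw [← add_div, div_le_iff₀ hπ]
      nlinarith
    simp only
    linarith
  | random δ =>
    rw [derived_random hn] at hx
    obtain ⟨q, ⟨w₀, hw₀, hm⟩, hq, hx2⟩ := hx
    set c := y.1 - x.1 with hc
    let t : V → ℝ := fun w => if w = w₀ then (1 - a) * s else s
    have hqt : ∀ w, 0 < δ.1 w → (y.1, max 0 (q w - t w / c)) ∈ rval M T i w := by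
      intro w hw
      have hq1 := (hRs w (hq w hw)).2.2
      by_cases h : w = w₀
      · subst h
        simp only [t, if_true]
        exact (hG w _ hm).prob hs' hβ hq1 hy.1 hc
      · simp only [t, h, if_false]
        exact (hR w _ (hq w hw)).prob hs.le hβ hq1 hy.1 hc
    have hmem : (y.1, ∑ w, δ.1 w * max 0 (q w - t w / c)) ∈ rval M T (i + 1) v := by
      rw [rval, mem_bellman_random hn]
      exact ⟨hy.1, _, hqt, rfl⟩
    refine hyU _ hmem y hy le_rfl ?_
    have ht : ∑ w, δ.1 w * t w = s - δ.1 w₀ * (a * s) := by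
      have : ∀ w, δ.1 w * t w = δ.1 w * s - if w = w₀ then δ.1 w₀ * (a * s) else 0 := by
        intro w
        by_cases h : w = w₀
        · subst h; simp only [t, if_true]; ring
        · simp [t, h]
      simp only [this, Finset.sum_sub_distrib, ← Finset.sum_mul]
      rw [δ.2.2]
      simp
    have hsum : x.2 - (s - δ.1 w₀ * (a * s)) / c ≤ ∑ w, δ.1 w * max 0 (q w - t w / c) := by
      rw [← ht, hx2, Finset.sum_div, ← Finset.sum_sub_distrib]
      refine Finset.sum_le_sum fun w _ => ?_
      rw [mul_div_assoc, ← mul_sub]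
      exact mul_le_mul_of_nonneg_left (le_max_right _ _) (δ.2.1 w)
    have hle : (s - δ.1 w₀ * (a * s)) / c ≤ x.2 - y.2 := by
      rw [div_le_iff₀ hβ]
      have := mul_le_mul_of_nonneg_right (deltaMin_le hn hw₀) (mul_nonneg ha0 hs.le)
      nlinarith
    simp only
    linarith

/-- The saved fraction is `deltaMin ^ 0 = 1` on the initial values, where the constant is zero, and
loses a factor `deltaMin` per favourable step. -/
lemma hyperbolaBound_of_mem_reachWithin (hT : ∀ t ∈ T, M.IsSink t) {R : V → Set (ℝ × ℝ)}
    (hRs : ∀ v, R v ⊆ square) {s : ℝ} {i : ℕ} (hs : 0 < s)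
    (hR : ∀ v, ∀ x ∈ R v, HyperbolaBound M T s i v x) (m : ℕ) {v : V} {x : ℝ × ℝ}
    (hx : x ∈ reachWithin M T R m v) :
    HyperbolaBound M T ((1 - M.deltaMin ^ m) * s) (i + m) v x := by
  have hd0 := deltaMin_pos M
  have hd1 := deltaMin_le_half M
  induction m generalizing v x with
  | zero =>
    intro y hy h1 h2 _
    exact rval_mono hT v (Nat.zero_le _) (upClosed_rval 0 v x hx y hy h1 h2)
  | succ m ih =>
    rcases hx with hx | ⟨-, y, h1, h2, hy⟩
    · refine (ih hx).mono hT ?_ (by omega)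
      have : M.deltaMin ^ (m + 1) ≤ M.deltaMin ^ m :=
        pow_le_pow_of_le_one hd0.le (by linarith) (Nat.le_succ m)
      exact mul_le_mul_of_nonneg_right (by linarith) hs.le
    · have := hyperbolaBound_of_derived (i := i + m) hRs
        (fun v => reachWithin_subset_square R m v) hs
        (pow_nonneg hd0.le m) (pow_le_one₀ hd0.le (by linarith))
        (fun v x hx => (hR v x hx).mono hT le_rfl (by omega)) (fun v x hx => ih hx) hy
      rw [pow_succ]
      exact this.of_better h1 h2

lemma hyperbolaBound_mul (hT : ∀ t ∈ T, M.IsSink t) (k : ℕ) (v : V) {x : ℝ × ℝ}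
    (hx : x ∈ valStar M T v .reach) :
    HyperbolaBound M T ((1 - M.deltaMin ^ Fintype.card V) ^ k) (k * Fintype.card V) v x := by
  have hd0 := deltaMin_pos M
  have hd1 := deltaMin_le_half M
  have hn : Fintype.card V ≠ 0 := (Fintype.card_pos_iff.2 ⟨v⟩).ne'
  have hpos : 0 < 1 - M.deltaMin ^ Fintype.card V := by
    have := pow_lt_one₀ hd0.le (by linarith) hn
    linarith
  induction k generalizing v x with
  | zero =>
    intro y hy h1 h2 h3
    obtain ⟨⟨a1, a2⟩, a3, a4⟩ := mem_square.1 hy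
    obtain ⟨⟨b1, b2⟩, b3, b4⟩ := mem_square.1 (valStar_reach_subset_square v hx)
    rw [pow_zero] at h3
    -- Within the unit square a product of advantages of at least `1` forces `y.1 = 1`.
    refine side_mem_rval _ v hy (Or.inl ?_)
    nlinarith
  | succ k ih =>
    have := hyperbolaBound_of_mem_reachWithin hT valStar_reach_subset_square (pow_pos hpos k)
      (fun v x hx => ih v hx) (Fintype.card V) (subset_reachWithin_card (reachLike_valStar hT) v hx)
    rw [pow_succ', Nat.succ_mul]
    exact this

lemma hyperbolaBound_radius (hT : ∀ t ∈ T, M.IsSink t) (i : ℕ) (v : V) {x : ℝ × ℝ}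
    (hx : x ∈ valStar M T v .reach) : HyperbolaBound M T (radius M i ^ 2) i v x :=
  (hyperbolaBound_mul hT (i / Fintype.card V) v hx).mono hT
    (pow_div_le_radius_sq M ((Fintype.card_pos_iff.2 ⟨v⟩).ne') i) (Nat.div_mul_le_self _ _)

/-- Such an `x` lies in some `rval k`; worsening it by the radius in both coordinates gives product
`radius ^ 2`, so the shifted point, truncated to the square, is in `rval i`. This makes the second
test of the algorithm sound. -/
lemma infDist_rval_le_radius (hT : ∀ t ∈ T, M.IsSink t) (i : ℕ) (v : V) {x : ℝ × ℝ}
    (hx : x ∈ square) (hs : x ∉ valStar M T v .safe) :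
    Metric.infDist x (rval M T i v) ≤ radius M i := by
  obtain ⟨k, hk⟩ := (mem_valStar_reach_or_mem_valStar_safe (M := M) (T := T) v hx).resolve_right hs
  have hr := radius_pos M i
  obtain ⟨⟨a1, a2⟩, a3, a4⟩ := mem_square.1 hx
  set r := radius M i with hrdef
  have hsq : (min 1 (x.1 + r), max 0 (x.2 - r)) ∈ square :=
    mem_square.2 ⟨⟨le_min zero_le_one (by linarith), min_le_left _ _⟩,
      le_max_left _ _, max_le zero_le_one (by linarith)⟩
  have hmem : (min 1 (x.1 + r), max 0 (x.2 - r)) ∈ rval M T i v := by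
    rcases le_total 1 (x.1 + r) with h1 | h1
    · exact side_mem_rval i v hsq (Or.inl (min_eq_left h1))
    rcases le_total (x.2 - r) 0 with h2 | h2
    · exact side_mem_rval i v hsq (Or.inr (max_eq_left h2))
    have := hyperbolaBound_radius hT i v (rval_subset_valStar k v hk)
    rw [min_eq_right h1, max_eq_right h2] at hsq ⊢
    exact this _ hsq (by simp only; linarith) (by simp only; linarith) (by
      rw [← hrdef]; ring_nf; rfl)
  refine (Metric.infDist_le_dist_of_mem hmem).trans ?_
  rw [Prod.dist_eq, Real.dist_eq, Real.dist_eq]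
  refine max_le (abs_le.2 ⟨?_, ?_⟩) (abs_le.2 ⟨?_, ?_⟩)
  · have := min_le_right 1 (x.1 + r); simp only; linarith
  · have : x.1 ≤ min 1 (x.1 + r) := le_min a2 (by linarith)
    simp only; linarith
  · have : max 0 (x.2 - r) ≤ x.2 := max_le a3 (by linarith)
    simp only; linarith
  · have := le_max_right 0 (x.2 - r); simp only; linarith

end Convergence

/-! ### Policies that keep their promises. -/

section Winning

variable {V : Type*} {T : Finset V}

lemma frestrictLe_last (k : ℕ) (ω : ℕ → V) :
    FinPath.last (Preorder.frestrictLe (π := fun _ => V) k ω) = ω k := rfl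

/-- The path has visited `T`. -/
def Visited (T : Finset V) {k : ℕ} (ρ : FinPath V k) : Prop := ∃ j, ρ j ∈ T

lemma visited_snoc {k : ℕ} {ρ : FinPath V k} {w : V} :
    Visited T (ρ.snoc w) ↔ Visited T ρ ∨ w ∈ T := by
  constructor
  · rintro ⟨j, hj⟩
    by_cases h : j.1 ≤ k
    · exact Or.inl ⟨⟨j.1, Finset.mem_Iic.2 h⟩, by simpa [FinPath.snoc, h] using hj⟩
    · exact Or.inr (by simpa [FinPath.snoc, h] using hj)
  · rintro (⟨j, hj⟩ | hw)
    · refine ⟨⟨j.1, Finset.mem_Iic.2 ((Finset.mem_Iic.1 j.2).trans k.le_succ)⟩, ?_⟩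
      simpa [FinPath.snoc, Finset.mem_Iic.1 j.2] using hj
    · exact ⟨⟨k + 1, Finset.mem_Iic.2 le_rfl⟩, by simpa [FinPath.snoc] using hw⟩

variable [Fintype V] {M : MDP V}

/-- A way to keep the required budget and probability along one step: the bid `β`, the vertex `u`
to move to, and the new requirement `c w` at each successor `w`. -/
structure StepPlan (M : MDP V) (val : V → Set (ℝ × ℝ)) (v : V) (x : ℝ × ℝ)
    (β : ℝ) (u : V) (c : V → ℝ × ℝ) : Prop where
  control : ∀ E hE, M.node v = .control E hE → 0 ≤ β ∧ β ≤ x.1 ∧ u ∈ E ∧ (c u).1 ≤ x.1 - β ∧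
    ∀ w ∈ E, c w ∈ val w ∧ (c w).2 = x.2 ∧ (c w).1 ≤ x.1 + β
  random : ∀ δ, M.node v = .random δ → (∀ w, 0 < δ.1 w → c w ∈ val w ∧ (c w).1 = x.1) ∧
    ∑ w, δ.1 w * (c w).2 = x.2

lemma exists_stepPlan {val : V → Set (ℝ × ℝ)} (hs : ∀ v, val v ⊆ square) {v : V} {x : ℝ × ℝ}
    (hx : x ∈ bellman M val v) : ∃ β u c, StepPlan M val v x β u c := by
  classical
  cases hn : M.node v with
  | control E hE =>
    rw [mem_bellman_control hn] at hx
    obtain ⟨h2, bp, bm, ⟨u, hu, hm⟩, hp, hx1⟩ := hx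
    have hbm : 0 ≤ bm := (hs _ hm).1.1
    have hbp : 0 ≤ bp := (hs _ (hp u hu)).1.1
    rcases le_total bm bp with h | h
    -- Winning leaves `x.1 - (bp - bm) / 2 = bm`; losing gives at least `x.1 + (bp - bm) / 2 = bp`.
    · refine ⟨(bp - bm) / 2, u, fun w => if w = u then (bm, x.2) else (bp, x.2), ?_, ?_⟩
      · intro E' hE' hn'
        rw [hn] at hn'
        cases hn'
        refine ⟨by linarith, by linarith, hu, by simp; linarith, fun w hw => ?_⟩
        by_cases hwu : w = u
        · subst hwu
          simp only [if_true]
          exact ⟨hm, trivial, by linarith⟩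
        · simp only [hwu, if_false]
          exact ⟨hp w hw, trivial, by linarith⟩
      · intro δ hn'
        rw [hn] at hn'
        cases hn'
    -- Here `bp ≤ x.1`, so `bp` is available at every successor without bidding.
    · refine ⟨0, u, fun w => (bp, x.2), ?_, ?_⟩
      · intro E' hE' hn'
        rw [hn] at hn'
        cases hn'
        exact ⟨le_rfl, by linarith, hu, by simp only; linarith,
          fun w hw => ⟨hp w hw, rfl, by simp only; linarith⟩⟩
      · intro δ hn'
        rw [hn] at hn'
        cases hn'
  | random δ =>
    rw [mem_bellman_random hn] at hx
    obtain ⟨h1, q, hq, hx2⟩ := hx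
    refine ⟨0, v, fun w => (x.1, q w), ?_, ?_⟩
    · intro E' hE' hn'
      rw [hn] at hn'
      cases hn'
    · intro δ' hn'
      rw [hn] at hn'
      cases hn'
      exact ⟨fun w hw => ⟨hq w hw, rfl⟩, hx2.symm⟩

/-- The policy that follows step plans, and the requirement that it maintains after each path. -/
lemma exists_tracking_policy {val : ℕ → V → Set (ℝ × ℝ)} (hs : ∀ k v, val k v ⊆ square)
    (hval : ∀ k v, val k v ⊆ bellman M (val (k + 1)) v) (x₀ : ℝ × ℝ) :
    ∃ (π : Policy M) (x : (k : ℕ) → FinPath V k → ℝ × ℝ), (∀ ρ, x 0 ρ = x₀) ∧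
      ∀ k (ρ : FinPath V k), x k ρ ∈ val k ρ.last → ∃ β u,
        StepPlan M (val (k + 1)) ρ.last (x k ρ) β u (fun w => x (k + 1) (ρ.snoc w)) ∧
        (M.IsControl ρ.last → ∀ b, (x k ρ).1 ≤ b → π.act b k ρ = (β, u)) := by
  classical
  have hplan : ∀ k v x, ∃ β u c, (M.IsControl v → u ∈ M.succ v) ∧
      (x ∈ val k v → StepPlan M (val (k + 1)) v x β u c) := by
    intro k v x
    by_cases hx : x ∈ val k v
    · obtain ⟨β, u, c, h⟩ := exists_stepPlan (hs (k + 1)) (hval k v hx)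
      refine ⟨β, u, c, fun hc => ?_, fun _ => h⟩
      cases hn : M.node v with
      | control E hE =>
        rw [succ_control hn]
        exact (h.control E hE hn).2.2.1
      | random δ => simp [MDP.IsControl, hn] at hc
    · by_cases hc : M.IsControl v
      · cases hn : M.node v with
        | control E hE =>
          obtain ⟨u, hu⟩ := hE
          exact ⟨0, u, fun _ => 0, fun _ => by rwa [succ_control hn], fun h => absurd h hx⟩
        | random δ => simp [MDP.IsControl, hn] at hc
      · exact ⟨0, v, fun _ => 0, fun h => absurd h hc, fun h => absurd h hx⟩
  choose β u c hu hc using hplan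
  let x : (k : ℕ) → FinPath V k → ℝ × ℝ := fun k => Nat.rec (motive := fun k => FinPath V k → ℝ × ℝ)
    (fun _ => x₀) (fun k y ρ => c k ρ.init.last (y ρ.init) ρ.last) k
  have hxs : ∀ k (ρ : FinPath V k) w, x (k + 1) (ρ.snoc w) = c k ρ.last (x k ρ) w := by
    intro k ρ w
    change c k (ρ.snoc w).init.last (x k (ρ.snoc w).init) (ρ.snoc w).last = _
    simp
  -- Clipping makes the bid legal for every budget; it has no effect when the budget covers the
  -- requirement.
  refine ⟨⟨fun b k ρ => (max 0 (min (β k ρ.last (x k ρ)) b), u k ρ.last (x k ρ)),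
    fun b hb n ρ _ => le_max_left _ _, fun b hb n ρ _ => max_le hb.1 (min_le_right _ _),
    fun b hb n ρ h => hu _ _ _ h⟩, x, fun _ => rfl, fun k ρ hρ => ?_⟩
  have h := hc k ρ.last (x k ρ) hρ
  refine ⟨β k ρ.last (x k ρ), u k ρ.last (x k ρ), ?_, fun hcon b hb => ?_⟩
  · simp only [hxs]
    exact h
  · cases hn : M.node ρ.last with
    | control E hE =>
      obtain ⟨h0, h1, -⟩ := h.control E hE hn
      simp only [min_eq_left (h1.trans hb), max_eq_right h0]
    | random δ => simp [MDP.IsControl, hn] at hcon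

lemma budget_snoc_control {σ τ : Policy M} {B : ℝ} {k : ℕ} {ρ : FinPath V k} {w : V}
    (h : M.IsControl ρ.last) :
    budget σ τ B (k + 1) (ρ.snoc w) = (bidding σ τ (budget σ τ B k ρ) k ρ).2 := by
  cases hn : M.node ρ.last with
  | control E hE => simp [budget, hn]
  | random δ => simp [MDP.IsControl, hn] at h

lemma budget_snoc_random {σ τ : Policy M} {B : ℝ} {k : ℕ} {ρ : FinPath V k} {w : V}
    {δ : stdSimplex ℝ V} (h : M.node ρ.last = .random δ) :
    budget σ τ B (k + 1) (ρ.snoc w) = budget σ τ B k ρ := by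
  simp [budget, h]

variable [MeasurableSpace V] [DiscreteMeasurableSpace V]

instance (σ τ : Policy M) (v : V) (B : ℝ) : IsProbabilityMeasure (pathMeasure σ τ v B) := by
  unfold pathMeasure
  infer_instance

lemma pathMeasure_reach_le {σ τ : Policy M} {v : V} {B p : ℝ} (hp : 0 ≤ p)
    (h : ∀ k, (pathMeasure σ τ v B).real
      {ω | Preorder.frestrictLe (π := fun _ => V) k ω ∈ {ρ : FinPath V k | Visited T ρ}} ≤ p) :
    (pathMeasure σ τ v B).real (Reach T) ≤ p := by
  have hmono : Monotone fun k => {ω : ℕ → V | Preorder.frestrictLe (π := fun _ => V) k ω ∈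
      {ρ : FinPath V k | Visited T ρ}} := by
    rintro k l hkl ω ⟨j, hj⟩
    exact ⟨⟨j.1, Finset.mem_Iic.2 ((Finset.mem_Iic.1 j.2).trans hkl)⟩, hj⟩
  have hU : Reach T = ⋃ k, {ω : ℕ → V | Preorder.frestrictLe (π := fun _ => V) k ω ∈
      {ρ : FinPath V k | Visited T ρ}} := by
    ext ω
    simp only [Set.mem_iUnion]
    constructor
    · rintro ⟨i, hi⟩
      exact ⟨i, ⟨i, Finset.mem_Iic.2 le_rfl⟩, hi⟩
    · rintro ⟨k, j, hj⟩
      exact ⟨j.1, hj⟩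
  refine ENNReal.toReal_le_of_le_ofReal hp ?_
  rw [hU, hmono.measure_iUnion]
  refine iSup_le fun k => ?_
  rw [← ofReal_measureReal]
  exact ENNReal.ofReal_le_ofReal (h k)

variable [DecidableEq V]

/-- The required budget stays below `1` and within the actual budget, and one minus the promised
probability does not grow in expectation. After `i` steps the promise is in `rval 0`, which off `T`
allows only probability zero; so the chance of being off `T` is at most `1 - p`. -/
lemma reach_winning_of_mem_rval (hT : ∀ t ∈ T, M.IsSink t) {i : ℕ} {v : V} {b p B : ℝ}
    (h : (b, p) ∈ rval M T i v) (hb : b < 1) (hbB : b ≤ B) (hB : B ≤ 1) :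
    (winning M T v B p .reach).Nonempty := by
  -- Subtraction is truncated: from step `i` on, the stage remains zero.
  have hval : ∀ k w, rval M T (i - k) w ⊆ bellman M (fun w => rval M T (i - (k + 1)) w) w := by
    intro k w
    rcases lt_or_ge k i with hk | hk
    · have : i - k = i - (k + 1) + 1 := by omega
      rw [this]
      exact subset_rfl
    · have h1 : i - k = 0 := by omega
      have h2 : i - (k + 1) = 0 := by omega
      rw [h1, h2]
      exact rval_le_succ hT 0 w
  obtain ⟨σ, x, hx0, hx⟩ := exists_tracking_policy (fun k => rval_subset_square (i - k)) hval (b, p)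
  refine ⟨σ, fun τ => ?_⟩
  have hmain := pathMeasure_le_of_invariant σ τ v B
    (fun k ρ => x k ρ ∈ rval M T (i - k) ρ.last ∧ (x k ρ).1 < 1 ∧
      (x k ρ).1 ≤ budget σ τ B k ρ ∧ budget σ τ B k ρ ≤ 1) (fun k ρ => 1 - (x k ρ).2)
    ?_ ?_ ?_ ?_ i {ρ | ρ.last ∉ T} ?_
  · have hc : {ω : ℕ → V | Preorder.frestrictLe (π := fun _ => V) i ω ∈
        {ρ : FinPath V i | ρ.last ∉ T}} = {ω | ω i ∈ T}ᶜ := by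
      ext ω
      simp [frestrictLe_last]
    have hmeas : MeasurableSet {ω : ℕ → V | ω i ∈ T} :=
      measurableSet_preimage (measurable_pi_apply i) (T : Set V).toFinite.measurableSet
    rw [hc, probReal_compl_eq_one_sub hmeas, hx0] at hmain
    have hsub : (pathMeasure σ τ v B).real {ω | ω i ∈ T} ≤
        (pathMeasure σ τ v B).real (Reach T) := measureReal_mono fun ω hω => ⟨i, hω⟩
    simp only at hmain
    linarith
  · rw [hx0]
    exact ⟨h, hb, hbB, hB⟩
  · rintro k ρ ⟨h1, -⟩
    have := (rval_subset_square _ _ h1).2.2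
    linarith
  · rintro k ρ ⟨h1, h2, h3, h4⟩ hcon
    obtain ⟨β, u, hplan, hact⟩ := hx k ρ h1
    have hx0 : 0 ≤ (x k ρ).1 := (rval_subset_square _ _ h1).1.1
    have hact := hact hcon _ h3
    rw [budget_snoc_control hcon, FinPath.last_snoc]
    cases hn : M.node ρ.last with
    | random δ => simp [MDP.IsControl, hn] at hcon
    | control E hE =>
      obtain ⟨c1, c2, c3, c4, c5⟩ := hplan.control E hE hn
      have hτI : 1 - budget σ τ B k ρ ∈ Set.Icc (0 : ℝ) 1 := ⟨by linarith, by linarith⟩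
      have t1 := τ.bid_nonneg _ hτI k ρ hcon
      have t2 := τ.bid_le _ hτI k ρ hcon
      have t3 := τ.move_mem _ hτI k ρ hcon
      rw [succ_control hn] at t3
      unfold scheduler bidding
      rw [hact]
      split
      · obtain ⟨d1, d2, d3⟩ := c5 u c3
        exact ⟨⟨d1, by simp only; linarith, by simp only; linarith, by simp only; linarith⟩,
          by simp only; linarith⟩
      -- A lost bid is strictly exceeded, so the new requirement is strictly below the new budget
      -- and hence below `1`.
      · rename_i hlt
        simp only [not_le] at hlt
        obtain ⟨d1, d2, d3⟩ := c5 _ t3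
        exact ⟨⟨d1, by simp only; linarith, by simp only; linarith, by simp only; linarith⟩,
          by simp only; linarith⟩
  · rintro k ρ ⟨h1, h2, h3, h4⟩ δ hn
    obtain ⟨β, u, hplan, -⟩ := hx k ρ h1
    obtain ⟨c1, c2⟩ := hplan.random δ hn
    refine ⟨fun w hw => ?_, ?_⟩
    · obtain ⟨d1, d2⟩ := c1 w hw
      rw [budget_snoc_random hn, FinPath.last_snoc, d2]
      exact ⟨d1, h2, h3, h4⟩
    · simp only [mul_sub, mul_one, Finset.sum_sub_distrib, c2]
      rw [δ.2.2]
  · rintro ρ hρ ⟨h1, h2, -⟩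
    have hρ' : ρ.last ∉ T := hρ
    simp only [Nat.sub_self, rval, hρ', if_false] at h1
    rcases h1 with h1 | h1
    · have : (x i ρ).2 = 0 := h1.2
      linarith
    · have : (x i ρ).1 = 1 := h1.1
      linarith

/-- The promises of safety are tracked in reflected coordinates, so that `(x k ρ).1` is the budget
safety needs and `1 - (x k ρ).2` bounds the probability of reaching `T`. -/
lemma safe_winning_of_mem_valStar (hT : ∀ t ∈ T, M.IsSink t) {v : V} {b p B : ℝ}
    (h : (b, p) ∈ valStar M T v .safe) (hb : B < b ∨ b = 1) (hB0 : 0 ≤ B) (hB1 : B ≤ 1) :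
    (winning M T v B p .safe).Nonempty := by
  classical
  let val : V → Set (ℝ × ℝ) := fun w => reflect ⁻¹' valStar M T w .safe
  have hsafe_sq : ∀ w, valStar M T w .safe ⊆ square := fun w x hx =>
    sval_subset_square 0 w (Set.mem_iInter.1 hx 0)
  have hvs : ∀ w, val w ⊆ square := fun w y hy => reflect_mem_square.1 (hsafe_sq w hy)
  have hval : ∀ w, val w ⊆ bellman M val w := by
    intro w y hy
    rw [← reflect_reflect y]
    refine reflect_mem_bellman (fun w z hz => ?_) (valStar_safe_subset_bellman hT w hy)
    change reflect (reflect z) ∈ valStar M T w .safe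
    rwa [reflect_reflect]
  obtain ⟨τ, x, hx0, hx⟩ := exists_tracking_policy (fun _ : ℕ => hvs) (fun _ => hval) (reflect (b, p))
  refine ⟨τ, fun σ => ?_⟩
  -- The strict inequality, or a requirement of zero, keeps the needed budget below `1`. So at a
  -- target only the side with reaching probability `1` of `sval 0` remains.
  let Inv : (k : ℕ) → FinPath V k → Prop := fun k ρ => x k ρ ∈ val ρ.last ∧
    ((x k ρ).1 < 1 - budget σ τ B k ρ ∨ (x k ρ).1 = 0) ∧
    0 ≤ budget σ τ B k ρ ∧ budget σ τ B k ρ ≤ 1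
  -- Freezing the value at `1` after a visit causes no jump: at the first visit the promised bound
  -- is already `1`.
  let f : (k : ℕ) → FinPath V k → ℝ := fun k ρ => if Visited T ρ then 1 else 1 - (x k ρ).2
  have hInvT : ∀ k (ρ : FinPath V k), Inv k ρ → ρ.last ∈ T → (x k ρ).2 = 0 := by
    rintro k ρ ⟨h1, h2, h3, h4⟩ hρ
    have h5 : reflect (x k ρ) ∈ sval M T 0 ρ.last := Set.mem_iInter.1 h1 0
    simp only [sval, hρ, if_true] at h5
    rcases h5 with h5 | h5
    · have : 1 - (x k ρ).2 = 1 := h5.2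
      linarith
    · have : 1 - (x k ρ).1 = 0 := h5.1
      rcases h2 with h2 | h2 <;> linarith
  have hfsnoc : ∀ k (ρ : FinPath V k) w, ¬ Visited T ρ → Inv (k + 1) (ρ.snoc w) →
      f (k + 1) (ρ.snoc w) = 1 - (x (k + 1) (ρ.snoc w)).2 := by
    intro k ρ w hρ hI
    by_cases hw : w ∈ T
    · have h0 := hInvT _ _ hI (by simpa using hw)
      simp only [f, h0, sub_zero, ite_self]
    · have : ¬ Visited T (ρ.snoc w) := by simp [visited_snoc, hρ, hw]
      simp only [f, this, if_false]
  have hI0 : Inv 0 fun _ => v := by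
    refine ⟨?_, ?_, hB0, hB1⟩
    · rw [hx0]
      change reflect (reflect (b, p)) ∈ valStar M T v .safe
      rwa [reflect_reflect]
    · rw [hx0]
      change 1 - b < 1 - B ∨ 1 - b = 0
      rcases hb with hb | hb
      · left; linarith
      · right; linarith
  have hf0 : f 0 (fun _ => v) = p := by
    have h1 : 1 - (x 0 fun _ => v).2 = p := by rw [hx0]; simp [reflect]
    by_cases hv : v ∈ T
    · have h0 := hInvT _ _ hI0 hv
      simp only [f, h0, sub_zero, ite_self]
      rw [← h1, h0, sub_zero]
    · have : ¬ Visited T (fun _ => v : FinPath V 0) := by rintro ⟨j, hj⟩; exact hv hj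
      simp only [f, this, if_false]
      exact h1
  refine pathMeasure_reach_le (hsafe_sq v h).2.1 fun k => ?_
  rw [← hf0]
  refine pathMeasure_le_of_invariant σ τ v B (fun k ρ => Visited T ρ ∨ Inv k ρ) f
    (Or.inr hI0) ?_ ?_ ?_ k _ fun ρ hρ _ => ?_
  · intro k ρ hI
    by_cases hv : Visited T ρ
    · simp [f, hv]
    · have := (hvs _ (hI.resolve_left hv).1).2.2
      simp only [f, hv, if_false]
      linarith
  · intro k ρ hI hcon
    by_cases hv : Visited T ρ
    · have hv' : Visited T (ρ.snoc (scheduler σ τ B k ρ)) := visited_snoc.2 (Or.inl hv)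
      exact ⟨Or.inl hv', by simp [f, hv, hv']⟩
    have hIρ := hI.resolve_left hv
    obtain ⟨h1, h2, h3, h4⟩ := hIρ
    obtain ⟨β, u, hplan, hact⟩ := hx k ρ h1
    have hx0 : 0 ≤ (x k ρ).1 := (hvs _ h1).1.1
    have hle : (x k ρ).1 ≤ 1 - budget σ τ B k ρ := by rcases h2 with h2 | h2 <;> linarith
    have hact := hact hcon _ hle
    have key : Inv (k + 1) (ρ.snoc (scheduler σ τ B k ρ)) ∧
        (x (k + 1) (ρ.snoc (scheduler σ τ B k ρ))).2 = (x k ρ).2 := by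
      simp only [Inv]
      rw [budget_snoc_control hcon, FinPath.last_snoc]
      cases hn : M.node ρ.last with
      | random δ => simp [MDP.IsControl, hn] at hcon
      | control E hE =>
        obtain ⟨c1, c2, c3, c4, c5⟩ := hplan.control E hE hn
        have hσI : budget σ τ B k ρ ∈ Set.Icc (0 : ℝ) 1 := ⟨h3, h4⟩
        have t1 := σ.bid_nonneg _ hσI k ρ hcon
        have t2 := σ.bid_le _ hσI k ρ hcon
        have t3 := σ.move_mem _ hσI k ρ hcon
        rw [succ_control hn] at t3
        unfold scheduler bidding
        rw [hact]
        split
        · rename_i hlt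
          simp only at hlt
          obtain ⟨d1, d2, d3⟩ := c5 _ t3
          have hy0 := (hvs _ d1).1.1
          refine ⟨⟨d1, ?_, by simp only; linarith, by simp only; linarith⟩, d2⟩
          rcases h2 with h2 | h2
          · left; simp only; linarith
          · right; linarith
        · obtain ⟨d1, d2, d3⟩ := c5 u c3
          have hy0 := (hvs _ d1).1.1
          refine ⟨⟨d1, ?_, by simp only; linarith, by simp only; linarith⟩, d2⟩
          rcases h2 with h2 | h2
          · left; simp only; linarith
          · right; simp only; linarith
    refine ⟨Or.inr key.1, ?_⟩
    rw [hfsnoc _ _ _ hv key.1, key.2]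
    simp [f, hv]
  · intro k ρ hI δ hn
    by_cases hv : Visited T ρ
    · have hv' : ∀ w, Visited T (ρ.snoc w) := fun w => visited_snoc.2 (Or.inl hv)
      refine ⟨fun w _ => Or.inl (hv' w), ?_⟩
      simp only [f, hv, hv', if_true, mul_one]
      rw [δ.2.2]
    have hIρ := hI.resolve_left hv
    obtain ⟨h1, h2, h3, h4⟩ := hIρ
    obtain ⟨β, u, hplan, -⟩ := hx k ρ h1
    obtain ⟨c1, c2⟩ := hplan.random δ hn
    have key : ∀ w, 0 < δ.1 w → Inv (k + 1) (ρ.snoc w) := by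
      intro w hw
      obtain ⟨d1, d2⟩ := c1 w hw
      simp only [Inv]
      rw [budget_snoc_random hn, FinPath.last_snoc, d2]
      exact ⟨d1, h2, h3, h4⟩
    refine ⟨fun w hw => Or.inr (key w hw), le_of_eq ?_⟩
    have : ∀ w, δ.1 w * f (k + 1) (ρ.snoc w) = δ.1 w * (1 - (x (k + 1) (ρ.snoc w)).2) := by
      intro w
      rcases (δ.2.1 w).eq_or_lt with h0 | h0
      · simp [← h0]
      · rw [hfsnoc _ _ _ hv (key w h0)]
    simp only [this, mul_sub, mul_one, Finset.sum_sub_distrib, c2, f, hv, if_false]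
    rw [δ.2.2]
  · have hρ' : Visited T ρ := hρ
    simp [f, hρ']

end Winning

/-! ### Specifications of list folds. -/

section Folds

variable {α β γ : Type*}

lemma foldl_max_spec [LinearOrder γ] (P : α → Prop) [DecidablePred P] (g : α → γ) (l : List α)
    (b : γ) :
    b ≤ l.foldl (fun r c => if P c then max r (g c) else r) b ∧
    (∀ c ∈ l, P c → g c ≤ l.foldl (fun r c => if P c then max r (g c) else r) b) ∧
    (l.foldl (fun r c => if P c then max r (g c) else r) b = b ∨
      ∃ c ∈ l, P c ∧ l.foldl (fun r c => if P c then max r (g c) else r) b = g c) := by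
  induction l generalizing b with
  | nil => simp
  | cons a l ih =>
    simp only [List.foldl_cons]
    by_cases h : P a
    · simp only [if_pos h]
      obtain ⟨h1, h2, h3⟩ := ih (max b (g a))
      refine ⟨(le_max_left _ _).trans h1, ?_, ?_⟩
      · intro c hc hPc
        rcases List.mem_cons.1 hc with rfl | hc
        · exact (le_max_right _ _).trans h1
        · exact h2 c hc hPc
      · rcases h3 with h3 | ⟨c, hc, hPc, h3⟩
        · rw [h3]
          rcases max_choice b (g a) with h4 | h4
          · exact Or.inl h4
          · exact Or.inr ⟨a, List.mem_cons_self, h, h4⟩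
        · exact Or.inr ⟨c, List.mem_cons_of_mem _ hc, hPc, h3⟩
    · simp only [if_neg h]
      obtain ⟨h1, h2, h3⟩ := ih b
      refine ⟨h1, ?_, ?_⟩
      · intro c hc hPc
        rcases List.mem_cons.1 hc with rfl | hc
        · exact absurd hPc h
        · exact h2 c hc hPc
      · rcases h3 with h3 | ⟨c, hc, hPc, h3⟩
        · exact Or.inl h3
        · exact Or.inr ⟨c, List.mem_cons_of_mem _ hc, hPc, h3⟩

lemma foldl_min_spec [LinearOrder γ] (P : α → Prop) [DecidablePred P] (g : α → γ) (l : List α)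
    (b : γ) :
    l.foldl (fun r c => if P c then min r (g c) else r) b ≤ b ∧
    (∀ c ∈ l, P c → l.foldl (fun r c => if P c then min r (g c) else r) b ≤ g c) ∧
    (l.foldl (fun r c => if P c then min r (g c) else r) b = b ∨
      ∃ c ∈ l, P c ∧ l.foldl (fun r c => if P c then min r (g c) else r) b = g c) :=
  foldl_max_spec (γ := γᵒᵈ) P g l b

lemma foldl_true_iff (P : α → Prop) [DecidablePred P] (l : List α) (b : Bool) :
    l.foldl (fun r c => if P c then true else r) b = true ↔ b = true ∨ ∃ c ∈ l, P c := by
  induction l generalizing b with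
  | nil => simp
  | cons a l ih =>
    rw [List.foldl_cons, ih]
    by_cases h : P a <;> simp [h]

lemma mem_foldl_cons_iff (g : α → β) (l : List α) (acc : List β) (x : β) :
    x ∈ l.foldl (fun acc c => g c :: acc) acc ↔ x ∈ acc ∨ ∃ c ∈ l, x = g c := by
  induction l generalizing acc with
  | nil => simp
  | cons a l ih =>
    rw [List.foldl_cons, ih]
    simp only [List.mem_cons, exists_eq_or_imp]
    tauto

lemma mem_foldl_iff (f : List β → α → List β) (Q : α → β → Prop)
    (hf : ∀ acc a x, x ∈ f acc a ↔ x ∈ acc ∨ Q a x) (l : List α) (acc : List β) (x : β) :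
    x ∈ l.foldl f acc ↔ x ∈ acc ∨ ∃ a ∈ l, Q a x := by
  induction l generalizing acc with
  | nil => simp
  | cons a l ih =>
    rw [List.foldl_cons, ih, hf]
    simp only [List.mem_cons, exists_eq_or_imp]
    tauto

lemma length_foldl_le (f : List β → α → List β) (k : α → ℕ)
    (hf : ∀ acc a, (f acc a).length ≤ acc.length + k a) (l : List α) (acc : List β) :
    (l.foldl f acc).length ≤ acc.length + (l.map k).sum := by
  induction l generalizing acc with
  | nil => simp
  | cons a l ih =>
    rw [List.foldl_cons, List.map_cons, List.sum_cons]
    have := ih (f acc a)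
    have := hf acc a
    omega

lemma foldl_add_eq (g : α → ℝ) (l : List α) (s : ℝ) :
    l.foldl (fun s u => s + g u) s = s + (l.map g).sum := by
  induction l generalizing s with
  | nil => simp
  | cons a l ih => rw [List.foldl_cons, ih, List.map_cons, List.sum_cons, add_assoc]

lemma foldl_mul_mul_eq (d : ℝ) (l : List α) (s : ℝ) :
    l.foldl (fun s _ => s * d * d) s = s * d ^ (2 * l.length) := by
  induction l generalizing s with
  | nil => simp
  | cons a l ih => rw [List.foldl_cons, ih, List.length_cons]; ring

end Folds

/-! ### Values and costs of composed computations. -/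

namespace Cost

variable {α β : Type*}

@[simp] lemma val_ret (x : α) : (ret x).val = x := rfl
@[simp] lemma val_pure (x : α) : (pure x : Cost α).val = x := rfl
@[simp] lemma val_op (x : α) : (op x).val = x := rfl
@[simp] lemma val_test (P : Prop) [Decidable P] : (test P).val = decide P := rfl
@[simp] lemma val_bind.{u} {α β : Type u} (x : Cost α) (f : α → Cost β) : (x >>= f).val = (f x.val).val := rfl
@[simp] lemma val_andThen (x : Cost α) (f : α → Cost β) :
    (andThen x f).val = (f x.val).val := rfl
@[simp] lemma val_ite (P : Prop) [Decidable P] (x y : Cost α) :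
    (if P then x else y).val = if P then x.val else y.val := by split <;> rfl

@[simp] lemma val_fold (f : β → α → Cost β) (b : β) (l : List α) :
    (fold f b l).val = l.foldl (fun b a => (f b a).val) b := by
  induction l generalizing b with
  | nil => rfl
  | cons a l ih => simp [fold, ih]

/-- Time and space are at most `t`. -/
def Within (x : Cost α) (t : ℕ) : Prop := x.time ≤ t ∧ x.space ≤ t

lemma Within.mono {x : Cost α} {s t : ℕ} (h : Within x s) (hst : s ≤ t) : Within x t :=
  ⟨h.1.trans hst, h.2.trans hst⟩

lemma within_ret (x : α) : Within (ret x) 0 := ⟨le_rfl, le_rfl⟩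

lemma within_op (x : α) : Within (op x) 1 := ⟨le_rfl, le_rfl⟩

lemma within_test (P : Prop) [Decidable P] : Within (test P) 1 := ⟨le_rfl, Nat.zero_le 1⟩

lemma within_bind.{u} {α β : Type u} {x : Cost α} {f : α → Cost β} {s t : ℕ} (hx : Within x s)
    (hf : Within (f x.val) t) : Within (x >>= f) (s + t) :=
  ⟨add_le_add hx.1 hf.1, add_le_add hx.2 hf.2⟩

lemma within_ite {P : Prop} [Decidable P] {x y : Cost α} {t : ℕ} (hx : Within x t)
    (hy : Within y t) : Within (if P then x else y) t := by split <;> assumption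

lemma within_fold {f : β → α → Cost β} {t : α → ℕ} {l : List α}
    (h : ∀ b, ∀ a ∈ l, Within (f b a) (t a)) (b : β) :
    Within (fold f b l) (l.map fun a => t a + 1).sum := by
  induction l generalizing b with
  | nil => exact within_ret b
  | cons a l ih =>
    have h1 := h b a List.mem_cons_self
    have h2 := ih (fun b a ha => h b a (List.mem_cons_of_mem _ ha)) (f b a).val
    simp only [List.map_cons, List.sum_cons]
    constructor
    · change 1 + ((f b a).time + (fold f (f b a).val l).time) ≤ _
      have := h1.1; have := h2.1; omega
    · change 0 + ((f b a).space + (fold f (f b a).val l).space) ≤ _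
      have := h1.2; have := h2.2; omega

lemma within_fold_const {f : β → α → Cost β} {t : ℕ} {l : List α}
    (h : ∀ b, ∀ a ∈ l, Within (f b a) t) (b : β) :
    Within (fold f b l) (l.length * (t + 1)) := by
  have := within_fold (t := fun _ => t) h b
  simpa using this

lemma within_table {V : Type*} [Fintype V] {f : V → Cost α} {t : ℕ} (h : ∀ v, Within (f v) t) :
    Within (table f) (Fintype.card V * (t + 1)) := by
  constructor
  · refine (Finset.sum_le_card_nsmul Finset.univ _ (t + 1) fun v _ => ?_).trans ?_
    · exact Nat.succ_le_succ (h v).1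
    · simp
  · refine (Finset.sum_le_card_nsmul Finset.univ _ (t + 1) fun v _ => ?_).trans ?_
    · exact Nat.succ_le_succ (h v).2
    · simp

end Cost

open Cost

/-! ### Corner lists as representations of staircase sets. -/

section Corners

/-- The list of corners represents the set. -/
structure Corners.Represents (G : Corners) (S : Set (ℝ × ℝ)) : Prop where
  corner_mem : ∀ c ∈ G, c ∈ S
  exists_corner : ∀ x ∈ S, ∃ c ∈ G, c.1 ≤ x.1 ∧ x.2 ≤ c.2

lemma Corners.within_bestProb (G : Corners) (B : ℝ) : Within (G.bestProb B) (3 * G.length) :=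
  (within_fold_const (t := 2) (fun _ _ _ => within_bind (s := 1) (t := 1) (within_test _)
    (within_ite (within_op _) ((within_ret _).mono (Nat.zero_le 1)))) 0).mono (by omega)

lemma Corners.within_leastBudget (G : Corners) (p : ℝ) :
    Within (G.leastBudget p) (3 * G.length) :=
  (within_fold_const (t := 2) (fun _ _ _ => within_bind (s := 1) (t := 1) (within_test _)
    (within_ite (within_op _) ((within_ret _).mono (Nat.zero_le 1)))) 1).mono (by omega)

lemma Corners.within_contains (G : Corners) (B p : ℝ) : Within (G.contains B p) (4 * G.length) :=
  (within_fold_const (t := 3) (fun _ _ _ => within_bind (s := 1) (t := 2) (within_test _)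
    (within_ite (within_bind (s := 1) (t := 1) (within_test _)
      (within_ite (within_op _) ((within_ret _).mono (Nat.zero_le 1))))
      ((within_ret _).mono (Nat.zero_le 2)))) false).mono (by omega)

lemma Corners.within_dist (G : Corners) (B p : ℝ) : Within (G.dist B p) (6 * G.length) :=
  (within_fold_const (t := 5) (fun _ _ _ => within_bind (s := 1) (t := 4) (within_op _)
    (within_bind (s := 1) (t := 3) (within_op _) (within_bind (s := 1) (t := 2) (within_op _)
      (within_bind (s := 1) (t := 1) (within_op _) (within_op _))))) 1).mono (by omega)

lemma Corners.bestProb_spec (G : Corners) (B : ℝ) :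
    0 ≤ (G.bestProb B).val ∧ (∀ c ∈ G, c.1 ≤ B → c.2 ≤ (G.bestProb B).val) ∧
    ((G.bestProb B).val = 0 ∨ ∃ c ∈ G, c.1 ≤ B ∧ (G.bestProb B).val = c.2) := by
  have : (G.bestProb B).val = G.foldl (fun r c => if c.1 ≤ B then max r c.2 else r) 0 := by
    simp [Corners.bestProb]
  rw [this]
  exact foldl_max_spec (fun c : ℝ × ℝ => c.1 ≤ B) Prod.snd G 0

lemma Corners.leastBudget_spec (G : Corners) (p : ℝ) :
    (G.leastBudget p).val ≤ 1 ∧ (∀ c ∈ G, p ≤ c.2 → (G.leastBudget p).val ≤ c.1) ∧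
    ((G.leastBudget p).val = 1 ∨ ∃ c ∈ G, p ≤ c.2 ∧ (G.leastBudget p).val = c.1) := by
  have : (G.leastBudget p).val = G.foldl (fun r c => if p ≤ c.2 then min r c.1 else r) 1 := by
    simp [Corners.leastBudget]
  rw [this]
  exact foldl_min_spec (fun c : ℝ × ℝ => p ≤ c.2) Prod.fst G 1

lemma Corners.contains_iff (G : Corners) (B p : ℝ) :
    (G.contains B p).val = true ↔ ∃ c ∈ G, c.1 ≤ B ∧ p ≤ c.2 := by
  have : (G.contains B p).val =
      G.foldl (fun r c => if c.1 ≤ B ∧ p ≤ c.2 then true else r) false := by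
    simp [Corners.contains, ite_and]
  rw [this, foldl_true_iff (fun c : ℝ × ℝ => c.1 ≤ B ∧ p ≤ c.2)]
  simp

lemma Corners.dist_spec (G : Corners) (B p : ℝ) :
    (∀ c ∈ G, (G.dist B p).val ≤ max (max (c.1 - B) (p - c.2)) 0) ∧
    ((G.dist B p).val = 1 ∨ ∃ c ∈ G, (G.dist B p).val = max (max (c.1 - B) (p - c.2)) 0) := by
  have : (G.dist B p).val = G.foldl (fun r c => if True then
      min r (max (max (c.1 - B) (p - c.2)) 0) else r) 1 := by
    simp [Corners.dist]
  rw [this]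
  have h := foldl_min_spec (fun _ : ℝ × ℝ => True)
    (fun c => max (max (c.1 - B) (p - c.2)) 0) G 1
  refine ⟨fun c hc => h.2.1 c hc trivial, h.2.2.imp_right ?_⟩
  rintro ⟨c, hc, -, he⟩
  exact ⟨c, hc, he⟩

variable {V : Type*} [Fintype V] [DecidableEq V] {M : MDP V} {T : Finset V} {i : ℕ} {v : V}
  {G : Corners}

/-- The default `0`, when no corner qualifies, is correct because `rval` contains the side of
probability zero. In the same way the side of budget one justifies the default `1` of `leastBudget`.
-/
lemma Corners.Represents.le_bestProb_iff (h : G.Represents (rval M T i v)) {x : ℝ × ℝ}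
    (hx : x ∈ square) : x.2 ≤ (G.bestProb x.1).val ↔ x ∈ rval M T i v := by
  obtain ⟨h0, h1, h2⟩ := G.bestProb_spec x.1
  constructor
  · intro hle
    rcases h2 with h2 | ⟨c, hc, hc1, h2⟩
    · exact side_mem_rval i v hx (Or.inr (le_antisymm (h2 ▸ hle) hx.2.1))
    · exact upClosed_rval i v c (h.corner_mem c hc) x hx hc1 (h2 ▸ hle)
  · intro hmem
    obtain ⟨c, hc, hc1, hc2⟩ := h.exists_corner x hmem
    exact hc2.trans (h1 c hc hc1)

lemma Corners.Represents.leastBudget_le_iff (h : G.Represents (rval M T i v)) {x : ℝ × ℝ}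
    (hx : x ∈ square) : (G.leastBudget x.2).val ≤ x.1 ↔ x ∈ rval M T i v := by
  obtain ⟨h0, h1, h2⟩ := G.leastBudget_spec x.2
  constructor
  · intro hle
    rcases h2 with h2 | ⟨c, hc, hc1, h2⟩
    · exact side_mem_rval i v hx (Or.inl (le_antisymm hx.1.2 (h2 ▸ hle)))
    · exact upClosed_rval i v c (h.corner_mem c hc) x hx (h2 ▸ hle) hc1
  · intro hmem
    obtain ⟨c, hc, hc1, hc2⟩ := h.exists_corner x hmem
    exact (h1 c hc hc2).trans hc1

lemma Corners.Represents.bestProb_mem_Icc (h : G.Represents (rval M T i v)) (B : ℝ) :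
    (G.bestProb B).val ∈ Set.Icc (0 : ℝ) 1 := by
  obtain ⟨h0, h1, h2⟩ := G.bestProb_spec B
  refine ⟨h0, ?_⟩
  rcases h2 with h2 | ⟨c, hc, hc1, h2⟩
  · rw [h2]; exact zero_le_one
  · rw [h2]; exact (rval_subset_square i v (h.corner_mem c hc)).2.2

lemma Corners.Represents.leastBudget_mem_Icc (h : G.Represents (rval M T i v)) (p : ℝ) :
    (G.leastBudget p).val ∈ Set.Icc (0 : ℝ) 1 := by
  obtain ⟨h0, h1, h2⟩ := G.leastBudget_spec p
  refine ⟨?_, h0⟩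
  rcases h2 with h2 | ⟨c, hc, hc1, h2⟩
  · rw [h2]; exact zero_le_one
  · rw [h2]; exact (rval_subset_square i v (h.corner_mem c hc)).1.1

lemma Corners.Represents.contains_eq (h : G.Represents (rval M T i v)) {x : ℝ × ℝ}
    (hx : x ∈ square) : (G.contains x.1 x.2).val = true ↔ x ∈ rval M T i v := by
  rw [Corners.contains_iff]
  constructor
  · rintro ⟨c, hc, h1, h2⟩
    exact upClosed_rval i v c (h.corner_mem c hc) x hx h1 h2
  · exact h.exists_corner x

/-- The point of the quadrant of a corner `c` nearest to `x` is `(max c.1 x.1, min c.2 x.2)`. The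
start value `1` of the minimum is harmless, since `(1, x.2)` is in the set at distance at most `1`.
-/
lemma Corners.Represents.dist_eq (h : G.Represents (rval M T i v)) {x : ℝ × ℝ}
    (hx : x ∈ square) : (G.dist x.1 x.2).val = Metric.infDist x (rval M T i v) := by
  obtain ⟨⟨a1, a2⟩, a3, a4⟩ := mem_square.1 hx
  obtain ⟨h1, h2⟩ := G.dist_spec x.1 x.2
  have hside : ((1, x.2) : ℝ × ℝ) ∈ rval M T i v :=
    side_mem_rval i v (mem_square.2 ⟨by norm_num, a3, a4⟩) (Or.inl rfl)
  apply le_antisymm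
  · refine (Metric.le_infDist ⟨_, hside⟩).2 fun y hy => ?_
    obtain ⟨c, hc, hc1, hc2⟩ := h.exists_corner y hy
    refine (h1 c hc).trans ?_
    rw [Prod.dist_eq, Real.dist_eq, Real.dist_eq]
    refine max_le (max_le ?_ ?_) (le_max_of_le_left (abs_nonneg _))
    · exact le_max_of_le_left (by linarith [neg_abs_le (x.1 - y.1)])
    · exact le_max_of_le_right (by linarith [le_abs_self (x.2 - y.2)])
  · rcases h2 with h2 | ⟨c, hc, h2⟩
    · rw [h2]
      refine (Metric.infDist_le_dist_of_mem hside).trans ?_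
      rw [Prod.dist_eq, Real.dist_eq, Real.dist_eq]
      exact max_le (abs_le.2 ⟨by simp only; linarith, by simp only; linarith⟩) (by simp)
    · rw [h2]
      have hc' := h.corner_mem c hc
      obtain ⟨⟨b1, b2⟩, b3, b4⟩ := mem_square.1 (rval_subset_square i v hc')
      have hy : (max c.1 x.1, min c.2 x.2) ∈ rval M T i v := by
        refine upClosed_rval i v c hc' _ (mem_square.2 ⟨⟨b1.trans (le_max_left _ _), max_le b2 a2⟩,
          le_min b3 a3, (min_le_left _ _).trans b4⟩) (le_max_left _ _) (min_le_left _ _)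
      refine (Metric.infDist_le_dist_of_mem hy).trans ?_
      rw [Prod.dist_eq, Real.dist_eq, Real.dist_eq]
      simp only
      refine max_le ?_ ?_
      · rcases max_cases c.1 x.1 with ⟨e, _⟩ | ⟨e, _⟩ <;> rw [e]
        · rw [abs_sub_comm, abs_of_nonneg (by linarith)]
          exact (le_max_left _ _).trans (le_max_left _ _)
        · simp
      · rcases min_cases c.2 x.2 with ⟨e, _⟩ | ⟨e, _⟩ <;> rw [e]
        · rw [abs_of_nonneg (by linarith)]
          exact (le_max_right _ _).trans (le_max_left _ _)
        · simp

end Corners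

/-! ### Value iteration on corner lists. -/

section Step

variable {V : Type*} [Fintype V]

lemma mem_vertices (v : V) : v ∈ vertices V := by simp [vertices]

lemma length_vertices : (vertices V).length = Fintype.card V := by simp [vertices]

lemma sum_map_vertices {A : Type*} [AddCommMonoid A] (g : V → A) :
    ((vertices V).map g).sum = ∑ v, g v := by
  simp [vertices]

lemma mem_stepRandom_iff (δ : V → ℝ) (G : V → Corners) (x : ℝ × ℝ) :
    x ∈ (stepRandom δ G).val ↔
      ∃ w, ∃ c ∈ G w, x = (c.1, ∑ u, δ u * ((G u).bestProb c.1).val) := by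
  have : (stepRandom δ G).val = (vertices V).foldl (fun acc w => (G w).foldl (fun acc c =>
      (c.1, ∑ u, δ u * ((G u).bestProb c.1).val) :: acc) acc) [] := by
    simp only [stepRandom, val_fold, val_bind, val_op, foldl_add_eq, sum_map_vertices, zero_add]
  rw [this, mem_foldl_iff _ (fun w x => ∃ c ∈ G w, x = (c.1, ∑ u, δ u * ((G u).bestProb c.1).val))]
  · simp [mem_vertices]
  · exact fun acc w x => mem_foldl_cons_iff _ _ _ _

lemma length_stepRandom (δ : V → ℝ) (G : V → Corners) :
    (stepRandom δ G).val.length ≤ ∑ w, (G w).length := by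
  rw [stepRandom, val_fold]
  refine (length_foldl_le _ (fun w => (G w).length) (fun acc w => ?_) _ _).trans ?_
  · simp [add_comm]
  · simp [sum_map_vertices]

lemma within_stepRandom (δ : V → ℝ) (G : V → Corners) :
    Within (stepRandom δ G) (2 * Fintype.card V + (∑ w, (G w).length) *
      (5 * Fintype.card V + 3 * (∑ w, (G w).length) + 2)) := by
  have hq : ∀ c : ℝ × ℝ, Within (fold (fun (s : ℝ) u => do
        let Gu ← op (G u)
        let r ← Gu.bestProb c.1
        let d ← op (δ u)
        let x ← op (d * r)
        op (s + x)) 0 (vertices V)) (5 * Fintype.card V + 3 * ∑ w, (G w).length) := by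
    intro c
    refine (within_fold (t := fun u => 1 + (3 * (G u).length + (1 + (1 + 1)))) (fun s u _ => ?_)
      0).mono ?_
    · exact within_bind (within_op _) (within_bind (Corners.within_bestProb _ _)
        (within_bind (within_op _) (within_bind (within_op _) (within_op _))))
    · rw [sum_map_vertices, Finset.mul_sum]
      simp only [Finset.sum_add_distrib, Finset.sum_const, Finset.card_univ, smul_eq_mul]
      omega
  refine (within_fold (t := fun w => 1 + (G w).length *
    (5 * Fintype.card V + 3 * (∑ w, (G w).length) + 1 + 1)) (fun acc w _ => ?_) []).mono ?_
  · refine within_bind (within_op _) (within_fold_const (fun acc c _ => ?_) _)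
    exact within_bind (hq c) (within_op _)
  · rw [sum_map_vertices]
    simp only [Finset.sum_add_distrib, Finset.sum_const, Finset.card_univ, smul_eq_mul,
      ← Finset.sum_mul]
    apply le_of_eq
    ring

variable [DecidableEq V]

/-- The smallest of the least budgets of the successors in `E`. -/
def minBudget (E : Finset V) (G : V → Corners) (p : ℝ) : ℝ :=
  (vertices V).foldl (fun s u => if u ∈ E then min s ((G u).leastBudget p).val else s) 1

/-- The greatest of the least budgets of the successors in `E`. -/
def maxBudget (E : Finset V) (G : V → Corners) (p : ℝ) : ℝ :=
  (vertices V).foldl (fun s u => if u ∈ E then max s ((G u).leastBudget p).val else s) 0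

lemma mem_stepControl_iff (E : Finset V) (G : V → Corners) (x : ℝ × ℝ) :
    x ∈ (stepControl E G).val ↔
      ∃ w ∈ E, ∃ c ∈ G w, x = ((maxBudget E G c.2 + minBudget E G c.2) / 2, c.2) := by
  have : (stepControl E G).val = (vertices V).foldl (fun acc w => if w ∈ E then
      (G w).foldl (fun acc c =>
        ((maxBudget E G c.2 + minBudget E G c.2) / 2, c.2) :: acc) acc else acc) [] := by
    simp [stepControl, maxBudget, minBudget]
  rw [this, mem_foldl_iff _ (fun w x => w ∈ E ∧
    ∃ c ∈ G w, x = ((maxBudget E G c.2 + minBudget E G c.2) / 2, c.2))]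
  · simp [mem_vertices]
  · intro acc w x
    by_cases h : w ∈ E
    · simp only [h, if_true, true_and]
      exact mem_foldl_cons_iff _ _ _ _
    · simp [h]

lemma length_stepControl (E : Finset V) (G : V → Corners) :
    (stepControl E G).val.length ≤ ∑ w, (G w).length := by
  rw [stepControl, val_fold]
  refine (length_foldl_le _ (fun w => (G w).length) (fun acc w => ?_) _ _).trans ?_
  · by_cases h : w ∈ E
    · simp [h, add_comm]
    · simp [h]
  · simp [sum_map_vertices]

lemma within_stepControl (E : Finset V) (G : V → Corners) :
    Within (stepControl E G) (3 * Fintype.card V + (∑ w, (G w).length) *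
      (8 * Fintype.card V + 6 * (∑ w, (G w).length) + 4)) := by
  have hb : ∀ (g : ℝ → ℝ → ℝ) (b : ℝ) (c : ℝ × ℝ), Within (fold (fun (s : ℝ) u => do
        if ← test (u ∈ E) then
          let Gu ← op (G u)
          let b ← Gu.leastBudget c.2
          op (g s b)
        else return s) b (vertices V)) (4 * Fintype.card V + 3 * ∑ w, (G w).length) := by
    intro g b c
    refine (within_fold (t := fun u => 1 + (1 + (3 * (G u).length + 1))) (fun s u _ => ?_)
      b).mono ?_
    · exact within_bind (within_test _) (within_ite (within_bind (within_op _)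
        (within_bind (Corners.within_leastBudget _ _) (within_op _)))
        ((within_ret _).mono (Nat.zero_le _)))
    · rw [sum_map_vertices, Finset.mul_sum]
      simp only [Finset.sum_add_distrib, Finset.sum_const, Finset.card_univ, smul_eq_mul]
      omega
  set K := 4 * Fintype.card V + 3 * ∑ w, (G w).length with hK
  refine (within_fold (t := fun w => 1 + (1 + (G w).length * (K + (K + (1 + (1 + 1))) + 1)))
    (fun acc w _ => ?_) []).mono ?_
  · refine within_bind (within_test _) (within_ite (within_bind (within_op _) (within_fold_const
      (fun acc c _ => ?_) _)) ((within_ret _).mono (Nat.zero_le _)))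
    exact within_bind (hb min 1 c) (within_bind (hb max 0 c) (within_bind (within_op _)
      (within_bind (within_op _) (within_op _))))
  · rw [sum_map_vertices]
    simp only [Finset.sum_add_distrib, Finset.sum_const, Finset.card_univ, smul_eq_mul,
      ← Finset.sum_mul]
    apply le_of_eq
    rw [hK]
    ring

variable {M : MDP V} {T : Finset V}

lemma represents_stepRandom {i : ℕ} {v : V} {δ : stdSimplex ℝ V} (hn : M.node v = .random δ)
    {G : V → Corners} (hG : ∀ w, (G w).Represents (rval M T i w)) :
    Corners.Represents (stepRandom δ.1 G).val (rval M T (i + 1) v) := by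
  constructor
  · intro x hx
    obtain ⟨w, c, hc, rfl⟩ := (mem_stepRandom_iff _ _ _).1 hx
    have hcs := rval_subset_square i w ((hG w).corner_mem c hc)
    rw [rval, mem_bellman_random hn]
    refine ⟨hcs.1, _, fun u _ => ?_, rfl⟩
    exact ((hG u).le_bestProb_iff (x := (c.1, ((G u).bestProb c.1).val))
      ⟨hcs.1, (hG u).bestProb_mem_Icc c.1⟩).1 le_rfl
  · intro x hx
    have hxs := rval_subset_square _ _ hx
    rw [rval, mem_bellman_random hn] at hx
    obtain ⟨h1, q, hq, hx2⟩ := hx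
    have hcor : ∀ w, ∃ c : ℝ × ℝ, 0 < δ.1 w → c ∈ G w ∧ c.1 ≤ x.1 ∧ q w ≤ c.2 := by
      intro w
      by_cases h : 0 < δ.1 w
      · obtain ⟨c, hc⟩ := (hG w).exists_corner _ (hq w h)
        exact ⟨c, fun _ => hc⟩
      · exact ⟨0, fun h' => absurd h' h⟩
    choose c hc using hcor
    have hne : (Finset.univ.filter fun w => 0 < δ.1 w).Nonempty := by
      by_contra hemp
      rw [Finset.not_nonempty_iff_eq_empty, Finset.filter_eq_empty_iff] at hemp
      have : ∑ w, δ.1 w = 0 := Finset.sum_eq_zero fun w _ =>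
        le_antisymm (not_lt.1 (hemp (Finset.mem_univ w))) (δ.2.1 w)
      rw [δ.2.2] at this
      exact one_ne_zero this
    -- The greatest of the chosen corner budgets is still at most `x.1`, and the chosen corners of
    -- all successors are usable with it.
    obtain ⟨w, hw, hmax⟩ := Finset.exists_max_image _ (fun w => (c w).1) hne
    have hw' : 0 < δ.1 w := (Finset.mem_filter.1 hw).2
    obtain ⟨hw1, hw2, hw3⟩ := hc w hw'
    refine ⟨_, (mem_stepRandom_iff _ _ _).2 ⟨w, c w, hw1, rfl⟩, hw2, ?_⟩
    rw [hx2]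
    refine Finset.sum_le_sum fun u _ => ?_
    rcases (δ.2.1 u).eq_or_lt with h0 | h0
    · simp [← h0]
    · refine mul_le_mul_of_nonneg_left ?_ h0.le
      obtain ⟨hu1, hu2, hu3⟩ := hc u h0
      exact hu3.trans (((G u).bestProb_spec _).2.1 _ hu1
        (hmax u (Finset.mem_filter.2 ⟨Finset.mem_univ u, h0⟩)))

lemma represents_stepControl {i : ℕ} {v : V} {E : Finset V} {hE : E.Nonempty}
    (hn : M.node v = .control E hE) {G : V → Corners}
    (hG : ∀ w, (G w).Represents (rval M T i w)) :
    Corners.Represents (stepControl E G).val (rval M T (i + 1) v) := by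
  have hmin : ∀ p, minBudget E G p ≤ 1 ∧
      (∀ u ∈ E, minBudget E G p ≤ ((G u).leastBudget p).val) ∧
      (minBudget E G p = 1 ∨ ∃ u ∈ E, minBudget E G p = ((G u).leastBudget p).val) := by
    intro p
    have h := foldl_min_spec (fun u : V => u ∈ E) (fun u => ((G u).leastBudget p).val)
      (vertices V) 1
    simp only [mem_vertices, true_and, forall_const] at h
    exact h
  have hmax : ∀ p, 0 ≤ maxBudget E G p ∧
      (∀ u ∈ E, ((G u).leastBudget p).val ≤ maxBudget E G p) ∧
      (maxBudget E G p = 0 ∨ ∃ u ∈ E, maxBudget E G p = ((G u).leastBudget p).val) := by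
    intro p
    have h := foldl_max_spec (fun u : V => u ∈ E) (fun u => ((G u).leastBudget p).val)
      (vertices V) 0
    simp only [mem_vertices, true_and, forall_const] at h
    exact h
  have hmem : ∀ p ∈ Set.Icc (0 : ℝ) 1,
      ((maxBudget E G p + minBudget E G p) / 2, p) ∈ rval M T (i + 1) v := by
    intro p hp
    obtain ⟨a1, a2, a3⟩ := hmin p
    obtain ⟨b1, b2, b3⟩ := hmax p
    rw [rval, mem_bellman_control hn]
    refine ⟨hp, _, _, ?_, fun w hw => ?_, rfl⟩
    · have hmemE : ∃ u ∈ E, minBudget E G p = ((G u).leastBudget p).val := by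
        rcases a3 with a3 | a3
        · obtain ⟨u, hu⟩ := hE
          exact ⟨u, hu, le_antisymm (a2 u hu) (a3 ▸ ((hG u).leastBudget_mem_Icc p).2)⟩
        · exact a3
      obtain ⟨u, hu, he⟩ := hmemE
      rw [he]
      exact ⟨u, hu, ((hG u).leastBudget_le_iff (x := (((G u).leastBudget p).val, p))
        ⟨(hG u).leastBudget_mem_Icc p, hp⟩).1 le_rfl⟩
    · refine ((hG w).leastBudget_le_iff (x := (maxBudget E G p, p)) ⟨⟨b1, ?_⟩, hp⟩).1 (b2 w hw)
      rcases b3 with b3 | ⟨u, hu, b3⟩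
      · rw [b3]; exact zero_le_one
      · rw [b3]; exact ((hG u).leastBudget_mem_Icc p).2
  constructor
  · intro x hx
    obtain ⟨w, hw, c, hc, rfl⟩ := (mem_stepControl_iff _ _ _).1 hx
    exact hmem c.2 (rval_subset_square i w ((hG w).corner_mem c hc)).2
  · intro x hx
    rw [rval, mem_bellman_control hn] at hx
    obtain ⟨h1, bp, bm, ⟨w₁, hw₁, hm⟩, hp, hx1⟩ := hx
    obtain ⟨d, hd, hd1, hd2⟩ := (hG w₁).exists_corner _ hm
    have hcor : ∀ w, ∃ c : ℝ × ℝ, w ∈ E → c ∈ G w ∧ c.1 ≤ bp ∧ x.2 ≤ c.2 := by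
      intro w
      by_cases h : w ∈ E
      · obtain ⟨c, hc⟩ := (hG w).exists_corner _ (hp w h)
        exact ⟨c, fun _ => hc⟩
      · exact ⟨0, fun h' => absurd h' h⟩
    choose c hc using hcor
    obtain ⟨w₂, hw₂, hw₂min⟩ := E.exists_min_image (fun w => (c w).2) hE
    -- Among `d` and the corners `c u`, one of least probability is taken: at its probability `d`
    -- and all `c u` still qualify, so both extreme budgets are bounded by those of `x`.
    have hcorner : ∃ w ∈ E, ∃ e ∈ G w, x.2 ≤ e.2 ∧ e.2 ≤ d.2 ∧ ∀ u ∈ E, e.2 ≤ (c u).2 := by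
      rcases le_total d.2 (c w₂).2 with h | h
      · exact ⟨w₁, hw₁, d, hd, hd2, le_rfl, fun u hu => h.trans (hw₂min u hu)⟩
      · exact ⟨w₂, hw₂, c w₂, (hc w₂ hw₂).1, (hc w₂ hw₂).2.2, h, hw₂min⟩
    obtain ⟨w, hw, e, he, he1, he2, he3⟩ := hcorner
    refine ⟨_, (mem_stepControl_iff _ _ _).2 ⟨w, hw, e, he, rfl⟩, ?_, he1⟩
    have hle1 : minBudget E G e.2 ≤ bm :=
      ((hmin e.2).2.1 w₁ hw₁).trans ((((G w₁).leastBudget_spec e.2).2.1 d hd he2).trans hd1)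
    have hle2 : maxBudget E G e.2 ≤ bp := by
      rcases (hmax e.2).2.2 with h | ⟨u, hu, h⟩
      · rw [h]
        obtain ⟨u, hu⟩ := hE
        exact (rval_subset_square _ _ (hp u hu)).1.1
      · rw [h]
        obtain ⟨hu1, hu2, hu3⟩ := hc u hu
        exact (((G u).leastBudget_spec e.2).2.1 _ hu1 (he3 u hu)).trans hu2
    rw [hx1]
    simp only
    linarith

/-- The table of corner lists after `i` steps of value iteration. -/
def cornerTable (M : MDP V) (T : Finset V) : ℕ → V → Corners
  | 0 => (initTable T).val
  | i + 1 => (stepTable M (cornerTable M T i)).val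

lemma represents_cornerTable (i : ℕ) (v : V) :
    (cornerTable M T i v).Represents (rval M T i v) := by
  induction i generalizing v with
  | zero =>
    by_cases hv : v ∈ T
    · have h : cornerTable M T 0 v = [(0, 1)] := by
        simp [cornerTable, initTable, table, hv]
      rw [h]
      simp only [rval, hv, if_true]
      constructor
      · intro c hc
        rw [List.mem_singleton.1 hc]
        exact mem_square.2 (by norm_num)
      · intro x hx
        exact ⟨_, List.mem_singleton.2 rfl, hx.1.1, hx.2.2⟩
    · have h : cornerTable M T 0 v = [(0, 0), (1, 1)] := by
        simp [cornerTable, initTable, table, hv]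
      rw [h]
      constructor
      · intro c hc
        simp only [List.mem_cons, List.not_mem_nil, or_false] at hc
        rcases hc with rfl | rfl
        · exact side_mem_rval 0 v (mem_square.2 (by norm_num)) (Or.inr rfl)
        · exact side_mem_rval 0 v (mem_square.2 (by norm_num)) (Or.inl rfl)
      · intro x hx
        have hxs := rval_subset_square 0 v hx
        simp only [rval, hv, if_false] at hx
        rcases hx with hx | hx
        · exact ⟨(0, 0), by simp, hxs.1.1, hx.2.le⟩
        · exact ⟨(1, 1), by simp, hx.1.ge, hxs.2.2⟩
  | succ i ih =>
    cases hn : M.node v with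
    | control E hE =>
      have h : cornerTable M T (i + 1) v = (stepControl E (cornerTable M T i)).val := by
        simp [cornerTable, stepTable, table, hn]
      rw [h]
      exact represents_stepControl hn ih
    | random δ =>
      have h : cornerTable M T (i + 1) v = (stepRandom δ.1 (cornerTable M T i)).val := by
        simp [cornerTable, stepTable, table, hn]
      rw [h]
      exact represents_stepRandom hn ih

lemma length_stepTable (G : V → Corners) (v : V) :
    ((stepTable M G).val v).length ≤ ∑ w, (G w).length := by
  cases hn : M.node v with
  | control E hE =>
    have h : (stepTable M G).val v = (stepControl E G).val := by simp [stepTable, table, hn]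
    rw [h]
    exact length_stepControl E G
  | random δ =>
    have h : (stepTable M G).val v = (stepRandom δ.1 G).val := by simp [stepTable, table, hn]
    rw [h]
    exact length_stepRandom δ.1 G

/-- Each new list has at most one corner for each old corner of any vertex, so the total grows at
most by the factor `Fintype.card V`; initially a list has at most two corners. -/
lemma sum_length_cornerTable_le (i : ℕ) :
    ∑ w, (cornerTable M T i w).length ≤ 2 * Fintype.card V ^ (i + 1) := by
  induction i with
  | zero =>
    refine (Finset.sum_le_card_nsmul Finset.univ _ 2 fun v _ => ?_).trans ?_
    · by_cases hv : v ∈ T <;> simp [cornerTable, initTable, table, hv]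
    · simp [mul_comm]
  | succ i ih =>
    refine (Finset.sum_le_card_nsmul Finset.univ _ _ fun v _ =>
      (length_stepTable (cornerTable M T i) v).trans ih).trans ?_
    rw [smul_eq_mul, Finset.card_univ, pow_succ _ (i + 1)]
    apply le_of_eq
    ring

lemma within_stepTable (G : V → Corners) :
    Within (stepTable M G) (Fintype.card V * (3 * Fintype.card V + (∑ w, (G w).length) *
      (8 * Fintype.card V + 6 * (∑ w, (G w).length) + 4) + 1)) := by
  refine within_table fun v => ?_
  cases hn : M.node v with
  | control E hE => exact within_stepControl E G
  | random δ =>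
    refine (within_stepRandom δ.1 G).mono ?_
    gcongr <;> omega

lemma within_initTable (T : Finset V) : Within (initTable T) (Fintype.card V * 4) :=
  within_table (t := 3) fun _ => within_bind (s := 1) (t := 2) (within_test _)
    (within_ite ((within_op _).mono (by omega))
      (within_bind (s := 1) (t := 1) (within_op _) (within_op _)))

end Step

/-! ### Computing the minimum probability and the radius. -/

section Radius

variable {V : Type*} [Fintype V] {M : MDP V}

lemma computeDeltaMin_spec (M : MDP V) : (computeDeltaMin M).val = M.deltaMin := by
  have hstep : ∀ (r : ℝ) (v : V), ∃ r' : ℝ,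
      Cost.val (match M.node v with
        | .control _ _ => ret r
        | .random δ => fold (fun r w => do
            let d ← op (δ.1 w)
            if ← test (0 < d) then op (min r d) else return r) r (vertices V)) = r' ∧ r' ≤ r ∧
      (∀ w, 0 < M.prob v w → r' ≤ M.prob v w) ∧
      (r' = r ∨ ∃ w, 0 < M.prob v w ∧ r' = M.prob v w) := by
    intro r v
    cases hn : M.node v with
    | control E hE => exact ⟨r, rfl, le_rfl, by simp [MDP.prob, hn], Or.inl rfl⟩
    | random δ =>
      have h := foldl_min_spec (fun w : V => 0 < δ.1 w) (fun w => δ.1 w) (vertices V) r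
      simp only [mem_vertices, true_and, forall_const] at h
      refine ⟨_, ?_, by simpa [MDP.prob, hn] using h⟩
      rw [val_fold]
      congr 1
      funext b w
      by_cases hw : 0 < δ.1 w <;> simp [hw, test]
  have hfold : ∀ (l : List V) (r : ℝ), ∃ r' : ℝ,
      (fold (fun r v => match M.node v with
        | .control _ _ => ret r
        | .random δ => fold (fun r w => do
            let d ← op (δ.1 w)
            if ← test (0 < d) then op (min r d) else return r) r (vertices V)) r l).val = r' ∧
      r' ≤ r ∧ (∀ v ∈ l, ∀ w, 0 < M.prob v w → r' ≤ M.prob v w) ∧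
      (r' = r ∨ ∃ v w, 0 < M.prob v w ∧ r' = M.prob v w) := by
    intro l
    induction l with
    | nil => exact fun r => ⟨r, rfl, le_rfl, by simp, Or.inl rfl⟩
    | cons v l ih =>
      intro r
      obtain ⟨r1, e1, h1, h2, h3⟩ := hstep r v
      obtain ⟨r2, e2, h4, h5, h6⟩ := ih r1
      refine ⟨r2, ?_, h4.trans h1, ?_, ?_⟩
      · rw [← e2, ← e1]
        rfl
      · intro u hu w hw
        rcases List.mem_cons.1 hu with rfl | hu
        · exact h4.trans (h2 w hw)
        · exact h5 u hu w hw
      · rcases h6 with h6 | h6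
        · rcases h3 with h3 | ⟨w, h3⟩
          · exact Or.inl (h6.trans h3)
          · exact Or.inr ⟨v, w, h6 ▸ h3⟩
        · exact Or.inr h6
  obtain ⟨r, e, h1, h2, h3⟩ := hfold (vertices V) (1 / 2)
  have hr : (computeDeltaMin M).val = r := e
  rw [hr, MDP.deltaMin]
  refine (IsLeast.csInf_eq ⟨?_, ?_⟩).symm
  · rcases h3 with h3 | ⟨v, w, h3, h4⟩
    · exact Or.inl h3
    · exact Or.inr ⟨h4 ▸ h3, v, w, h4.symm⟩
  · rintro x (rfl | ⟨hx, v, w, rfl⟩)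
    · exact h1
    · exact h2 v (mem_vertices v) w hx

lemma computeRadius_spec (M : MDP V) (i : ℕ) : (computeRadius M i).val = radius M i := by
  have h1 : ((vertices V).map fun _ => (1 : ℝ)).sum = Fintype.card V := by
    rw [sum_map_vertices]; simp
  simp only [computeRadius, val_bind, val_op, val_fold, computeDeltaMin_spec, foldl_mul_mul_eq,
    foldl_add_eq (fun _ => (1 : ℝ)), h1, length_vertices, one_mul, zero_add]
  rfl

lemma within_computeDeltaMin (M : MDP V) :
    Within (computeDeltaMin M) (Fintype.card V * (Fintype.card V * 4 + 1)) := by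
  have := within_fold_const (t := Fintype.card V * 4) (l := vertices V) (f := fun (r : ℝ) v =>
    match M.node v with
    | .control _ _ => ret r
    | .random δ => fold (fun r w => do
        let d ← op (δ.1 w)
        if ← test (0 < d) then op (min r d) else return r) r (vertices V)) ?_ (1 / 2)
  · rwa [length_vertices] at this
  · intro r v _
    cases M.node v with
    | control E hE => exact (within_ret _).mono (Nat.zero_le _)
    | random δ =>
      rw [← length_vertices]
      refine within_fold_const (t := 3) (fun r w _ => ?_) r
      refine within_bind (s := 1) (t := 2) (within_op _) ?_
      refine within_bind (s := 1) (t := 1) (within_test _) ?_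
      exact within_ite (within_op _) ((within_ret _).mono (Nat.zero_le _))

lemma within_computeRadius (M : MDP V) (i : ℕ) :
    Within (computeRadius M i) (Fintype.card V * (Fintype.card V * 4 + 1) +
      (Fintype.card V * 2 + (Fintype.card V * 3 + 7))) := by
  refine within_bind (within_computeDeltaMin M) (within_bind ?_ (within_bind ?_ ?_))
  · rw [← length_vertices]
    exact within_fold_const (fun _ _ _ => within_op _) _
  · rw [← length_vertices]
    exact within_fold_const (t := 2) (fun _ _ _ => within_bind (s := 1) (t := 1) (within_op _)
      (within_op _)) _
  · exact within_bind (s := 1) (t := 6) (within_op _) (within_bind (s := 1) (t := 5) (within_op _)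
      (within_bind (s := 1) (t := 4) (within_op _) (within_bind (s := 1) (t := 3) (within_op _)
        (within_bind (s := 1) (t := 2) (within_op _) (within_bind (s := 1) (t := 1) (within_op _)
          (within_op _))))))

end Radius

namespace ProblemInstance

/-! ### The iteration bound, the cost of the tests, and exclusivity of winning. -/

section Basics

open Cost

variable {V : Type*} [Fintype V] (I : ProblemInstance V)

lemma point_mem_square : I.point ∈ square := ⟨I.B_mem, I.p_mem⟩

lemma tendsto_radius : Filter.Tendsto (radius I.M) Filter.atTop (𝓝 0) := by
  have hd := deltaMin_pos I.M
  have hn : (0 : ℝ) < Fintype.card V := by exact_mod_cast Fintype.card_pos_iff.2 ⟨I.v⟩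
  have h1 : Filter.Tendsto (fun i : ℕ => (i : ℝ) *
      (I.M.deltaMin ^ (2 * Fintype.card V) / (4 * Fintype.card V))) Filter.atTop Filter.atTop :=
    tendsto_natCast_atTop_atTop.atTop_mul_const (by positivity)
  have h2 := (Real.tendsto_exp_neg_atTop_nhds_zero.comp h1).const_mul 2
  rw [mul_zero] at h2
  refine h2.congr fun i => ?_
  simp only [Function.comp, radius, mul_div_assoc]

/-- The bound on the number of iterations, up to a constant factor. -/
def iterationBound (ε : ℝ) : ℝ :=
  Real.log (2 / ε) * Fintype.card V * (I.M.deltaMin ^ (2 * Fintype.card V))⁻¹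

/-- Lets additive constants be absorbed into a multiple of the bound: the logarithm is at least `1 /
2` and the inverse power at least `4`. -/
lemma two_le_iterationBound {ε : ℝ} (hε : 0 < ε) (hε1 : ε ≤ 1) : 2 ≤ I.iterationBound ε := by
  have hd0 := deltaMin_pos I.M
  have hd1 := deltaMin_le_half I.M
  have hn : 0 < Fintype.card V := Fintype.card_pos_iff.2 ⟨I.v⟩
  have hn' : (1 : ℝ) ≤ Fintype.card V := by exact_mod_cast hn
  have hlog : 1 / 2 ≤ Real.log (2 / ε) := by
    have h1 : Real.log 2 ≤ Real.log (2 / ε) := by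
      apply Real.log_le_log (by norm_num)
      rw [le_div_iff₀ hε]
      linarith
    linarith [Real.log_two_gt_d9]
  have hpow : I.M.deltaMin ^ (2 * Fintype.card V) ≤ 1 / 4 := by
    calc _ ≤ I.M.deltaMin ^ 2 := pow_le_pow_of_le_one hd0.le (by linarith) (by omega)
      _ ≤ 1 / 4 := by nlinarith
  have hinv : 4 ≤ (I.M.deltaMin ^ (2 * Fintype.card V))⁻¹ := by
    rw [le_inv_comm₀ (by norm_num) (by positivity)]
    linarith
  unfold iterationBound
  have h1 : 1 / 2 * 1 ≤ Real.log (2 / ε) * Fintype.card V :=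
    mul_le_mul hlog hn' zero_le_one (by linarith)
  have h2 := mul_le_mul h1 hinv (by norm_num) (by linarith)
  linarith

lemma within_runTests (i : ℕ) (G : V → Corners) :
    Within (runTests I i G) (10 * (∑ w, (G w).length) + 4 * Fintype.card V ^ 2 +
      6 * Fintype.card V + 10) := by
  have hle : (G I.v).length ≤ ∑ w, (G w).length :=
    Finset.single_le_sum (f := fun w => (G w).length) (fun _ _ => Nat.zero_le _)
      (Finset.mem_univ I.v)
  have h : Within (runTests I i G) (1 + (4 * (G I.v).length + (6 * (G I.v).length +
      ((Fintype.card V * (Fintype.card V * 4 + 1) + (Fintype.card V * 2 +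
        (Fintype.card V * 3 + 7))) + (1 + 1))))) := by
    refine within_bind (within_op _) (within_bind (Corners.within_contains _ _ _) (within_ite
      ((within_op _).mono (by omega)) ?_))
    exact within_bind (Corners.within_dist _ _ _) (within_bind (within_computeRadius _ _)
      (within_bind (within_test _) (within_ite (within_op _)
        ((within_ret _).mono (Nat.zero_le _)))))
  refine h.mono ?_
  nlinarith

variable [MeasurableSpace V] [DiscreteMeasurableSpace V]

lemma not_reach_winning_of_safe_winning {p p' : ℝ} (hp : p' < p)
    (h : (winning I.M I.T I.v I.B p' .safe).Nonempty) :
    ¬ (winning I.M I.T I.v I.B p .reach).Nonempty := by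
  rintro ⟨σ, hσ⟩
  obtain ⟨τ, hτ⟩ := h
  exact absurd ((hσ τ).trans (hτ σ)) (not_le.2 hp)

lemma winning_iff_eq {j : Player} (hj : (winning I.M I.T I.v I.B I.p j).Nonempty)
    (hj' : ∀ k, k ≠ j → ¬ (winning I.M I.T I.v I.B I.p k).Nonempty) (k : Player) :
    (winning I.M I.T I.v I.B I.p k).Nonempty ↔ k = j :=
  ⟨fun h => by_contra fun hne => hj' k hne h, fun h => h ▸ hj⟩

end Basics

/-! ### Soundness, and completeness off the threshold. -/

section Correctness

variable {V : Type*} [Fintype V] [DecidableEq V] (I : ProblemInstance V)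

lemma verdict_eq_reach_iff (i : ℕ) :
    I.verdict i = some .reach ↔ I.point ∈ rval I.M I.T i I.v := by
  unfold verdict
  split_ifs <;> simp_all

lemma verdict_eq_safe_iff (i : ℕ) :
    I.verdict i = some .safe ↔ I.point ∉ rval I.M I.T i I.v ∧
      radius I.M i < Metric.infDist I.point (rval I.M I.T i I.v) := by
  unfold verdict radius
  split_ifs <;> simp_all

lemma exists_returnsAt {i : ℕ} (h : I.verdict i ≠ none) : ∃ j, ∃ k ≤ i, I.ReturnsAt j k := by
  classical
  have hex : ∃ k, I.verdict k ≠ none := ⟨i, h⟩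
  obtain ⟨j, hj⟩ := Option.ne_none_iff_exists'.1 (Nat.find_spec hex)
  exact ⟨j, Nat.find hex, Nat.find_min' hex h,
    fun k hk => not_not.1 (Nat.find_min hex hk), hj⟩

/-- The distance test is an open condition, and every point of the square that passes it is in the
safety limit by `infDist_rval_le_radius`. -/
lemma mem_squareInterior_of_returnsAt_safe {i : ℕ} (h : I.ReturnsAt .safe i) :
    I.point ∈ squareInterior (valStar I.M I.T I.v .safe) := by
  have hv := ((I.verdict_eq_safe_iff i).1 h.2).2
  refine ⟨I.point_mem_square, ?_⟩
  have hopen : IsOpen {y | radius I.M i < Metric.infDist y (rval I.M I.T i I.v)} :=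
    isOpen_lt continuous_const (Metric.continuous_infDist_pt _)
  filter_upwards [self_mem_nhdsWithin, mem_nhdsWithin_of_mem_nhds (hopen.mem_nhds hv)] with y hy hy'
  by_contra hcon
  exact absurd (infDist_rval_le_radius I.sink i I.v hy hcon) (not_le.2 hy')

lemma p_pos_of_returnsAt_safe {i : ℕ} (h : I.ReturnsAt .safe i) : 0 < I.p := by
  refine I.p_mem.1.lt_of_ne fun h0 => ((I.verdict_eq_safe_iff i).1 h.2).1 ?_
  exact side_mem_rval i I.v I.point_mem_square (Or.inr h0.symm)

/-- A point in the interior of `S` can be moved within the square, towards larger budgets and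
smaller probabilities, without leaving `S`. -/
lemma exists_mem_of_mem_squareInterior {S : Set (ℝ × ℝ)} {x : ℝ × ℝ} (h : x ∈ squareInterior S) :
    ∃ ε > 0, ∀ y ∈ square, dist y x < ε → y ∈ S := by
  obtain ⟨ε, hε, hsub⟩ := Metric.mem_nhdsWithin_iff.1 h.2
  exact ⟨ε, hε, fun y hy hd => hsub ⟨Metric.mem_ball.2 hd, hy⟩⟩

variable [MeasurableSpace V] [DiscreteMeasurableSpace V]

/-- Within the limit value the budget can be raised, strictly or to `1`, as the tie rule requires,
and the probability lowered. The slack in probability excludes a winning policy of the reachability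
player. -/
lemma exists_safe_winning_of_mem_squareInterior
    (h : I.point ∈ squareInterior (valStar I.M I.T I.v .safe)) (hp : 0 < I.p) :
    ∃ p' < I.p, (winning I.M I.T I.v I.B p' .safe).Nonempty := by
  obtain ⟨ε, hε, hsub⟩ := exists_mem_of_mem_squareInterior h
  have hB := I.B_mem
  have hp1 := I.p_mem
  refine ⟨max 0 (I.p - ε / 2), max_lt hp (by linarith), ?_⟩
  have hmin : I.B ≤ min 1 (I.B + ε / 2) := le_min hB.2 (by linarith)
  refine safe_winning_of_mem_valStar I.sink (b := min 1 (I.B + ε / 2)) (hsub _ ?_ ?_) ?_ hB.1 hB.2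
  · exact mem_square.2 ⟨⟨hB.1.trans hmin, min_le_left _ _⟩, le_max_left _ _,
      max_le zero_le_one (by linarith [hp1.2])⟩
  · rw [Prod.dist_eq, Real.dist_eq, Real.dist_eq]
    simp only [point]
    have h1 := min_le_right 1 (I.B + ε / 2)
    have h2 := le_max_right 0 (I.p - ε / 2)
    have h3 : max 0 (I.p - ε / 2) ≤ I.p := max_le hp1.1 (by linarith)
    exact max_lt (abs_lt.2 ⟨by linarith, by linarith⟩) (abs_lt.2 ⟨by linarith, by linarith⟩)
  · rcases le_total 1 (I.B + ε / 2) with h1 | h1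
    · exact Or.inr (min_eq_left h1)
    · rw [min_eq_right h1]
      exact Or.inl (by linarith)

lemma safe_winning_of_returnsAt_safe {i : ℕ} (h : I.ReturnsAt .safe i) :
    (winning I.M I.T I.v I.B I.p .safe).Nonempty ∧
      ¬ (winning I.M I.T I.v I.B I.p .reach).Nonempty := by
  obtain ⟨p', hp', hw⟩ := I.exists_safe_winning_of_mem_squareInterior
    (I.mem_squareInterior_of_returnsAt_safe h) (I.p_pos_of_returnsAt_safe h)
  refine ⟨?_, I.not_reach_winning_of_safe_winning hp' hw⟩
  obtain ⟨τ, hτ⟩ := hw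
  exact ⟨τ, fun σ => (hτ σ).trans hp'.le⟩

/-- Off the threshold, the algorithm terminates and its answer is the winner. -/
lemma exists_returnsAt_of_not_mem_threshold (h : I.point ∉ threshold I.M I.T I.v) :
    ∃ j i, I.ReturnsAt j i ∧ I.point ∈ squareInterior (valStar I.M I.T I.v j) ∧
      ∀ k, (winning I.M I.T I.v I.B I.p k).Nonempty ↔ k = j := by
  have hB := I.B_mem
  have hp := I.p_mem
  have hsafe : ∀ i, I.ReturnsAt .safe i → ∃ j i, I.ReturnsAt j i ∧
      I.point ∈ squareInterior (valStar I.M I.T I.v j) ∧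
      ∀ k, (winning I.M I.T I.v I.B I.p k).Nonempty ↔ k = j := by
    intro i hi
    obtain ⟨h1, h2⟩ := I.safe_winning_of_returnsAt_safe hi
    refine ⟨.safe, i, hi, I.mem_squareInterior_of_returnsAt_safe hi, I.winning_iff_eq h1 ?_⟩
    rintro (_ | _) hk
    · exact h2
    · exact absurd rfl hk
  have h' : ∃ y ∈ square, ¬ ((I.B < y.1 → y.2 < I.p →
        (winning I.M I.T I.v y.1 y.2 .reach).Nonempty) ∧
      (y.1 < I.B → I.p < y.2 → (winning I.M I.T I.v y.1 y.2 .safe).Nonempty)) := by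
    by_contra! hcon
    exact h ⟨I.point_mem_square, hcon⟩
  obtain ⟨y, hy, hy'⟩ := h'
  obtain ⟨⟨y1, y2⟩, y3, y4⟩ := mem_square.1 hy
  rw [not_and_or] at hy'
  rcases hy' with hy' | hy'
  · push Not at hy'
    obtain ⟨hBy, hpy, hemp⟩ := hy'
    -- Otherwise reachability would win at `y`, whose budget exceeds this requirement. So the
    -- distances to all `rval i` are bounded below while the radius tends to zero.
    have hnot : ∀ i, ((I.B + y.1) / 2, y.2) ∉ rval I.M I.T i I.v := fun i hi =>
      (Set.not_nonempty_iff_eq_empty.2 hemp) (reach_winning_of_mem_rval I.sink hi (by linarith) (by linarith) y2)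
    have hpt : ∀ i, I.point ∉ rval I.M I.T i I.v := fun i hi => hnot i
      (upClosed_rval i I.v _ hi _ (mem_square.2 ⟨⟨by linarith [hB.1], by linarith⟩, y3, y4⟩)
        (by simp only [point]; linarith) hpy.le)
    obtain ⟨i, hi⟩ := ((I.tendsto_radius).eventually (gt_mem_nhds
      (show (0 : ℝ) < min ((y.1 - I.B) / 2) (I.p - y.2) from
        lt_min (by linarith) (by linarith)))).exists
    have hdist : min ((y.1 - I.B) / 2) (I.p - y.2) ≤
        Metric.infDist I.point (rval I.M I.T i I.v) := by
      refine (Metric.le_infDist ⟨(1, 1), side_mem_rval i I.v (mem_square.2 (by norm_num))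
        (Or.inl rfl)⟩).2 fun z hz => ?_
      by_contra! hlt
      rw [lt_min_iff, Prod.dist_eq, max_lt_iff, max_lt_iff, Real.dist_eq, Real.dist_eq] at hlt
      obtain ⟨⟨d1, -⟩, -, d4⟩ := hlt
      simp only [point] at d1 d4
      have d1 := (abs_lt.1 d1).1
      have d4 := (abs_lt.1 d4).2
      exact hnot i (upClosed_rval i I.v z hz _
        (mem_square.2 ⟨⟨by linarith [hB.1], by linarith⟩, y3, y4⟩)
        (by simp only; linarith) (by simp only; linarith))
    have hverd := (I.verdict_eq_safe_iff i).2 ⟨hpt i, hi.trans_le hdist⟩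
    obtain ⟨j, k, -, hk⟩ := I.exists_returnsAt (i := i) (by rw [hverd]; simp)
    cases j with
    | reach => exact absurd ((I.verdict_eq_reach_iff k).1 hk.2) (hpt k)
    | safe => exact hsafe k hk
  · push Not at hy'
    obtain ⟨hBy, hpy, hemp⟩ := hy'
    set b := (y.1 + I.B) / 2 with hb
    have hbs : (b, y.2) ∈ square := mem_square.2 ⟨⟨by linarith, by linarith [hB.2]⟩, y3, y4⟩
    have hns : (b, y.2) ∉ valStar I.M I.T I.v .safe := fun hs =>
      (Set.not_nonempty_iff_eq_empty.2 hemp) (safe_winning_of_mem_valStar I.sink hs (Or.inl (by linarith)) y1 y2)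
    obtain ⟨m, hm⟩ := (mem_valStar_reach_or_mem_valStar_safe (M := I.M) (T := I.T) I.v
      hbs).resolve_right hns
    -- Even after a loss of `e` in both coordinates the point keeps advantages of at least `e` over
    -- `(b, y.2)`, which exceed the radius for suitable `i`.
    set e := min ((I.B - b) / 2) ((y.2 - I.p) / 2) with he
    have he0 : 0 < e := lt_min (by linarith) (by linarith)
    have he1 : e ≤ (I.B - b) / 2 := min_le_left _ _
    have he2 : e ≤ (y.2 - I.p) / 2 := min_le_right _ _
    obtain ⟨i, hi⟩ := ((I.tendsto_radius).eventually (gt_mem_nhds he0)).exists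
    have hr := radius_pos I.M i
    have hmem : ∀ z ∈ square, I.B - e ≤ z.1 → z.2 ≤ I.p + e → z ∈ rval I.M I.T i I.v := by
      intro z hz h1 h2
      refine hyperbolaBound_radius I.sink i I.v (rval_subset_valStar m I.v hm) z hz
        (by simp only; linarith) (by simp only; linarith) ?_
      simp only
      rw [pow_two]
      exact mul_le_mul (by linarith) (by linarith) hr.le (by linarith)
    have hpt : I.point ∈ rval I.M I.T i I.v :=
      hmem _ I.point_mem_square (by simp only [point]; linarith) (by simp only [point]; linarith)
    have hint : I.point ∈ squareInterior (valStar I.M I.T I.v .reach) := by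
      refine ⟨I.point_mem_square, Metric.mem_nhdsWithin_iff.2 ⟨e, he0, ?_⟩⟩
      rintro z ⟨hz, hzs⟩
      rw [Metric.mem_ball, Prod.dist_eq, max_lt_iff, Real.dist_eq, Real.dist_eq] at hz
      simp only [point] at hz
      have d1 := (abs_lt.1 hz.1).1
      have d2 := (abs_lt.1 hz.2).2
      exact rval_subset_valStar i I.v (hmem z hzs (by linarith) (by linarith))
    have hbe : 0 ≤ I.B - e := by linarith
    have hpe : I.p + e ≤ 1 := by linarith
    -- Winning with probability `I.p + e` rules out a safety policy for `I.p`.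
    obtain ⟨σ, hσ⟩ := reach_winning_of_mem_rval I.sink (B := I.B)
      (hmem (I.B - e, I.p + e) (mem_square.2 ⟨⟨hbe, by simp only; linarith [hB.2]⟩,
        by simp only; linarith [hp.1], hpe⟩) le_rfl le_rfl)
      (by linarith [hB.2]) (by linarith) hB.2
    have hwin : (winning I.M I.T I.v I.B I.p .reach).Nonempty :=
      ⟨σ, fun τ => by linarith [hσ τ]⟩
    obtain ⟨j, k, -, hk⟩ := I.exists_returnsAt (i := i)
      (by rw [(I.verdict_eq_reach_iff i).2 hpt]; simp)
    cases j with
    | safe => exact absurd hwin (I.safe_winning_of_returnsAt_safe hk).2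
    | reach =>
      refine ⟨.reach, k, hk, hint, I.winning_iff_eq hwin ?_⟩
      rintro (_ | _) hne
      · exact absurd rfl hne
      · rintro ⟨τ, hτ⟩
        have h1 : I.p + e ≤ _ := hσ τ
        have h2 := hτ σ
        linarith

end Correctness

/-! ### The number of iterations at distance `ε`. -/

section Iterations

variable {V : Type*} [Fintype V] [DecidableEq V] (I : ProblemInstance V)

lemma thresholdDist_le_one : thresholdDist I.M I.T I.v I.point ≤ 1 := by
  have hB := I.B_mem
  have hp := I.p_mem
  unfold thresholdDist
  split
  · have hmem : ((0, I.p) : ℝ × ℝ) ∈ valStar I.M I.T I.v .safe := Set.mem_iInter.2 fun i =>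
      side_mem_sval i I.v (mem_square.2 ⟨by norm_num, hp⟩) (Or.inl rfl)
    refine (Metric.infDist_le_dist_of_mem hmem).trans ?_
    rw [Prod.dist_eq, Real.dist_eq, Real.dist_eq]
    simp only [point, sub_self, abs_zero, sub_zero]
    exact max_le (abs_le.2 ⟨by linarith [hB.1], hB.2⟩) zero_le_one
  · have hmem : ((1, I.p) : ℝ × ℝ) ∈ valStar I.M I.T I.v .reach := rval_subset_valStar 0 I.v
      (side_mem_rval 0 I.v (mem_square.2 ⟨by norm_num, hp⟩) (Or.inl rfl))
    refine (Metric.infDist_le_dist_of_mem hmem).trans ?_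
    rw [Prod.dist_eq, Real.dist_eq, Real.dist_eq]
    simp only [point, sub_self, abs_zero]
    exact max_le (abs_le.2 ⟨by linarith [hB.1], by linarith [hB.2]⟩) zero_le_one

/-- Inside the reachability limit, `(B - r, p + r)` is outside the safety limit, hence in some `rval
m`, and the hyperbola bound there gives the point itself, as the product of advantages is `r ^ 2`.
Outside, `rval i` is at least as far away as its limit, so the second test succeeds if the first
fails. -/
lemma verdict_ne_none_of_radius_lt {i : ℕ}
    (h : radius I.M i < thresholdDist I.M I.T I.v I.point) : I.verdict i ≠ none := by
  have hB := I.B_mem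
  have hp := I.p_mem
  have hr := radius_pos I.M i
  unfold thresholdDist at h
  split at h
  · set r := radius I.M i with hrdef
    have hnot : ∀ y ∈ valStar I.M I.T I.v .safe, ¬ dist I.point y ≤ r := fun y hy hd =>
      absurd (Metric.infDist_le_dist_of_mem hy) (not_le.2 (hd.trans_lt h))
    have hBr : 0 ≤ I.B - r := by
      by_contra! hlt
      refine hnot (0, I.p) (Set.mem_iInter.2 fun i =>
        side_mem_sval i I.v (mem_square.2 ⟨by norm_num, hp⟩) (Or.inl rfl)) ?_
      rw [Prod.dist_eq, Real.dist_eq, Real.dist_eq]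
      simp only [point, sub_self, abs_zero, sub_zero]
      exact max_le (abs_le.2 ⟨by linarith [hB.1], by linarith⟩) hr.le
    have hpr : I.p + r ≤ 1 := by
      by_contra! hlt
      refine hnot (I.B, 1) (Set.mem_iInter.2 fun i =>
        side_mem_sval i I.v (mem_square.2 ⟨hB, by norm_num⟩) (Or.inr rfl)) ?_
      rw [Prod.dist_eq, Real.dist_eq, Real.dist_eq]
      simp only [point, sub_self, abs_zero]
      exact max_le hr.le (abs_le.2 ⟨by linarith, by linarith [hp.2]⟩)
    have hsq : (I.B - r, I.p + r) ∈ square :=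
      mem_square.2 ⟨⟨hBr, by simp only; linarith [hB.2]⟩, by simp only; linarith [hp.1], hpr⟩
    have hns : (I.B - r, I.p + r) ∉ valStar I.M I.T I.v .safe := fun hs => by
      refine hnot _ hs ?_
      rw [Prod.dist_eq, Real.dist_eq, Real.dist_eq]
      simp only [point]
      exact max_le (abs_le.2 ⟨by linarith, by linarith⟩) (abs_le.2 ⟨by linarith, by linarith⟩)
    obtain ⟨m, hm⟩ := (mem_valStar_reach_or_mem_valStar_safe (M := I.M) (T := I.T) I.v
      hsq).resolve_right hns
    have hpt : I.point ∈ rval I.M I.T i I.v := by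
      refine hyperbolaBound_radius I.sink i I.v (rval_subset_valStar m I.v hm) _ I.point_mem_square
        (by simp only [point]; linarith) (by simp only [point]; linarith) (le_of_eq ?_)
      simp only [point, ← hrdef]
      ring
    rw [(I.verdict_eq_reach_iff i).2 hpt]
    simp
  · rename_i hnot
    have hpt : I.point ∉ rval I.M I.T i I.v := fun hmem => hnot (rval_subset_valStar i I.v hmem)
    have hle := Metric.infDist_le_infDist_of_subset (x := I.point)
      (rval_subset_valStar (M := I.M) (T := I.T) i I.v)
      ⟨(1, 1), side_mem_rval i I.v (mem_square.2 (by norm_num)) (Or.inl rfl)⟩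
    rw [(I.verdict_eq_safe_iff i).2 ⟨hpt, h.trans_le hle⟩]
    simp

lemma exists_returnsAt_le {ε : ℝ} (hε : 0 < ε) (h : thresholdDist I.M I.T I.v I.point = ε) :
    ∃ j i, I.ReturnsAt j i ∧ (i : ℝ) + 1 ≤ 5 * I.iterationBound ε := by
  have hd0 := deltaMin_pos I.M
  have hn : (0 : ℝ) < Fintype.card V := by exact_mod_cast Fintype.card_pos_iff.2 ⟨I.v⟩
  have hN := I.two_le_iterationBound hε (h ▸ I.thresholdDist_le_one)
  set N := I.iterationBound ε with hNdef
  -- The radius falls to `ε` at the real argument `4 * N`. Rounding and counting iterations from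
  -- zero add at most `2 ≤ N`, whence the factor `5`.
  have hi : (4 * N) < (⌊4 * N⌋₊ + 1 : ℕ) := by exact_mod_cast Nat.lt_floor_add_one (4 * N)
  have hfl := Nat.floor_le (show 0 ≤ 4 * N by linarith)
  obtain ⟨j, k, hk, hret⟩ := I.exists_returnsAt (i := ⌊4 * N⌋₊ + 1)
    (I.verdict_ne_none_of_radius_lt (by
      rw [h, radius]
      set i := ⌊4 * N⌋₊ + 1
      have h1 : Real.log (2 / ε) <
          i * I.M.deltaMin ^ (2 * Fintype.card V) / (4 * Fintype.card V) := by
        rw [lt_div_iff₀ (by positivity)]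
        have : 4 * N * I.M.deltaMin ^ (2 * Fintype.card V) =
            Real.log (2 / ε) * (4 * Fintype.card V) := by
          rw [hNdef, iterationBound]
          field_simp
        rw [← this]
        exact mul_lt_mul_of_pos_right hi (by positivity)
      rw [Real.exp_neg, ← div_eq_mul_inv, div_lt_iff₀ (Real.exp_pos _)]
      have h2 := (Real.log_lt_iff_lt_exp (by positivity)).1 h1
      rw [div_lt_iff₀ hε] at h2
      linarith))
  refine ⟨j, k, hret, ?_⟩
  have hk' : (k : ℝ) ≤ (⌊4 * N⌋₊ + 1 : ℕ) := by exact_mod_cast hk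
  push_cast at hk'
  linarith

end Iterations

/-! ### Agreement of the implementation with the algorithm, and its cost. -/

section Run

open Cost

variable {V : Type*} [Fintype V] [DecidableEq V] (I : ProblemInstance V)

lemma val_runTests (i : ℕ) :
    (runTests I i (cornerTable I.M I.T i)).val = I.verdict i := by
  have hG := represents_cornerTable (M := I.M) (T := I.T) i I.v
  have h1 := hG.contains_eq I.point_mem_square
  have h2 := hG.dist_eq I.point_mem_square
  simp only [point] at h1 h2
  simp only [runTests, val_bind, val_op, val_ite, val_test, val_pure, computeRadius_spec, h1, h2,
    decide_eq_true_eq]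
  unfold verdict radius point
  split_ifs <;> first | rfl | simp_all

lemma val_run {n : ℕ} (h : ∀ k < n, I.verdict k = none) :
    (I.run n).val = (I.verdict n, cornerTable I.M I.T n) := by
  induction n with
  | zero =>
    simp only [run, val_andThen, val_ret]
    exact Prod.ext (I.val_runTests 0) rfl
  | succ n ih =>
    have h1 := ih fun k hk => h k (by omega)
    simp only [run, val_andThen, h1, h n (by omega), val_ret]
    exact Prod.ext (I.val_runTests (n + 1)) rfl

lemma run_succ_of_some {n : ℕ} {j : Player} (h : (I.run n).val.1 = some j) :
    (I.run (n + 1)).val = (I.run n).val ∧ (I.run (n + 1)).time = (I.run n).time ∧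
      (I.run (n + 1)).space = (I.run n).space := by
  simp only [run, andThen, h]
  exact ⟨rfl, rfl, rfl⟩

lemma run_of_returnsAt {i : ℕ} {j : Player} (h : I.ReturnsAt j i) {n : ℕ} (hn : i ≤ n) :
    (I.run n).val.1 = some j ∧ (I.run n).time = (I.run i).time ∧
      (I.run n).space = (I.run i).space := by
  induction n, hn using Nat.le_induction with
  | base =>
    rw [I.val_run h.1]
    exact ⟨h.2, rfl, rfl⟩
  | succ n _ ih =>
    obtain ⟨h1, h2, h3⟩ := I.run_succ_of_some ih.1
    rw [h1, h2, h3]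
    exact ih

lemma run_eq_some_iff (n : ℕ) (j : Player) :
    (I.run n).val.1 = some j ↔ ∃ i ≤ n, I.ReturnsAt j i := by
  constructor
  · intro h
    by_cases hnone : ∀ k < n, I.verdict k = none
    · rw [I.val_run hnone] at h
      exact ⟨n, le_rfl, hnone, h⟩
    · push Not at hnone
      obtain ⟨k, hk, hne⟩ := hnone
      obtain ⟨j', i, hi, hret⟩ := I.exists_returnsAt hne
      have := (I.run_of_returnsAt hret (n := n) (by omega)).1
      rw [this, Option.some_inj] at h
      exact ⟨i, by omega, h ▸ hret⟩
  · rintro ⟨i, hi, hret⟩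
    exact (I.run_of_returnsAt hret hi).1

/-- With `m = max n 2` numerical constants become powers of `m`: a new iteration costs at most `52 *
m ^ (2 * k + 5)`, and `52 ≤ 2 ^ 6 ≤ m ^ 6`. So it at most doubles the bound, within the allowed
factor `m ^ 2`. -/
lemma within_run (k : ℕ) : Within (I.run k) (max (Fintype.card V) 2 ^ (2 * k + 12)) := by
  set n := Fintype.card V with hn
  set m := max n 2 with hm
  have hm2 : 2 ≤ m := le_max_right _ _
  have hnm : n ≤ m := le_max_left _ _
  have hL : ∀ i, ∑ w, (cornerTable I.M I.T i w).length ≤ m ^ (i + 2) := fun i =>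
    (sum_length_cornerTable_le i).trans (by
      rw [pow_succ' m (i + 1)]
      exact Nat.mul_le_mul hm2 (Nat.pow_le_pow_left hnm _))
  have hY : ∀ i, m ^ 2 ≤ m ^ (i + 2) := fun i => Nat.pow_le_pow_right (by omega) (by omega)
  have hmm : m ≤ m ^ 2 := Nat.le_self_pow (by norm_num) m
  have hn2 : n ^ 2 ≤ m ^ 2 := Nat.pow_le_pow_left hnm 2
  have htests : ∀ i, Within (runTests I i (cornerTable I.M I.T i)) (30 * m ^ (i + 2)) := by
    intro i
    refine (I.within_runTests i _).mono ?_
    rw [← hn]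
    have := hL i
    have := hY i
    omega
  have hstep : ∀ i, Within (stepTable I.M (cornerTable I.M I.T i)) (22 * m ^ (2 * i + 5)) := by
    intro i
    refine (within_stepTable _).mono ?_
    have h1 := hL i
    have h2 := hY i
    set Y := m ^ (i + 2) with hYd
    set L := ∑ w, (cornerTable I.M I.T i w).length
    have hY2 : m ^ (2 * i + 5) = m * (Y * Y) := by rw [hYd]; ring
    rw [hY2]
    have hYY : Y ≤ Y * Y := Nat.le_mul_of_pos_left Y (by omega)
    calc n * (3 * n + L * (8 * n + 6 * L + 4) + 1)
        ≤ m * (3 * Y + Y * (8 * Y + 6 * Y + 4 * Y) + Y) := by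
          gcongr <;> omega
      _ ≤ 22 * (m * (Y * Y)) := by nlinarith
  have h64 : 2 ^ 6 ≤ m ^ 6 := Nat.pow_le_pow_left hm2 6
  induction k with
  | zero =>
    refine Within.mono (x := I.run 0) (s := n * 4 + (30 * m ^ (0 + 2) + 0)) ?_ ?_
    · exact ⟨add_le_add (within_initTable I.T).1 (add_le_add (htests 0).1 le_rfl),
        add_le_add (within_initTable I.T).2 (add_le_add (htests 0).2 le_rfl)⟩
    · have h1 : m ^ (2 * 0 + 12) = m ^ 6 * (m ^ 4 * m ^ 2) := by ring
      have h2 : m ^ 2 ≤ m ^ 4 * m ^ 2 := Nat.le_mul_of_pos_left _ (by positivity)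
      have h3 := Nat.mul_le_mul h64 h2
      rw [h1]
      simp only [zero_add]
      omega
  | succ k ih =>
    by_cases hnone : ∀ i < k + 1, I.verdict i = none
    · have hval := I.val_run (n := k) fun i hi => hnone i (by omega)
      rw [hnone k (by omega)] at hval
      have htime : (I.run (k + 1)).time = (I.run k).time +
          ((stepTable I.M (cornerTable I.M I.T k)).time +
            ((runTests I (k + 1) (cornerTable I.M I.T (k + 1))).time + 0)) := by
        simp only [run, andThen, hval]
        rfl
      have hspace : (I.run (k + 1)).space = (I.run k).space +
          ((stepTable I.M (cornerTable I.M I.T k)).space +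
            ((runTests I (k + 1) (cornerTable I.M I.T (k + 1))).space + 0)) := by
        simp only [run, andThen, hval]
        rfl
      have hbound : m ^ (2 * k + 12) + (22 * m ^ (2 * k + 5) + (30 * m ^ (k + 1 + 2) + 0)) ≤
          m ^ (2 * (k + 1) + 12) := by
        have h1 : m ^ (2 * (k + 1) + 12) = m ^ 2 * m ^ (2 * k + 12) := by ring
        have h2 : m ^ (2 * k + 12) = m ^ 6 * (m * m ^ (2 * k + 5)) := by ring
        have h3 : m ^ (2 * k + 5) ≤ m * m ^ (2 * k + 5) := Nat.le_mul_of_pos_left _ (by omega)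
        have h4 := Nat.mul_le_mul h64 h3
        have h5 : m ^ (k + 1 + 2) ≤ m ^ (2 * k + 5) :=
          Nat.pow_le_pow_right (by omega) (by omega)
        have h6 : 2 * m ^ (2 * k + 12) ≤ m ^ 2 * m ^ (2 * k + 12) :=
          Nat.mul_le_mul_right _ (hm2.trans hmm)
        rw [h1]
        rw [← h2] at h4
        omega
      constructor
      · rw [htime]
        exact (add_le_add ih.1 (add_le_add (hstep k).1 (add_le_add (htests (k + 1)).1
          le_rfl))).trans hbound
      · rw [hspace]
        exact (add_le_add ih.2 (add_le_add (hstep k).2 (add_le_add (htests (k + 1)).2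
          le_rfl))).trans hbound
    · push Not at hnone
      obtain ⟨i, hi, hne⟩ := hnone
      obtain ⟨j, i', hi', hret⟩ := I.exists_returnsAt hne
      obtain ⟨-, h2, h3⟩ := I.run_succ_of_some
        (I.run_of_returnsAt hret (n := k) (by omega)).1
      have hmono : m ^ (2 * k + 12) ≤ m ^ (2 * (k + 1) + 12) :=
        Nat.pow_le_pow_right (by omega) (by omega)
      exact ⟨h2 ▸ ih.1.trans hmono, h3 ▸ ih.2.trans hmono⟩

/-- After the answer the run costs nothing more, so the bound does not depend on `n`. -/
lemma within_run_of_returnsAt {i : ℕ} {j : Player} (h : I.ReturnsAt j i) (n : ℕ) :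
    Within (I.run n) (max (Fintype.card V) 2 ^ (12 * (i + 1))) := by
  have hpow : ∀ k ≤ i, max (Fintype.card V) 2 ^ (2 * k + 12) ≤
      max (Fintype.card V) 2 ^ (12 * (i + 1)) := fun k hk =>
    Nat.pow_le_pow_right (by positivity) (by omega)
  rcases le_total n i with hn | hn
  · exact (I.within_run n).mono (hpow n hn)
  · obtain ⟨-, h2, h3⟩ := I.run_of_returnsAt h hn
    have := (I.within_run i).mono (hpow i le_rfl)
    exact ⟨h2 ▸ this.1, h3 ▸ this.2⟩

end Run

end ProblemInstance

end BiddingGame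

end

open BiddingGame in
theorem mainTheorem5 :
    ∃ C : ℝ, 0 < C ∧
      ∀ (V : Type*) [Fintype V] [DecidableEq V] [MeasurableSpace V] [DiscreteMeasurableSpace V]
        (I : ProblemInstance V),
        -- every answer is correct, on every instance
        (∀ i, I.ReturnsAt .reach i →
          I.point ∈ valStar I.M I.T I.v .reach ∧
          (I.B < 1 → (winning I.M I.T I.v I.B I.p .reach).Nonempty)) ∧
        (∀ i, I.ReturnsAt .safe i →
          I.point ∈ squareInterior (valStar I.M I.T I.v .safe) ∧
          (winning I.M I.T I.v I.B I.p .safe).Nonempty ∧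
          ¬ (winning I.M I.T I.v I.B I.p .reach).Nonempty) ∧
        -- off the threshold the algorithm terminates and decides which player wins
        (I.point ∉ threshold I.M I.T I.v →
          ∃ j i, I.ReturnsAt j i ∧
            I.point ∈ squareInterior (valStar I.M I.T I.v j) ∧
            ∀ k, (winning I.M I.T I.v I.B I.p k).Nonempty ↔ k = j) ∧
        -- the implementation by corner points returns the same answers in the same iterations
        (∀ n j, (I.run n).val.1 = some j ↔ ∃ i ≤ n, I.ReturnsAt j i) ∧
        -- number of iterations, time and space at distance `ε` from the threshold
        (∀ ε : ℝ, 0 < ε → thresholdDist I.M I.T I.v I.point = ε →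
          (∃ j i, I.ReturnsAt j i ∧
            (i : ℝ) + 1 ≤ C * (Real.log (2 / ε) * Fintype.card V *
              (I.M.deltaMin ^ (2 * Fintype.card V))⁻¹)) ∧
          ∀ n,
            ((I.run n).time : ℝ) ≤ (max (Fintype.card V : ℝ) 2) ^
              (C * (Real.log (2 / ε) * Fintype.card V *
                (I.M.deltaMin ^ (2 * Fintype.card V))⁻¹)) ∧
            ((I.run n).space : ℝ) ≤ (max (Fintype.card V : ℝ) 2) ^
              (C * (Real.log (2 / ε) * Fintype.card V *
                (I.M.deltaMin ^ (2 * Fintype.card V))⁻¹))) := by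
  -- `60 = 12 * 5`: at most `5 * N` iterations, and an exponent `12` per iteration in the cost.
  refine ⟨60, by norm_num, ?_⟩
  intro V _ _ _ _ I
  refine ⟨fun i hi => ?_, fun i hi => ?_, I.exists_returnsAt_of_not_mem_threshold,
    I.run_eq_some_iff, fun ε hε hdist => ?_⟩
  · have hmem := (I.verdict_eq_reach_iff i).1 hi.2
    exact ⟨rval_subset_valStar i I.v hmem,
      fun hB => reach_winning_of_mem_rval I.sink hmem hB le_rfl I.B_mem.2⟩
  · exact ⟨I.mem_squareInterior_of_returnsAt_safe hi, I.safe_winning_of_returnsAt_safe hi⟩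
  · obtain ⟨j, i, hret, hi⟩ := I.exists_returnsAt_le hε hdist
    rw [ProblemInstance.iterationBound] at hi
    set N := Real.log (2 / ε) * Fintype.card V * (I.M.deltaMin ^ (2 * Fintype.card V))⁻¹
    have hi0 : (0 : ℝ) ≤ i := Nat.cast_nonneg i
    refine ⟨⟨j, i, hret, by linarith⟩, fun n => ?_⟩
    have hbase : (1 : ℝ) ≤ max (Fintype.card V : ℝ) 2 := le_max_of_le_right (by norm_num)
    have hpow : ((max (Fintype.card V) 2 ^ (12 * (i + 1)) : ℕ) : ℝ) ≤
        max (Fintype.card V : ℝ) 2 ^ (60 * N) := by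
      push_cast
      rw [← Real.rpow_natCast]
      refine Real.rpow_le_rpow_of_exponent_le hbase ?_
      push_cast
      linarith
    obtain ⟨htime, hspace⟩ := I.within_run_of_returnsAt hret n
    exact ⟨(Nat.cast_le.2 htime).trans hpow, (Nat.cast_le.2 hspace).trans hpow⟩
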